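/- Let $r\ge 1$ and $k\ge 1$ be fixed integers and let $\mu=(\mu_1,\dots,\mu_r)$ be a fixed probability distribution with $\mu_i>0$ for all $i$. Let $K_{1,n},\dots,K_{r,n},P_n$ be nonnegative integers with $$2\le K_{1,n}\le K_{2,n}\le\cdots\le K_{r,n}\le P_n/2\qquad (n\ge 2),$$ and let $\alpha_n\in(0,1)$. For each $n$, the random graph $\mathbb H_n$ on $n$ nodes is defined as follows. Each node independently belongs to class $i$ with probability $\mu_i$, and a node of class $i$ receives a key ring, chosen uniformly at random among the $K_{i,n}$-element subsets of a pool of $P_n$ keys; the pairs (class, key ring) of the $n$ nodes are i.i.d. The key graph joins two distinct nodes if and only if their key rings intersect. Independently of the classes and key rings, let $\mathbb G(n;\alpha_n)$ be the Erdős–Rényi graph on the same nodes, in which each pair of nodes is joined independently with probability $\alpha_n$. Then $\mathbb H_n$ is the intersection of the two graphs: two nodes are adjacent in $\mathbb H_n$ if and only if they are adjacent in both. Let $p_{1j}(n)=1-\binom{P_n-K_{1,n}}{K_{j,n}}\big/\binom{P_n}{K_{j,n}}$ be the probability that the key rings of a class-$1$ node and a class-$j$ node intersect, and let $\lambda_1(n)=\sum_{j=1}^r\mu_j\,p_{1j}(n)$.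 Define $\gamma_n\in\mathbb R$ for $n\ge 2$ by $$\alpha_n\lambda_1(n)=\frac{\log n+(k-1)\log\log n+\gamma_n}{n}.$$ A graph is called $k$-connected if it has more than $k$ vertices and remains connected after the deletion of any set of fewer than $k$ vertices. All limits and Landau symbols refer to $n\to\infty$. (a) If $\lambda_1(n)=o(1)$ and $\gamma_n\to-\infty$, then $\lim_{n\to\infty}\mathbb P[\mathbb H_n\text{ is }k\text{-connected}]=0$. (b) If $P_n=\Omega(n)$, $K_{r,n}/P_n=o(1)$, $K_{r,n}/K_{1,n}=o(\log n)$ and $\gamma_n\to+\infty$, then $\lim_{n\to\infty}\mathbb P[\mathbb H_n\text{ is }k\text{-connected}]=1$. -/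

import Mathlib

namespace RandomKeyGraph

open MeasureTheory ProbabilityTheory

/-- A graph is `k`-connected if it has more than `k` vertices and stays connected whenever
fewer than `k` of its vertices are deleted. -/
def IsKConnected {V : Type*} [Fintype V] (k : ℕ) (G : SimpleGraph V) : Prop :=
  k < Fintype.card V ∧
    ∀ S : Finset V, S.card < k → (G.induce {v : V | v ∉ S}).Connected

/-- The law of a key ring of size `K`: a uniformly random `K`-element subset of a pool of
`P` keys. -/
noncomputable def keyRingLaw (P K : ℕ) : Measure (Finset (Fin P)) :=
  uniformOn (((Finset.univ : Finset (Fin P)).powersetCard K : Finset (Finset (Fin P))) :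
    Set (Finset (Fin P)))

/-- The joint law of the class and the key ring of one node: the class is `i` with probability
`μ i`, and given the class `i` the key ring has law `keyRingLaw P (K i)`. -/
noncomputable def nodeLaw {r : ℕ} (μ : Fin r → ℝ) (K : Fin r → ℕ) (P : ℕ) :
    Measure (Fin r × Finset (Fin P)) :=
  ∑ i : Fin r, ENNReal.ofReal (μ i) • (Measure.dirac i).prod (keyRingLaw P (K i))

/-- The key graph of an assignment of classes and key rings to the nodes: two distinct nodes
are adjacent if they have at least one key in common. -/
def keyGraph {n r P : ℕ} (x : Fin n → Fin r × Finset (Fin P)) : SimpleGraph (Fin n) where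
  Adj u v := u ≠ v ∧ ((x u).2 ∩ (x v).2).Nonempty
  symm := ⟨fun u v h => ⟨h.1.symm, by rw [Finset.inter_comm]; exact h.2⟩⟩
  loopless := ⟨fun _ h => h.1 rfl⟩

/-- The joint law of the i.i.d. classes and key rings of `n` nodes and of an independent
Erdős–Rényi graph with edge probability `α` on the same nodes. -/
noncomputable def modelLaw (n : ℕ) {r : ℕ} (μ : Fin r → ℝ) (K : Fin r → ℕ) (P : ℕ)
    (α : unitInterval) :
    Measure ((Fin n → Fin r × Finset (Fin P)) × SimpleGraph (Fin n)) :=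
  (Measure.pi fun _ : Fin n => nodeLaw μ K P).prod (SimpleGraph.binomialRandom (Fin n) α)

/-- The intersection of the key graph with the Erdős–Rényi graph. -/
def intersectionGraph {n r P : ℕ}
    (ω : (Fin n → Fin r × Finset (Fin P)) × SimpleGraph (Fin n)) : SimpleGraph (Fin n) :=
  keyGraph ω.1 ⊓ ω.2

/-- The probability that the intersection graph on `n` nodes is `k`-connected. -/
noncomputable def probKConnected (k n : ℕ) {r : ℕ} (μ : Fin r → ℝ) (K : Fin r → ℕ) (P : ℕ)
    (α : unitInterval) : ℝ :=
  (modelLaw n μ K P α).real {ω | IsKConnected k (intersectionGraph ω)}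

/-- The probability that two independent key rings, of sizes `K₁` and `K₂`, drawn from a pool
of `P` keys have a key in common. -/
noncomputable def keyEdgeProb (P K₁ K₂ : ℕ) : ℝ :=
  ((keyRingLaw P K₁).prod (keyRingLaw P K₂)).real {S | (S.1 ∩ S.2).Nonempty}

/-- The mean edge probability, in the key graph, of a node of class `i`. -/
noncomputable def meanEdgeProb {r : ℕ} (μ : Fin r → ℝ) (K : Fin r → ℕ) (P : ℕ) (i : Fin r) : ℝ :=
  ∑ j : Fin r, keyEdgeProb P (K i) (K j) * μ j

/-- Admissible key parameters: `2 ≤ K₁ ≤ K₂ ≤ ⋯ ≤ Kᵣ ≤ P / 2`. -/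
def IsKeyScaling {m : ℕ} (K : ℕ → Fin (m + 1) → ℕ) (P : ℕ → ℕ) : Prop :=
  ∀ n : ℕ, 2 ≤ n →
    2 ≤ K n 0 ∧ Monotone (K n) ∧ (K n (Fin.last m) : ℝ) ≤ (P n : ℝ) / 2

end RandomKeyGraph

open Filter Asymptotics RandomKeyGraph

namespace RandomKeyGraph

open MeasureTheory ProbabilityTheory

/-! Write `s` for `α` times the probability that a class-0 ring meets the ring of a random node, and
`X = n * s`. Given its class, a node has a binomial degree, and class 0 has the smallest link
probability. The expected number of class-0 nodes of degree `k - 1` is of order `n * X ^ (k - 1) *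
exp (-X)`, which for `X` near `log n` is of order `exp (-γ)`. The threshold is therefore the one for
minimum degree `k`, and the work is to show that degrees of different nodes are nearly uncorrelated
below it and that no other cut matters above it.

Part (a) is a second moment argument for the number of class-0 nodes of one fixed degree `d < k`
(`measureReal_forall_notMem_le`, `probKConnected_le_secondMoment`). Given the rings of two nodes,
the other nodes link to them independently of each other, and one node links to both with
probability at most `t * s ^ 2`, where `t` is affine in the number of shared keys. The joint
probability of the two degrees then exceeds the product by a factor exponential in the overlap. The
overlap is hypergeometric, with a moment generating function below the binomial one
(`ringAvg_pow_inter_le`), and `exp_mul_le_of_sparse` shows that the resulting correction vanishes.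

Part (b) is a union bound over small cuts. If the graph is not `k`-connected, some set `T` of at
most half of the nodes has fewer than `k` outer neighbours; for `T` of least size, `T` and its outer
boundary span a connected graph (`exists_grows_of_not_isKConnected`). Singletons are nodes of small
degree, whose expected number vanishes with `exp (-γ)` up to a power of `γ`. For larger `T` one pays
for a spanning tree, or for a free choice of the nodes, and gains a factor `isoProb` for every node
outside, which must have no link to `T`.

Good bounds on `isoProb` need typical rings. `HalfOverlap` makes two nodes of `T` strictly harder to
avoid than one, which settles bounded sizes. `SpreadOn` makes the keys held by `T` grow linearly
with `T`, which settles all other sizes. Both properties hold with probability tending to 1, because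
`P = Ω(n)` and the bound on the ratio of ring sizes force `K 0` to infinity, while `K (Fin.last m) /
P` tends to 0. -/

theorem dependsOn_update {V Ω β : Type*} [DecidableEq V] {F : (V → Ω) → β} {w : V}
    {s : Set V} (hw : w ∉ s)
    (hF : DependsOn F s) (x : V → Ω) (y : Ω) : F (Function.update x w y) = F x :=
  hF fun i hi => Function.update_of_ne (fun h => hw (by rwa [h] at hi)) _ _

/-! ### Expectations over finitely many independent coordinates. -/

section Expectation

variable {V Ω : Type*} [Fintype V] [DecidableEq V] [Fintype Ω]

/-- The expectation of `F` when the coordinates of `x : V → Ω` are independent, each with weight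
function `ν`. -/
noncomputable def expect (ν : Ω → ℝ) (F : (V → Ω) → ℝ) : ℝ :=
  ∑ x : V → Ω, (∏ v, ν (x v)) * F x

theorem expect_mono {ν : Ω → ℝ} (hν : ∀ y, 0 ≤ ν y) {F G : (V → Ω) → ℝ}
    (h : ∀ x, (∀ v, ν (x v) ≠ 0) → F x ≤ G x) : expect ν F ≤ expect ν G := by
  refine Finset.sum_le_sum fun x _ => ?_
  by_cases hx : ∀ v, ν (x v) ≠ 0
  · exact mul_le_mul_of_nonneg_left (h x hx) (Finset.prod_nonneg fun v _ => hν _)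
  · push Not at hx
    obtain ⟨v, hv⟩ := hx
    rw [Finset.prod_eq_zero (Finset.mem_univ v) hv]
    simp

theorem expect_congr {ν : Ω → ℝ} {F G : (V → Ω) → ℝ}
    (h : ∀ x, (∀ v, ν (x v) ≠ 0) → F x = G x) : expect ν F = expect ν G := by
  refine Finset.sum_congr rfl fun x _ => ?_
  by_cases hx : ∀ v, ν (x v) ≠ 0
  · rw [h x hx]
  · push Not at hx
    obtain ⟨v, hv⟩ := hx
    rw [Finset.prod_eq_zero (Finset.mem_univ v) hv]
    simp

theorem expect_mul_const (ν : Ω → ℝ) (F : (V → Ω) → ℝ) (c : ℝ) :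
    expect ν (fun x => F x * c) = expect ν F * c := by
  simp only [expect, Finset.sum_mul, mul_assoc]

theorem expect_const_mul (ν : Ω → ℝ) (F : (V → Ω) → ℝ) (c : ℝ) :
    expect ν (fun x => c * F x) = c * expect ν F := by
  simp only [expect, Finset.mul_sum, mul_left_comm]

theorem expect_sum {ι : Type*} (ν : Ω → ℝ) (s : Finset ι) (F : ι → (V → Ω) → ℝ) :
    expect ν (fun x => ∑ i ∈ s, F i x) = ∑ i ∈ s, expect ν (F i) := by
  simp only [expect, Finset.mul_sum]
  exact Finset.sum_comm

theorem expect_const {ν : Ω → ℝ} (hν1 : ∑ y, ν y = 1) (c : ℝ) :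
    expect (V := V) ν (fun _ => c) = c := by
  simp only [expect, ← Finset.sum_mul]
  have : ∑ x : V → Ω, ∏ v, ν (x v) = ∏ v : V, ∑ y, ν y := by
    rw [Finset.prod_univ_sum]; simp
  rw [this, hν1]; simp

/-- Fubini in one coordinate: the inner sum no longer depends on `x w`, and the weight of `x w` sums
to 1. Independence of the nodes is used later in this form. -/
theorem expect_resample {ν : Ω → ℝ} (hν1 : ∑ y, ν y = 1) (w : V) (F : (V → Ω) → ℝ) :
    expect ν F = expect ν (fun x => ∑ y, ν y * F (Function.update x w y)) := by
  classical
  have key : ∀ G : (V → Ω) → ℝ, expect ν G =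
      ∑ z : {j // j ≠ w} → Ω, (∏ j, ν (z j)) *
        ∑ a, ν a * G ((Equiv.funSplitAt w Ω).symm (a, z)) := by
    intro G
    rw [expect, ← (Equiv.funSplitAt w Ω).symm.sum_comp, Fintype.sum_prod_type, Finset.sum_comm]
    refine Finset.sum_congr rfl fun z _ => ?_
    rw [Finset.mul_sum]
    refine Finset.sum_congr rfl fun a _ => ?_
    have : ∏ v, ν ((Equiv.funSplitAt w Ω).symm (a, z) v) = ν a * ∏ j, ν (z j) := by
      rw [← Finset.mul_prod_erase _ _ (Finset.mem_univ w)]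
      congr 1
      · simp [Equiv.funSplitAt, Equiv.piSplitAt]
      · rw [Finset.prod_subtype (p := fun j => j ≠ w) (Finset.univ.erase w) (by simp)
          (fun j => ν ((Equiv.funSplitAt w Ω).symm (a, z) j))]
        refine Fintype.prod_congr _ _ fun j => ?_
        simp [Equiv.funSplitAt, Equiv.piSplitAt, j.2]
    rw [this]; ring
  rw [key F, key]
  refine Finset.sum_congr rfl fun z _ => ?_
  congr 1
  have : ∀ a y, Function.update ((Equiv.funSplitAt w Ω).symm (a, z)) w y =
      (Equiv.funSplitAt w Ω).symm (y, z) := by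
    intro a y
    ext1 v
    by_cases hv : v = w
    · subst hv; simp [Equiv.funSplitAt, Equiv.piSplitAt]
    · simp [Equiv.funSplitAt, Equiv.piSplitAt, hv]
  simp only [this, ← Finset.sum_mul, hν1, one_mul]

/-- Integrating out the coordinates in `R`, when each of them enters one factor only. -/
theorem expect_mul_prod {ν : Ω → ℝ} (hν1 : ∑ y, ν y = 1) (R : Finset V)
    (G : (V → Ω) → ℝ) (hG : DependsOn G (Rᶜ : Set V))
    (h : V → Ω → (V → Ω) → ℝ) (hh : ∀ w y, DependsOn (h w y) (Rᶜ : Set V)) :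
    expect ν (fun x => G x * ∏ w ∈ R, h w (x w) x) =
      expect ν (fun x => G x * ∏ w ∈ R, ∑ y, ν y * h w y x) := by
  -- `R'` is the set of coordinates already integrated out. Resampling one more is harmless because
  -- the prefactor and the other factors ignore it.
  suffices H : ∀ R' ⊆ R, expect ν (fun x => G x * ∏ w ∈ R, h w (x w) x) =
      expect ν (fun x => G x * (∏ w ∈ R', ∑ y, ν y * h w y x) * ∏ w ∈ R \ R', h w (x w) x) by
    rw [H R subset_rfl]
    simp
  intro R' hR'
  induction R' using Finset.induction_on with
  | empty => simp
  | insert w R' hw ih =>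
    have hwR : w ∈ R := hR' (Finset.mem_insert_self _ _)
    have hwC : w ∉ (Rᶜ : Set V) := by simpa using hwR
    rw [ih fun a ha => hR' (Finset.mem_insert_of_mem ha), expect_resample hν1 w]
    refine expect_congr fun x _ => ?_
    have hsd : R \ R' = insert w (R \ insert w R') := by
      ext a; simp only [Finset.mem_sdiff, Finset.mem_insert]
      constructor
      · rintro ⟨h1, h2⟩; by_cases ha : a = w <;> simp [ha, h1, h2]
      · rintro (rfl | ⟨h1, h2⟩)
        · exact ⟨hwR, hw⟩
        · exact ⟨h1, fun h3 => h2 (Or.inr h3)⟩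
    have hnot : w ∉ R \ insert w R' := by simp
    simp only [hsd, Finset.prod_insert hnot, Finset.prod_insert hw, Function.update_self,
      dependsOn_update hwC hG, dependsOn_update hwC (hh _ _)]
    have hrest : ∀ y, ∏ a ∈ R \ insert w R', h a (Function.update x w y a) x =
        ∏ a ∈ R \ insert w R', h a (x a) x := by
      intro y
      refine Finset.prod_congr rfl fun a ha => ?_
      rw [Function.update_of_ne]
      rintro rfl; exact hnot ha
    simp only [hrest]
    rw [Finset.sum_mul, Finset.mul_sum, Finset.sum_mul]
    refine Finset.sum_congr rfl fun y _ => by ring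

end Expectation

/-! ### The law of the model as a finite weighted sum. -/

section Law

variable {r : ℕ}

/-- The probability that a node has a given class and key ring. -/
noncomputable def nodeWeight (μ : Fin r → ℝ) (K : Fin r → ℕ) (P : ℕ)
    (y : Fin r × Finset (Fin P)) : ℝ :=
  μ y.1 * if y.2.card = K y.1 then ((P.choose (K y.1) : ℝ))⁻¹ else 0

/-- The average of `g` over the key rings of size `K`. -/
noncomputable def ringAvg (P K : ℕ) (g : Finset (Fin P) → ℝ) : ℝ :=
  (∑ S ∈ (Finset.univ : Finset (Fin P)).powersetCard K, g S) / (P.choose K : ℝ)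

theorem keyRingLaw_singleton (P K : ℕ) (S : Finset (Fin P)) :
    keyRingLaw P K {S} = if S.card = K then ((P.choose K : ENNReal))⁻¹ else 0 := by
  classical
  have := uniformOn_apply_finset (s := (Finset.univ : Finset (Fin P)).powersetCard K) (t := {S})
  rw [Finset.coe_singleton] at this
  rw [keyRingLaw, this]
  split_ifs with h
  · rw [Finset.inter_singleton_of_mem (by simp [h])]
    simp
  · rw [Finset.inter_singleton_of_notMem (by simp [h])]
    simp

theorem isProbabilityMeasure_keyRingLaw {P K : ℕ} (h : K ≤ P) :
    IsProbabilityMeasure (keyRingLaw P K) := by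
  refine isProbabilityMeasure_uniformOn (Finset.finite_toSet _) ?_
  rw [Finset.coe_nonempty, Finset.powersetCard_nonempty]
  simpa using h

theorem isProbabilityMeasure_nodeLaw {μ : Fin r → ℝ} (hμ : ∀ i, 0 ≤ μ i) (hμ1 : ∑ i, μ i = 1)
    {K : Fin r → ℕ} {P : ℕ} (hK : ∀ i, K i ≤ P) : IsProbabilityMeasure (nodeLaw μ K P) := by
  refine ⟨?_⟩
  have := fun i => isProbabilityMeasure_keyRingLaw (hK i)
  rw [nodeLaw, Measure.coe_finsetSum, Finset.sum_apply]
  simp only [Measure.smul_apply, measure_univ, smul_eq_mul, mul_one]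
  rw [← ENNReal.ofReal_sum_of_nonneg fun i _ => hμ i, hμ1, ENNReal.ofReal_one]

theorem nodeLaw_real_singleton {μ : Fin r → ℝ} (hμ : ∀ i, 0 ≤ μ i)
    {K : Fin r → ℕ} {P : ℕ} (hK : ∀ i, K i ≤ P) (y : Fin r × Finset (Fin P)) :
    (nodeLaw μ K P).real {y} = nodeWeight μ K P y := by
  obtain ⟨c, S⟩ := y
  have := fun i => isProbabilityMeasure_keyRingLaw (hK i)
  rw [Measure.real, nodeLaw, Measure.coe_finsetSum, Finset.sum_apply, ← Set.singleton_prod_singleton]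
  simp only [Measure.smul_apply, smul_eq_mul, Measure.prod_prod, keyRingLaw_singleton]
  rw [Finset.sum_eq_single c]
  · rw [nodeWeight]
    split_ifs <;> simp [ENNReal.toReal_ofReal (hμ c)]
  · intro b _ hb
    simp [hb]
  · simp

theorem nodeWeight_nonneg {μ : Fin r → ℝ} (hμ : ∀ i, 0 ≤ μ i) (K : Fin r → ℕ) (P : ℕ)
    (y : Fin r × Finset (Fin P)) : 0 ≤ nodeWeight μ K P y := by
  unfold nodeWeight
  have := hμ y.1
  split_ifs <;> positivity

theorem card_of_nodeWeight_ne_zero {μ : Fin r → ℝ} {K : Fin r → ℕ} {P : ℕ}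
    {y : Fin r × Finset (Fin P)} (h : nodeWeight μ K P y ≠ 0) : y.2.card = K y.1 := by
  by_contra h'
  simp [nodeWeight, h'] at h

theorem sum_nodeWeight_mul (μ : Fin r → ℝ) (K : Fin r → ℕ) (P : ℕ)
    (g : Fin r × Finset (Fin P) → ℝ) :
    ∑ y, nodeWeight μ K P y * g y = ∑ j, μ j * ringAvg P (K j) (fun S => g (j, S)) := by
  classical
  rw [Fintype.sum_prod_type]
  refine Finset.sum_congr rfl fun j _ => ?_
  rw [ringAvg, div_eq_inv_mul, Finset.mul_sum, Finset.mul_sum]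
  rw [← Finset.univ_filter_card_eq, Finset.sum_filter]
  refine Finset.sum_congr rfl fun S _ => ?_
  simp only [nodeWeight]
  split_ifs <;> ring

theorem sum_nodeWeight {μ : Fin r → ℝ} (hμ1 : ∑ i, μ i = 1)
    {K : Fin r → ℕ} {P : ℕ} (hK : ∀ i, K i ≤ P) : ∑ y, nodeWeight μ K P y = 1 := by
  have := sum_nodeWeight_mul μ K P (fun _ => 1)
  simp only [mul_one] at this
  rw [this]
  refine Eq.trans (Finset.sum_congr rfl fun j _ => ?_) hμ1
  have hpos : (0 : ℝ) < P.choose (K j) := by exact_mod_cast Nat.choose_pos (hK j)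
  rw [ringAvg]
  simp [hpos.ne']

theorem keyRingLaw_real {P K : ℕ} (g : Set (Finset (Fin P)))
    [DecidablePred (· ∈ g)] :
    (keyRingLaw P K).real g = ringAvg P K (fun S => if S ∈ g then 1 else 0) := by
  classical
  have := uniformOn_apply_finset (s := (Finset.univ : Finset (Fin P)).powersetCard K)
    (t := Finset.univ.filter (· ∈ g))
  have h2 : ((Finset.univ.filter (· ∈ g) : Finset (Finset (Fin P))) : Set (Finset (Fin P))) = g := by
    ext; simp
  rw [h2] at this
  rw [Measure.real, keyRingLaw, this, ringAvg, ENNReal.toReal_div, ENNReal.toReal_natCast,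
    ENNReal.toReal_natCast, Finset.card_powersetCard, Finset.card_univ, Fintype.card_fin,
    ← Finset.filter_mem_eq_inter, Finset.card_filter]
  simp

theorem keyEdgeProb_eq {P K₁ K₂ : ℕ} (h₁ : K₁ ≤ P) (h₂ : K₂ ≤ P) :
    keyEdgeProb P K₁ K₂ =
      ringAvg P K₁ (fun S => ringAvg P K₂ (fun S' => if (S ∩ S').Nonempty then 1 else 0)) := by
  classical
  have := isProbabilityMeasure_keyRingLaw h₁
  have := isProbabilityMeasure_keyRingLaw h₂
  rw [keyEdgeProb, Measure.real, Measure.prod_apply (Set.toFinite _).measurableSet,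
    lintegral_fintype, ENNReal.toReal_sum (by intros; finiteness), ringAvg, div_eq_inv_mul,
    Finset.mul_sum, ← Finset.univ_filter_card_eq, Finset.sum_filter]
  refine Finset.sum_congr rfl fun S _ => ?_
  have h3 := keyRingLaw_real (P := P) (K := K₂) (Prod.mk S ⁻¹' {S | (S.1 ∩ S.2).Nonempty})
  rw [Measure.real] at h3
  rw [ENNReal.toReal_mul, h3, keyRingLaw_singleton]
  split_ifs with h
  · rw [ENNReal.toReal_inv, ENNReal.toReal_natCast, mul_comm]
    simp only [Set.mem_preimage, Set.mem_ofPred_eq]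
  · simp

theorem modelLaw_real {n : ℕ} {μ : Fin r → ℝ} (hμ : ∀ i, 0 ≤ μ i) (hμ1 : ∑ i, μ i = 1)
    {K : Fin r → ℕ} {P : ℕ} (hK : ∀ i, K i ≤ P) (α : unitInterval)
    {A : Set ((Fin n → Fin r × Finset (Fin P)) × SimpleGraph (Fin n))} (hA : MeasurableSet A) :
    (modelLaw n μ K P α).real A = expect (nodeWeight μ K P)
      (fun x => (SimpleGraph.binomialRandom (Fin n) α).real {g | (x, g) ∈ A}) := by
  classical
  have := isProbabilityMeasure_nodeLaw hμ hμ1 hK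
  rw [modelLaw, Measure.real, Measure.prod_apply hA,
    lintegral_fintype, ENNReal.toReal_sum (by intros; finiteness), expect]
  refine Finset.sum_congr rfl fun x _ => ?_
  rw [ENNReal.toReal_mul, Measure.pi_singleton, ENNReal.toReal_prod, mul_comm]
  congr 1
  exact Finset.prod_congr rfl fun v _ => nodeLaw_real_singleton hμ hK _

/-- All events below live on finite spaces; this makes their measurability automatic. -/
theorem measurableSet_simpleGraph {V : Type*} [Finite V] (s : Set (SimpleGraph V)) :
    MeasurableSet s := by
  rw [← SimpleGraph.measurableEmbedding_edgeSet.measurableSet_image]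
  exact (Set.toFinite _).measurableSet

instance {V : Type*} [Finite V] : DiscreteMeasurableSpace (SimpleGraph V) :=
  ⟨measurableSet_simpleGraph⟩

/-- `fromEdgeSet` discards diagonal pairs, hence the conditions excluding loops. Without loops the
event pulls back to a box in the product of Bernoulli variables indexed by `Sym2 V`. -/
theorem binomialRandom_real_cylinder {V : Type*} [Fintype V] [DecidableEq V] (α : unitInterval)
    (F₁ F₀ : Finset (Sym2 V)) (hd : Disjoint F₁ F₀) (h₁ : ∀ e ∈ F₁, ¬ e.IsDiag)
    (h₀ : ∀ e ∈ F₀, ¬ e.IsDiag) :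
    (SimpleGraph.binomialRandom V α).real {g | (∀ e ∈ F₁, e ∈ g.edgeSet) ∧
      ∀ e ∈ F₀, e ∉ g.edgeSet} = (α : ℝ) ^ F₁.card * (1 - (α : ℝ)) ^ F₀.card := by
  classical
  rw [Measure.real, SimpleGraph.binomialRandom_eq_map,
    Measure.map_apply SimpleGraph.measurable_fromEdgeSet (measurableSet_simpleGraph _),
    setBernoulli_apply']
  have hset : ((fun p : Sym2 V → Prop => {i | p i}) ⁻¹' (SimpleGraph.fromEdgeSet ⁻¹'
      {g : SimpleGraph V | (∀ e ∈ F₁, e ∈ g.edgeSet) ∧ ∀ e ∈ F₀, e ∉ g.edgeSet})) =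
      ((F₁ ∪ F₀ : Finset (Sym2 V)) : Set (Sym2 V)).pi
        (fun e => if e ∈ F₁ then {True} else {False}) := by
    ext p
    simp only [Set.mem_preimage, Set.mem_ofPred_eq, SimpleGraph.edgeSet_fromEdgeSet, Set.mem_pi,
      Set.mem_sdiff, Finset.coe_union, Set.mem_union, Finset.mem_coe]
    constructor
    · rintro ⟨a, b⟩ e he
      by_cases h1 : e ∈ F₁
      · simpa [h1] using (a e h1).1
      · have h0 : e ∈ F₀ := by tauto
        have := b e h0
        simp only [h1, if_false, Set.mem_singleton_iff, eq_iff_iff, iff_false]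
        intro hp
        exact this ⟨hp, h₀ e h0⟩
    · intro h
      refine ⟨fun e he => ⟨?_, h₁ e he⟩, fun e he hp => ?_⟩
      · simpa [he] using h e (Or.inl he)
      · have h1 : e ∉ F₁ := fun h1 => (Finset.disjoint_left.1 hd) h1 he
        have := h e (Or.inr he)
        simp only [h1, if_false, Set.mem_singleton_iff, eq_iff_iff, iff_false] at this
        exact this hp.1
  rw [hset, Measure.infinitePi_pi _ (fun i _ => by split_ifs <;> exact MeasurableSet.of_discrete),
    ENNReal.toReal_prod, Finset.prod_union hd]
  congr 1
  · rw [← Finset.prod_const]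
    refine Finset.prod_congr rfl fun e he => ?_
    have := h₁ e he
    simp [he, this]
  · rw [← Finset.prod_const]
    refine Finset.prod_congr rfl fun e he => ?_
    have h1 : e ∉ F₁ := fun h1 => (Finset.disjoint_left.1 hd) h1 he
    have := h₀ e he
    simp [h1, this]

open scoped Classical in
/-- The probability that the edges in `F₁` are present and those in `F₀` absent, jointly with an
event about classes and key rings. -/
theorem modelLaw_real_cylinder {n : ℕ} {μ : Fin r → ℝ} (hμ : ∀ i, 0 ≤ μ i) (hμ1 : ∑ i, μ i = 1)
    {K : Fin r → ℕ} {P : ℕ} (hK : ∀ i, K i ≤ P) (α : unitInterval)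
    (Φ : (Fin n → Fin r × Finset (Fin P)) → Prop)
    (F₁ F₀ : Finset (Sym2 (Fin n))) (hd : Disjoint F₁ F₀) (h₁ : ∀ e ∈ F₁, ¬ e.IsDiag)
    (h₀ : ∀ e ∈ F₀, ¬ e.IsDiag) :
    (modelLaw n μ K P α).real {ω | Φ ω.1 ∧ (∀ e ∈ F₁, e ∈ (intersectionGraph ω).edgeSet) ∧
      ∀ e ∈ F₀, e ∉ (intersectionGraph ω).edgeSet} =
    expect (nodeWeight μ K P) (fun x => (if Φ x then 1 else 0) *
      (∏ e ∈ F₁, (α : ℝ) * if e ∈ (keyGraph x).edgeSet then 1 else 0) *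
      ∏ e ∈ F₀, (1 - (α : ℝ) * if e ∈ (keyGraph x).edgeSet then 1 else 0)) := by
  rw [modelLaw_real hμ hμ1 hK α MeasurableSet.of_discrete]
  refine expect_congr fun x _ => ?_
  by_cases hΦ : Φ x
  swap
  · simp [hΦ]
  -- With the rings fixed, a required pair without a common key makes the event impossible, and a
  -- forbidden pair without a common key is absent for free. Only the forbidden pairs in the key
  -- graph constrain the Erdős–Rényi graph.
  by_cases h1 : ∀ e ∈ F₁, e ∈ (keyGraph x).edgeSet
  · have hset : {g : SimpleGraph (Fin n) | (x, g) ∈ {ω | Φ ω.1 ∧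
        (∀ e ∈ F₁, e ∈ (intersectionGraph ω).edgeSet) ∧
        ∀ e ∈ F₀, e ∉ (intersectionGraph ω).edgeSet}} =
        {g | (∀ e ∈ F₁, e ∈ g.edgeSet) ∧
          ∀ e ∈ F₀.filter (· ∈ (keyGraph x).edgeSet), e ∉ g.edgeSet} := by
      ext g
      simp only [Set.mem_ofPred_eq, intersectionGraph, SimpleGraph.edgeSet_inf, Set.mem_inter_iff,
        hΦ, true_and, Finset.mem_filter]
      constructor
      · rintro ⟨a, b⟩
        exact ⟨fun e he => (a e he).2, fun e he hg => b e he.1 ⟨he.2, hg⟩⟩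
      · rintro ⟨a, b⟩
        exact ⟨fun e he => ⟨h1 e he, a e he⟩, fun e he hg => b e ⟨he, hg.1⟩ hg.2⟩
    rw [hset, binomialRandom_real_cylinder α F₁ _
      (hd.mono_right (Finset.filter_subset _ _)) h₁
      (fun e he => h₀ e (Finset.mem_filter.1 he).1)]
    rw [if_pos hΦ, one_mul]
    congr 1
    · rw [← Finset.prod_const]
      exact Finset.prod_congr rfl fun e he => by simp [h1 e he]
    · rw [← Finset.prod_const, Finset.prod_filter]
      refine Finset.prod_congr rfl fun e he => ?_
      split_ifs <;> simp
  · push Not at h1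
    obtain ⟨e, he, hne⟩ := h1
    rw [Finset.prod_eq_zero he (by simp [hne])]
    have hset : {g : SimpleGraph (Fin n) | (x, g) ∈ {ω | Φ ω.1 ∧
        (∀ e ∈ F₁, e ∈ (intersectionGraph ω).edgeSet) ∧
        ∀ e ∈ F₀, e ∉ (intersectionGraph ω).edgeSet}} = ∅ := by
      ext g
      simp only [Set.mem_ofPred_eq, intersectionGraph, SimpleGraph.edgeSet_inf, Set.mem_inter_iff,
        Set.mem_empty_iff_false, iff_false]
      rintro ⟨-, a, -⟩
      exact hne (a e he).1
    rw [hset]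
    simp

end Law

end RandomKeyGraph

namespace RandomKeyGraph

open MeasureTheory ProbabilityTheory

/-! ### Uniformly random key rings: missing, hitting and containing given keys. -/

section Ring

variable {P K : ℕ}

theorem ringAvg_mono {g g' : Finset (Fin P) → ℝ} (h : ∀ S, S.card = K → g S ≤ g' S) :
    ringAvg P K g ≤ ringAvg P K g' := by
  refine div_le_div_of_nonneg_right (Finset.sum_le_sum fun S hS => h S ?_) (by positivity)
  exact (Finset.mem_powersetCard.1 hS).2

theorem ringAvg_congr {g g' : Finset (Fin P) → ℝ} (h : ∀ S, S.card = K → g S = g' S) :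
    ringAvg P K g = ringAvg P K g' :=
  le_antisymm (ringAvg_mono fun S hS => (h S hS).le) (ringAvg_mono fun S hS => (h S hS).ge)

theorem ringAvg_const (hK : K ≤ P) (c : ℝ) : ringAvg P K (fun _ => c) = c := by
  have hpos : (0 : ℝ) < P.choose K := by exact_mod_cast Nat.choose_pos hK
  rw [ringAvg]
  simp only [Finset.sum_const, Finset.card_powersetCard, Finset.card_univ, Fintype.card_fin,
    nsmul_eq_mul]
  field_simp

theorem ringAvg_add (g g' : Finset (Fin P) → ℝ) :
    ringAvg P K (fun S => g S + g' S) = ringAvg P K g + ringAvg P K g' := by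
  simp only [ringAvg, Finset.sum_add_distrib, add_div]

theorem ringAvg_sub (g g' : Finset (Fin P) → ℝ) :
    ringAvg P K (fun S => g S - g' S) = ringAvg P K g - ringAvg P K g' := by
  simp only [ringAvg, Finset.sum_sub_distrib, sub_div]

theorem ringAvg_const_mul (c : ℝ) (g : Finset (Fin P) → ℝ) :
    ringAvg P K (fun S => c * g S) = c * ringAvg P K g := by
  simp only [ringAvg, ← Finset.mul_sum, mul_div_assoc]

theorem ringAvg_sum {ι : Type*} (s : Finset ι) (g : ι → Finset (Fin P) → ℝ) :
    ringAvg P K (fun S => ∑ i ∈ s, g i S) = ∑ i ∈ s, ringAvg P K (g i) := by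
  simp only [ringAvg, Finset.sum_div]
  exact Finset.sum_comm

/-- The probability that a uniformly random `K`-subset of a `P`-set misses a given `a`-subset. -/
noncomputable def missProb (P K a : ℕ) : ℝ := ((P - a).choose K : ℝ) / (P.choose K : ℝ)

theorem ringAvg_disjoint (U : Finset (Fin P)) :
    ringAvg P K (fun S => if Disjoint S U then 1 else 0) = missProb P K U.card := by
  rw [ringAvg, missProb, ← Finset.sum_filter]
  congr 1
  rw [Finset.sum_const, nsmul_eq_mul, mul_one]
  congr 1
  have : ((Finset.univ : Finset (Fin P)).powersetCard K).filter (fun S => Disjoint S U) =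
      (Uᶜ).powersetCard K := by
    ext S
    simp only [Finset.mem_filter, Finset.mem_powersetCard, Finset.subset_univ, true_and,
      Finset.subset_compl_iff_disjoint_right]
    tauto
  rw [this, Finset.card_powersetCard, Finset.card_compl, Fintype.card_fin]

theorem missProb_nonneg (P K a : ℕ) : 0 ≤ missProb P K a := by unfold missProb; positivity

theorem missProb_le_one (P K a : ℕ) : missProb P K a ≤ 1 := by
  refine div_le_one_of_le₀ ?_ (by positivity)
  exact_mod_cast Nat.choose_le_choose _ (Nat.sub_le _ _)

theorem missProb_anti (P K : ℕ) {a b : ℕ} (h : a ≤ b) : missProb P K b ≤ missProb P K a := by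
  refine div_le_div_of_nonneg_right ?_ (by positivity)
  exact_mod_cast Nat.choose_le_choose _ (Nat.sub_le_sub_left h _)

theorem missProb_zero (P a : ℕ) : missProb P 0 a = 1 := by simp [missProb]

/-- Keys are drawn one at a time; the new factor is the conditional probability that the next key
also misses. The bounds below are inductions on the ring size through this recursion. -/
theorem missProb_succ (a : ℕ) (hK : K < P) :
    missProb P (K + 1) a = missProb P K a * (((P - a - K : ℕ) : ℝ) / ((P - K : ℕ) : ℝ)) := by
  have h1 : ((P - a).choose (K + 1) : ℝ) * (K + 1) = (P - a).choose K * ((P - a - K : ℕ) : ℝ) := by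
    exact_mod_cast Nat.choose_succ_right_eq (P - a) K
  have h2 : (P.choose (K + 1) : ℝ) * (K + 1) = P.choose K * ((P - K : ℕ) : ℝ) := by
    exact_mod_cast Nat.choose_succ_right_eq P K
  have hp : (0 : ℝ) < P.choose K := by exact_mod_cast Nat.choose_pos hK.le
  have hp' : (0 : ℝ) < P.choose (K + 1) := by exact_mod_cast Nat.choose_pos hK
  have hq : (0 : ℝ) < ((P - K : ℕ) : ℝ) := by exact_mod_cast Nat.sub_pos_of_lt hK
  have hk : (0 : ℝ) < (K : ℝ) + 1 := by positivity
  unfold missProb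
  rw [div_mul_div_comm, ← h1, ← h2, mul_div_mul_right _ _ hk.ne']

/-- Drawing without replacement, each key misses with conditional probability at most `1 - a / P`.
-/
theorem missProb_le_pow {a : ℕ} (hK : K ≤ P) (ha : a ≤ P) :
    missProb P K a ≤ (1 - (a : ℝ) / P) ^ K := by
  induction K with
  | zero => simp [missProb_zero]
  | succ K ih =>
    have hKP : K < P := hK
    have hP : (0 : ℝ) < P := by exact_mod_cast (Nat.zero_le K).trans_lt hKP
    have haP : (a : ℝ) ≤ P := by exact_mod_cast ha
    have h0 : 0 ≤ 1 - (a : ℝ) / P := by rw [sub_nonneg]; exact div_le_one_of_le₀ haP hP.le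
    rw [missProb_succ a hKP, pow_succ]
    refine mul_le_mul (ih hKP.le) ?_ (by positivity) (by positivity)
    have hq : (0 : ℝ) < ((P - K : ℕ) : ℝ) := by exact_mod_cast Nat.sub_pos_of_lt hKP
    -- In the other case the truncated subtraction makes the new factor zero.
    by_cases h : a + K ≤ P
    · have e1 : ((P - a - K : ℕ) : ℝ) = P - a - K := by
        rw [Nat.sub_sub, Nat.cast_sub h]; push_cast; ring
      have e2 : ((P - K : ℕ) : ℝ) = P - K := by rw [Nat.cast_sub hKP.le]
      rw [e2] at hq
      rw [e1, e2, div_le_iff₀ hq]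
      have : (1 - (a : ℝ) / P) * (P - K) = P - a - K + a * K / P := by field_simp; ring
      rw [this]
      have : 0 ≤ (a : ℝ) * K / P := by positivity
      linarith
    · have : P - a - K = 0 := by omega
      rw [this]; simpa using h0

theorem missProb_le_exp {a : ℕ} (hK : K ≤ P) (ha : a ≤ P) :
    missProb P K a ≤ Real.exp (-((a : ℝ) * K / P)) := by
  rcases Nat.eq_zero_or_pos P with rfl | hP
  · simpa using missProb_le_one 0 K a
  have hP' : (0 : ℝ) < P := by exact_mod_cast hP
  have haP : (a : ℝ) ≤ P := by exact_mod_cast ha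
  have h0 : 0 ≤ 1 - (a : ℝ) / P := by rw [sub_nonneg]; exact div_le_one_of_le₀ haP hP'.le
  refine (missProb_le_pow hK ha).trans ?_
  have h1 : 1 - (a : ℝ) / P ≤ Real.exp (-((a : ℝ) / P)) := Real.one_sub_le_exp_neg _
  refine (pow_le_pow_left₀ h0 h1 K).trans ?_
  rw [← Real.exp_nat_mul]
  refine le_of_eq ?_
  congr 1; ring

/-- Missing two disjoint sets is negatively correlated: at a draw with `N` keys left the claim is `N
* (N - a - b) ≤ (N - a) * (N - b)`. -/
theorem missProb_add_le {a b : ℕ} (hK : K ≤ P) :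
    missProb P K (a + b) ≤ missProb P K a * missProb P K b := by
  induction K with
  | zero => simp [missProb_zero]
  | succ K ih =>
    have hKP : K < P := hK
    rw [missProb_succ _ hKP, missProb_succ _ hKP, missProb_succ _ hKP]
    have hq : (0 : ℝ) < ((P - K : ℕ) : ℝ) := by exact_mod_cast Nat.sub_pos_of_lt hKP
    have hna := missProb_nonneg P K a
    have hnb := missProb_nonneg P K b
    rw [mul_mul_mul_comm]
    refine mul_le_mul (ih hKP.le) ?_ (by positivity) (by positivity)
    rw [div_mul_div_comm, div_le_div_iff₀ hq (by positivity)]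
    by_cases h : a + b + K ≤ P
    · have e1 : ((P - (a + b) - K : ℕ) : ℝ) = P - a - b - K := by
        rw [Nat.sub_sub, Nat.cast_sub h]; push_cast; ring
      have e2 : ((P - K : ℕ) : ℝ) = P - K := by rw [Nat.cast_sub hKP.le]
      have e3 : ((P - a - K : ℕ) : ℝ) = P - a - K := by
        rw [Nat.sub_sub, Nat.cast_sub (by omega)]; push_cast; ring
      have e4 : ((P - b - K : ℕ) : ℝ) = P - b - K := by
        rw [Nat.sub_sub, Nat.cast_sub (by omega)]; push_cast; ring
      rw [e2] at hq
      rw [e1, e2, e3, e4]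
      have : 0 ≤ (a : ℝ) * b * (P - K) := by positivity
      nlinarith
    · have : P - (a + b) - K = 0 := by omega
      rw [this]
      have : (0 : ℝ) ≤ ((P - a - K : ℕ) : ℝ) * ((P - b - K : ℕ) : ℝ) * ((P - K : ℕ) : ℝ) := by
        positivity
      simpa using this

theorem card_powersetCard_filter_superset (B : Finset (Fin P)) (hB : B.card ≤ K) :
    (((Finset.univ : Finset (Fin P)).powersetCard K).filter (fun S => B ⊆ S)).card =
      (P - B.card).choose (K - B.card) := by
  have : (P - B.card).choose (K - B.card) = ((Bᶜ).powersetCard (K - B.card)).card := by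
    rw [Finset.card_powersetCard, Finset.card_compl, Fintype.card_fin]
  rw [this]
  refine Finset.card_nbij' (fun S => S \ B) (fun S => S ∪ B) ?_ ?_ ?_ ?_
  · intro S hS
    simp only [Finset.coe_filter, Finset.mem_powersetCard, Finset.subset_univ, true_and,
      Set.mem_ofPred_eq] at hS
    simp only [Finset.mem_coe, Finset.mem_powersetCard, Finset.card_sdiff_of_subset hS.2, hS.1,
      and_true]
    rw [Finset.subset_compl_iff_disjoint_right]
    exact Finset.sdiff_disjoint
  · intro S hS
    simp only [Finset.mem_coe, Finset.mem_powersetCard,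
      Finset.subset_compl_iff_disjoint_right] at hS
    simp only [Finset.coe_filter, Finset.mem_powersetCard, Finset.subset_univ, true_and,
      Set.mem_ofPred_eq, Finset.card_union_of_disjoint hS.1, hS.2]
    exact ⟨by omega, Finset.subset_union_right⟩
  · intro S hS
    simp only [Finset.coe_filter, Finset.mem_powersetCard, Finset.subset_univ, true_and,
      Set.mem_ofPred_eq] at hS
    exact Finset.sdiff_union_of_subset hS.2
  · intro S hS
    simp only [Finset.mem_coe, Finset.mem_powersetCard,
      Finset.subset_compl_iff_disjoint_right] at hS
    exact Finset.union_sdiff_cancel_right hS.1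

theorem ringAvg_superset_le (hK : K ≤ P) (B : Finset (Fin P)) :
    ringAvg P K (fun S => if B ⊆ S then 1 else 0) ≤ ((K : ℝ) / P) ^ B.card := by
  rw [ringAvg, ← Finset.sum_filter, Finset.sum_const, nsmul_eq_mul, mul_one]
  by_cases hB : B.card ≤ K
  · rw [card_powersetCard_filter_superset B hB]
    have hbP : B.card ≤ P := hB.trans hK
    have h1 : (P.choose K : ℝ) * K.choose B.card =
        P.choose B.card * (P - B.card).choose (K - B.card) := by
      exact_mod_cast Nat.choose_mul hB
    have hp : (0 : ℝ) < P.choose K := by exact_mod_cast Nat.choose_pos hK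
    have hp' : (0 : ℝ) < P.choose B.card := by exact_mod_cast Nat.choose_pos hbP
    -- Exchange of roles: a random `K`-set containing the fixed set `B` is as likely as a random set
    -- of size `B.card` avoiding a fixed set of size `P - K`.
    have h2 : ((P - B.card).choose (K - B.card) : ℝ) / P.choose K = missProb P B.card (P - K) := by
      rw [missProb, Nat.sub_sub_self hK, div_eq_div_iff hp.ne' hp'.ne']
      linarith
    rw [h2]
    refine (missProb_le_pow hbP (Nat.sub_le _ _)).trans (le_of_eq ?_)
    rcases Nat.eq_zero_or_pos P with rfl | hP
    · have : B.card = 0 := by omega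
      simp [this]
    · have hP' : (0 : ℝ) < P := by exact_mod_cast hP
      congr 1
      rw [Nat.cast_sub hK]
      field_simp
      ring
  · have : ((Finset.univ : Finset (Fin P)).powersetCard K).filter (fun S => B ⊆ S) = ∅ := by
      rw [Finset.filter_eq_empty_iff]
      intro S hS hBS
      rw [Finset.mem_powersetCard] at hS
      exact hB (hS.2 ▸ Finset.card_le_card hBS)
    rw [this]
    simp only [Finset.card_empty, Nat.cast_zero, zero_div]
    positivity

theorem ringAvg_subset_le (hK : K ≤ P) (hP : 0 < P) (W : Finset (Fin P)) :
    ringAvg P K (fun S => if S ⊆ W then 1 else 0) ≤ ((W.card : ℝ) / P) ^ K := by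
  have hW : W.card ≤ P := by simpa using Finset.card_le_univ W
  have h1 : ringAvg P K (fun S => if S ⊆ W then 1 else 0) = missProb P K (Wᶜ).card := by
    rw [← ringAvg_disjoint]
    refine ringAvg_congr fun S _ => ?_
    simp only [← Finset.subset_compl_iff_disjoint_right, compl_compl]
  rw [h1, Finset.card_compl, Fintype.card_fin]
  refine (missProb_le_pow hK (Nat.sub_le _ _)).trans (le_of_eq ?_)
  have hP' : (0 : ℝ) < P := by exact_mod_cast hP
  congr 1
  rw [Nat.cast_sub hW]
  field_simp
  ring

theorem ringAvg_nonempty_inter (hK : K ≤ P) (U : Finset (Fin P)) :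
    ringAvg P K (fun S => if (U ∩ S).Nonempty then 1 else 0) = 1 - missProb P K U.card := by
  rw [← ringAvg_disjoint, ← ringAvg_const hK 1, ← ringAvg_sub, ringAvg_const hK]
  refine ringAvg_congr fun S _ => ?_
  simp only [disjoint_comm (a := S), ← Finset.not_disjoint_iff_nonempty_inter]
  split_ifs <;> simp_all

/-- Union bound over the `a` keys. With `missProb_le_exp` and `half_min_le_one_sub_exp_neg` it
determines the hitting probability as `min 1 (a * K / P)` up to a factor 2. -/
theorem one_sub_missProb_le (hK : K ≤ P) {a : ℕ} (ha : a ≤ P) :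
    1 - missProb P K a ≤ (a : ℝ) * K / P := by
  obtain ⟨U, -, hU⟩ := Finset.exists_subset_card_eq
    (s := (Finset.univ : Finset (Fin P))) (n := a) (by simpa using ha)
  rw [← hU, ← ringAvg_nonempty_inter hK]
  calc ringAvg P K (fun S => if (U ∩ S).Nonempty then 1 else 0)
      ≤ ringAvg P K (fun S => ∑ i ∈ U, if {i} ⊆ S then 1 else 0) := by
        refine ringAvg_mono fun S _ => ?_
        split_ifs with h
        · obtain ⟨i, hi⟩ := h
          rw [Finset.mem_inter] at hi
          refine le_trans ?_ (Finset.single_le_sum (fun j _ => ?_) hi.1)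
          · simp [hi.2]
          · split_ifs <;> norm_num
        · exact Finset.sum_nonneg fun j _ => by split_ifs <;> norm_num
    _ = ∑ i ∈ U, ringAvg P K (fun S => if {i} ⊆ S then 1 else 0) := ringAvg_sum _ _
    _ ≤ ∑ i ∈ U, (K : ℝ) / P := Finset.sum_le_sum fun i _ => by
        simpa using ringAvg_superset_le hK {i}
    _ = (U.card : ℝ) * K / P := by rw [Finset.sum_const, nsmul_eq_mul, mul_div_assoc]

theorem keyEdgeProb_eq_one_sub {K₁ K₂ : ℕ} (h₁ : K₁ ≤ P) (h₂ : K₂ ≤ P) :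
    keyEdgeProb P K₁ K₂ = 1 - missProb P K₂ K₁ := by
  rw [keyEdgeProb_eq h₁ h₂, ← ringAvg_const h₁ (1 - missProb P K₂ K₁)]
  refine ringAvg_congr fun S hS => ?_
  rw [ringAvg_nonempty_inter h₂, hS]

/-- The moment generating function of the size of the intersection with a random ring. -/
theorem ringAvg_pow_inter_le (hK : K ≤ P) (B : Finset (Fin P)) {c : ℝ} (hc : 1 ≤ c) :
    ringAvg P K (fun S => c ^ (B ∩ S).card) ≤ (1 + (c - 1) * (K / P)) ^ B.card := by
  have h1 : ∀ S : Finset (Fin P), c ^ (B ∩ S).card =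
      ∑ D ∈ B.powerset, (c - 1) ^ D.card * if D ⊆ S then 1 else 0 := by
    intro S
    -- Write `c = 1 + (c - 1)` at every common key and expand over subsets `D` of `B`. The
    -- coefficients are nonnegative, so `ringAvg_superset_le` applies termwise and the expansion
    -- closes up again.
    have : c ^ (B ∩ S).card = ∏ i ∈ B, (((c - 1) * if i ∈ S then 1 else 0) + 1) := by
      rw [← Finset.filter_mem_eq_inter, ← Finset.prod_const, Finset.prod_filter]
      refine Finset.prod_congr rfl fun i _ => ?_
      split_ifs <;> ring
    rw [this, Finset.prod_add_one]
    refine Finset.sum_congr rfl fun D _ => ?_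
    rw [Finset.prod_mul_distrib, Finset.prod_const]
    congr 1
    split_ifs with h
    · exact Finset.prod_eq_one fun i hi => by simp [h hi]
    · rw [Finset.not_subset] at h
      obtain ⟨i, hi, hi'⟩ := h
      exact Finset.prod_eq_zero hi (by simp [hi'])
  simp only [h1]
  rw [ringAvg_sum, add_comm, ← Finset.prod_const, Finset.prod_add_one]
  refine Finset.sum_le_sum fun D _ => ?_
  rw [ringAvg_const_mul, Finset.prod_const, mul_pow]
  exact mul_le_mul_of_nonneg_left (ringAvg_superset_le hK D) (pow_nonneg (by linarith) _)

/-- If `S` holds more than half of `B`, it contains a subset of `B` of size `(B.card + 1) / 2`, and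
there are at most `2 ^ B.card` such subsets. -/
theorem ringAvg_half_inter_le (hK : K ≤ P) (B : Finset (Fin P)) :
    ringAvg P K (fun S => if B.card < 2 * (S ∩ B).card then 1 else 0) ≤
      2 ^ B.card * ((K : ℝ) / P) ^ ((B.card + 1) / 2) := by
  calc _ ≤ ringAvg P K (fun S => ∑ D ∈ B.powersetCard ((B.card + 1) / 2),
        if D ⊆ S then 1 else 0) := by
        refine ringAvg_mono fun S _ => ?_
        split_ifs with h
        · obtain ⟨D, hD, hDc⟩ := Finset.exists_subset_card_eq
            (s := S ∩ B) (n := (B.card + 1) / 2) (by omega)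
          have hDm : D ∈ B.powersetCard ((B.card + 1) / 2) :=
            Finset.mem_powersetCard.2 ⟨hD.trans Finset.inter_subset_right, hDc⟩
          refine le_trans ?_ (Finset.single_le_sum (fun j _ => ?_) hDm)
          · simp [hD.trans Finset.inter_subset_left]
          · split_ifs <;> norm_num
        · exact Finset.sum_nonneg fun j _ => by split_ifs <;> norm_num
    _ = ∑ D ∈ B.powersetCard ((B.card + 1) / 2),
        ringAvg P K (fun S => if D ⊆ S then 1 else 0) := ringAvg_sum _ _
    _ ≤ ∑ D ∈ B.powersetCard ((B.card + 1) / 2), ((K : ℝ) / P) ^ ((B.card + 1) / 2) := by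
        refine Finset.sum_le_sum fun D hD => ?_
        have := ringAvg_superset_le hK D
        rwa [(Finset.mem_powersetCard.1 hD).2] at this
    _ ≤ _ := by
        rw [Finset.sum_const, nsmul_eq_mul, Finset.card_powersetCard]
        refine mul_le_mul_of_nonneg_right ?_ (by positivity)
        exact_mod_cast Nat.choose_le_two_pow _ _

end Ring

theorem half_min_le_one_sub_exp_neg {t : ℝ} (ht : 0 ≤ t) :
    min 1 t / 2 ≤ 1 - Real.exp (-t) := by
  have h1 : Real.exp (-t) ≤ 1 / (1 + t) := by
    rw [Real.exp_neg, ← one_div]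
    exact one_div_le_one_div_of_le (by linarith) (by linarith [Real.add_one_le_exp t])
  have h2 : min 1 t / 2 ≤ 1 - 1 / (1 + t) := by
    rw [one_sub_div (by linarith), le_div_iff₀ (by linarith)]
    rcases le_total 1 t with h | h
    · rw [min_eq_left h]; linarith
    · rw [min_eq_right h]; nlinarith
  linarith

end RandomKeyGraph

namespace RandomKeyGraph

open MeasureTheory ProbabilityTheory

/-! ### Vertex sets with a small outer boundary. -/

section Graph

variable {V : Type*} [Fintype V] [DecidableEq V]

open scoped Classical in
/-- The vertices outside `T` with a neighbour in `T`. -/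
noncomputable def outerBoundary (H : SimpleGraph V) (T : Finset V) : Finset V :=
  Finset.univ.filter fun w => w ∉ T ∧ ∃ u ∈ T, H.Adj u w

theorem mem_outerBoundary {H : SimpleGraph V} {T : Finset V} {w : V} :
    w ∈ outerBoundary H T ↔ w ∉ T ∧ ∃ u ∈ T, H.Adj u w := by
  classical
  simp [outerBoundary]

theorem disjoint_outerBoundary (H : SimpleGraph V) (T : Finset V) :
    Disjoint T (outerBoundary H T) :=
  Finset.disjoint_right.2 fun _ hw => (mem_outerBoundary.1 hw).1

/-- Every proper nonempty part of `W` is joined to the rest of `W`. -/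
def Grows (H : SimpleGraph V) (W : Finset V) : Prop :=
  ∀ A ⊆ W, A.Nonempty → A ≠ W → ∃ u ∈ A, ∃ w ∈ W, w ∉ A ∧ H.Adj u w

/-- After deleting a separating set `S`, the component `T₁` of one vertex and the remainder `T₂`
have their outer boundaries inside `S`; the smaller of the two has at most half of the vertices. -/
theorem exists_small_outerBoundary {H : SimpleGraph V} {k : ℕ} (hk : k < Fintype.card V)
    (h : ¬ IsKConnected k H) :
    ∃ T : Finset V, T.Nonempty ∧ 2 * T.card ≤ Fintype.card V ∧ (outerBoundary H T).card < k := by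
  classical
  simp only [IsKConnected, hk, true_and, not_forall] at h
  obtain ⟨S, hS, hc⟩ := h
  have hne : Nonempty {v : V | v ∉ S} := by
    by_contra hemp
    have : S = Finset.univ := by
      ext v
      simp only [Finset.mem_univ, iff_true]
      by_contra hv
      exact hemp ⟨⟨v, hv⟩⟩
    rw [this, Finset.card_univ] at hS
    omega
  rw [SimpleGraph.connected_iff] at hc
  have hpre : ¬ (H.induce {v : V | v ∉ S}).Preconnected := fun hp => hc ⟨hp, hne⟩
  simp only [SimpleGraph.Preconnected, not_forall] at hpre
  obtain ⟨a, b, hab⟩ := hpre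
  let T₁ : Finset V := Finset.univ.filter fun v =>
    ∃ hv : v ∉ S, (H.induce {v : V | v ∉ S}).Reachable a ⟨v, hv⟩
  let T₂ : Finset V := Finset.univ.filter fun v => v ∉ S ∧ v ∉ T₁
  have hstep : ∀ u w, u ∈ T₁ → H.Adj u w → w ∉ S → w ∈ T₁ := by
    intro u w hu huw hw
    simp only [T₁, Finset.mem_filter, Finset.mem_univ, true_and] at hu ⊢
    obtain ⟨hu, hr⟩ := hu
    refine ⟨hw, hr.trans (SimpleGraph.Adj.reachable ?_)⟩
    simpa using huw
  have hb₁ : outerBoundary H T₁ ⊆ S := by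
    intro w hw
    obtain ⟨hw, u, hu, huw⟩ := mem_outerBoundary.1 hw
    by_contra hwS
    exact hw (hstep u w hu huw hwS)
  have hb₂ : outerBoundary H T₂ ⊆ S := by
    intro w hw
    obtain ⟨hw, u, hu, huw⟩ := mem_outerBoundary.1 hw
    by_contra hwS
    simp only [T₂, Finset.mem_filter, Finset.mem_univ, true_and, not_and, not_not] at hw hu
    exact hu.2 (hstep w u (hw hwS) huw.symm hu.1)
  have hdisj : Disjoint T₁ T₂ := by
    rw [Finset.disjoint_right]
    intro v hv
    exact (Finset.mem_filter.1 hv).2.2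
  have hcard : T₁.card + T₂.card ≤ Fintype.card V := by
    rw [← Finset.card_union_of_disjoint hdisj]
    exact Finset.card_le_univ _
  rcases le_total T₁.card T₂.card with hle | hle
  · refine ⟨T₁, ⟨a, ?_⟩, by omega, (Finset.card_le_card hb₁).trans_lt hS⟩
    simp only [T₁, Finset.mem_filter, Finset.mem_univ, true_and]
    exact ⟨a.2, SimpleGraph.Reachable.refl _⟩
  · refine ⟨T₂, ⟨b, ?_⟩, by omega, (Finset.card_le_card hb₂).trans_lt hS⟩
    simp only [T₂, T₁, Finset.mem_filter, Finset.mem_univ, true_and, not_exists]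
    exact ⟨b.2, fun _ => hab⟩

/-- Take `T` of least size. A proper part of `T` without edges to the rest of `T` would have its
outer boundary inside that of `T`, against minimality; and every boundary vertex has a neighbour in
`T`. Connectedness is what makes the tree count in the union bound possible. -/
theorem exists_grows_of_not_isKConnected {H : SimpleGraph V} {k : ℕ} (hk : k < Fintype.card V)
    (h : ¬ IsKConnected k H) :
    ∃ T : Finset V, T.Nonempty ∧ 2 * T.card ≤ Fintype.card V ∧ (outerBoundary H T).card < k ∧
      Grows H (T ∪ outerBoundary H T) := by
  classical
  have hex : ∃ m, ∃ T : Finset V, T.card = m ∧ T.Nonempty ∧ 2 * T.card ≤ Fintype.card V ∧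
      (outerBoundary H T).card < k := by
    obtain ⟨T, hT⟩ := exists_small_outerBoundary hk h
    exact ⟨_, T, rfl, hT⟩
  obtain ⟨T, hTm, hne, hhalf, hbd⟩ := Nat.find_spec hex
  have hmin : ∀ A : Finset V, A.Nonempty → A ⊆ T → A ≠ T → ∃ u ∈ A, ∃ w ∈ T, w ∉ A ∧ H.Adj u w := by
    intro A hA hAT hAne
    by_contra hcon
    push Not at hcon
    have hlt : A.card < T.card := Finset.card_lt_card (hAT.ssubset_of_ne hAne)
    refine Nat.find_min hex (m := A.card) (by omega) ⟨A, rfl, hA, by omega, ?_⟩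
    refine (Finset.card_le_card ?_).trans_lt hbd
    intro w hw
    obtain ⟨hw, u, hu, huw⟩ := mem_outerBoundary.1 hw
    exact mem_outerBoundary.2 ⟨fun hwT => hcon u hu w hwT hw huw, u, hAT hu, huw⟩
  refine ⟨T, hne, hhalf, hbd, ?_⟩
  intro A hA hAne hAW
  by_cases hTA : T ⊆ A
  · obtain ⟨w, hw, hwA⟩ : ∃ w ∈ T ∪ outerBoundary H T, w ∉ A := by
      by_contra hcon
      push Not at hcon
      exact hAW (hA.antisymm hcon)
    have hwB : w ∈ outerBoundary H T := by
      rcases Finset.mem_union.1 hw with h1 | h1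
      · exact absurd (hTA h1) hwA
      · exact h1
    obtain ⟨-, u, hu, huw⟩ := mem_outerBoundary.1 hwB
    exact ⟨u, hTA hu, w, hw, hwA, huw⟩
  · by_cases hAT : (A ∩ T).Nonempty
    · obtain ⟨u, hu, w, hw, hwA, huw⟩ := hmin (A ∩ T) hAT Finset.inter_subset_right
        (fun he => hTA (Finset.inter_eq_right.1 he))
      exact ⟨u, (Finset.mem_inter.1 hu).1, w, Finset.mem_union_left _ hw,
        fun h => hwA (Finset.mem_inter.2 ⟨h, hw⟩), huw⟩
    · obtain ⟨u, hu⟩ := hAne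
      have huT : u ∉ T := fun h => hAT ⟨u, Finset.mem_inter.2 ⟨hu, h⟩⟩
      have huB : u ∈ outerBoundary H T := (Finset.mem_union.1 (hA hu)).resolve_left huT
      obtain ⟨-, w, hw, hwu⟩ := mem_outerBoundary.1 huB
      exact ⟨u, hu, w, Finset.mem_union_left _ hw,
        fun h => hAT ⟨w, Finset.mem_inter.2 ⟨h, hw⟩⟩, hwu.symm⟩

/-- Deleting the neighbours isolates `v`, and as there are more than `k` vertices, some other vertex
survives. -/
theorem not_isKConnected_of_card_neighbors_lt {H : SimpleGraph V} {k : ℕ} {v : V} {S : Finset V}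
    (hS : ∀ w, w ∈ S ↔ H.Adj v w) (hk : S.card < k) : ¬ IsKConnected k H := by
  rintro ⟨hcard, hconn⟩
  have hv : v ∉ S := fun h => H.irrefl ((hS v).1 h)
  obtain ⟨w, hw⟩ : ∃ w, w ∉ insert v S := by
    by_contra hcon
    push Not at hcon
    have : insert v S = Finset.univ := by ext w; simp [hcon w]
    have h2 := Finset.card_insert_le v S
    rw [this, Finset.card_univ] at h2
    omega
  rw [Finset.mem_insert, not_or] at hw
  obtain ⟨p⟩ := (hconn S hk).preconnected ⟨v, hv⟩ ⟨w, hw.2⟩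
  cases p with
  | nil => exact hw.1 rfl
  | @cons _ x _ hadj _ =>
    have h1 : H.Adj v x := by simpa using hadj
    exact x.2 ((hS _).2 h1)

end Graph

/-- A code for a tree: `join a b` is the tree consisting of `a`, `b` and an edge between their
roots, rooted at the root of `a`. -/
inductive TreeCode (V : Type*) where
  | leaf (v : V) : TreeCode V
  | join (a b : TreeCode V) : TreeCode V

/-! ### Trees on labelled vertices: counting, spanning, and expected weights. -/

namespace TreeCode

variable {V : Type*}

/-- The root of a tree. -/
def root : TreeCode V → V
  | leaf v => v
  | join a _ => a.root

/-- The number of edges of a tree. -/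
def size : TreeCode V → ℕ
  | leaf _ => 0
  | join a b => a.size + b.size + 1

/-- The product over the edges of a tree of a weight depending on the states of the end points. -/
def edgeProd {Ω : Type*} (ψ : Ω → Ω → ℝ) (x : V → Ω) : TreeCode V → ℝ
  | leaf _ => 1
  | join a b => ψ (x a.root) (x b.root) * a.edgeProd ψ x * b.edgeProd ψ x

theorem edgeProd_nonneg {Ω : Type*} {ψ : Ω → Ω → ℝ} (hψ : ∀ y z, 0 ≤ ψ y z) (x : V → Ω)
    (τ : TreeCode V) : 0 ≤ τ.edgeProd ψ x := by
  induction τ with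
  | leaf v => simp [edgeProd]
  | join a b iha ihb => exact mul_nonneg (mul_nonneg (hψ _ _) iha) ihb

open scoped Classical in
/-- All codes of trees with a given number of edges. -/
noncomputable def codes (V : Type*) [Fintype V] : ℕ → Finset (TreeCode V)
  | 0 => Finset.univ.image leaf
  | m + 1 => (Finset.HasAntidiagonal.antidiagonal m).attach.biUnion fun ij =>
      Finset.image₂ join (codes V ij.1.1) (codes V ij.1.2)
  decreasing_by
    · have := Finset.HasAntidiagonal.mem_antidiagonal.1 ij.2; omega
    · have := Finset.HasAntidiagonal.mem_antidiagonal.1 ij.2; omega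

theorem mem_codes [Fintype V] (τ : TreeCode V) : τ ∈ codes V τ.size := by
  classical
  induction τ with
  | leaf v => simp [size, codes]
  | join a b iha ihb =>
    rw [size, codes, Finset.mem_biUnion]
    exact ⟨⟨(a.size, b.size), by simp⟩, Finset.mem_attach _ _,
      Finset.mem_image₂.2 ⟨a, iha, b, ihb, rfl⟩⟩

theorem size_of_mem_codes [Fintype V] {m : ℕ} : ∀ {τ : TreeCode V}, τ ∈ codes V m → τ.size = m := by
  classical
  induction m using Nat.strong_induction_on with
  | _ m ih =>
    intro τ hτ
    cases m with
    | zero =>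
      rw [codes, Finset.mem_image] at hτ
      obtain ⟨v, -, rfl⟩ := hτ
      rfl
    | succ m =>
      rw [codes, Finset.mem_biUnion] at hτ
      obtain ⟨⟨⟨i, j⟩, hij⟩, -, h⟩ := hτ
      obtain ⟨a, ha, b, hb, rfl⟩ := Finset.mem_image₂.1 h
      have hij' := Finset.HasAntidiagonal.mem_antidiagonal.1 hij
      simp only at hij' ha hb
      rw [size, ih i (by omega) ha, ih j (by omega) hb, hij']

/-- The edges of a join split between its branches as in the Catalan recursion, and the `m + 1`
leaves carry arbitrary labels. Codes that are not `Valid` or describe the same tree are counted too,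
which costs nothing that matters. -/
theorem card_codes_le [Fintype V] (m : ℕ) :
    (codes V m).card ≤ catalan m * Fintype.card V ^ (m + 1) := by
  classical
  induction m using Nat.strong_induction_on with
  | _ m ih =>
    cases m with
    | zero =>
      rw [codes]
      simpa using Finset.card_image_le (s := Finset.univ) (f := leaf (V := V))
    | succ m =>
      rw [codes, catalan_succ', Finset.sum_mul]
      refine Finset.card_biUnion_le.trans ?_
      rw [← Finset.sum_attach (Finset.HasAntidiagonal.antidiagonal m)]
      refine Finset.sum_le_sum fun ij _ => ?_
      have hij := Finset.HasAntidiagonal.mem_antidiagonal.1 ij.2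
      refine (Finset.card_image₂_le _ _ _).trans ?_
      refine (Nat.mul_le_mul (ih _ (by omega)) (ih _ (by omega))).trans (le_of_eq ?_)
      rw [mul_mul_mul_comm, ← pow_add]
      congr 2
      omega

theorem catalan_le_four_pow (m : ℕ) : catalan m ≤ 4 ^ m := by
  rw [catalan_eq_centralBinom_div]
  refine (Nat.div_le_self _ _).trans ?_
  rw [Nat.centralBinom_eq_two_mul_choose]
  refine (Nat.choose_le_two_pow _ _).trans (le_of_eq ?_)
  rw [pow_mul]
  norm_num

variable [DecidableEq V]

/-- The vertices of a tree. -/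
def verts : TreeCode V → Finset V
  | leaf v => {v}
  | join a b => a.verts ∪ b.verts

/-- The edges of a tree. -/
def edges : TreeCode V → Finset (Sym2 V)
  | leaf _ => ∅
  | join a b => insert s(a.root, b.root) (a.edges ∪ b.edges)

/-- The vertices in a code are all distinct. -/
def Valid : TreeCode V → Prop
  | leaf _ => True
  | join a b => a.Valid ∧ b.Valid ∧ Disjoint a.verts b.verts

/-- Attach a new vertex `w` to the vertex `z`. -/
def grow (z w : V) : TreeCode V → TreeCode V
  | leaf v => if v = z then join (leaf v) (leaf w) else leaf v
  | join a b => join (a.grow z w) (b.grow z w)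

theorem root_mem_verts (τ : TreeCode V) : τ.root ∈ τ.verts := by
  induction τ with
  | leaf v => simp [root, verts]
  | join a b iha _ => simp [root, verts, iha]

theorem card_verts {τ : TreeCode V} (h : τ.Valid) : τ.verts.card = τ.size + 1 := by
  induction τ with
  | leaf v => simp [verts, size]
  | join a b iha ihb =>
    rw [verts, Finset.card_union_of_disjoint h.2.2, iha h.1, ihb h.2.1, size]
    ring

theorem mem_verts_of_mem_edges {τ : TreeCode V} {e : Sym2 V} (he : e ∈ τ.edges) {v : V}
    (hv : v ∈ e) : v ∈ τ.verts := by
  induction τ with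
  | leaf v => simp [edges] at he
  | join a b iha ihb =>
    simp only [edges, Finset.mem_insert, Finset.mem_union] at he
    simp only [verts, Finset.mem_union]
    rcases he with rfl | he | he
    · rw [Sym2.mem_iff] at hv
      rcases hv with rfl | rfl
      · exact Or.inl a.root_mem_verts
      · exact Or.inr b.root_mem_verts
    · exact Or.inl (iha he)
    · exact Or.inr (ihb he)

theorem not_isDiag_of_mem_edges {τ : TreeCode V} (h : τ.Valid) {e : Sym2 V} (he : e ∈ τ.edges) :
    ¬ e.IsDiag := by
  induction τ with
  | leaf v => simp [edges] at he
  | join a b iha ihb =>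
    simp only [edges, Finset.mem_insert, Finset.mem_union] at he
    rcases he with rfl | he | he
    · rw [Sym2.mk_isDiag_iff]
      intro hab
      exact Finset.disjoint_left.1 h.2.2 a.root_mem_verts (hab ▸ b.root_mem_verts)
    · exact iha h.1 he
    · exact ihb h.2.1 he

theorem root_grow (z w : V) (τ : TreeCode V) : (τ.grow z w).root = τ.root := by
  induction τ with
  | leaf v =>
    simp only [grow]
    split_ifs <;> rfl
  | join a b iha _ => simpa [grow, root] using iha

theorem verts_grow_subset (z w : V) (τ : TreeCode V) : (τ.grow z w).verts ⊆ insert w τ.verts := by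
  induction τ with
  | leaf v =>
    simp only [grow]
    split_ifs <;> intro x <;> simp [verts] <;> tauto
  | join a b iha ihb =>
    intro x hx
    simp only [grow, verts, Finset.mem_union, Finset.mem_insert] at hx ⊢
    rcases hx with hx | hx
    · have := iha hx; simp at this; tauto
    · have := ihb hx; simp at this; tauto

theorem grow_of_notMem {z : V} (w : V) {τ : TreeCode V} (hz : z ∉ τ.verts) : τ.grow z w = τ := by
  induction τ with
  | leaf v =>
    simp only [verts, Finset.mem_singleton] at hz
    simp [grow, Ne.symm hz]
  | join a b iha ihb =>
    simp only [verts, Finset.mem_union, not_or] at hz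
    simp [grow, iha hz.1, ihb hz.2]

theorem verts_grow {z : V} (w : V) {τ : TreeCode V} (hz : z ∈ τ.verts) :
    (τ.grow z w).verts = insert w τ.verts := by
  refine (verts_grow_subset z w τ).antisymm ?_
  induction τ with
  | leaf v =>
    simp only [verts, Finset.mem_singleton] at hz
    intro x
    simp [grow, hz, verts]; tauto
  | join a b iha ihb =>
    intro x hx
    simp only [grow, verts, Finset.mem_union, Finset.mem_insert] at hx hz ⊢
    by_cases hza : z ∈ a.verts <;> by_cases hzb : z ∈ b.verts
    · have h1 := iha hza; have h2 := ihb hzb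
      simp only [Finset.insert_subset_iff] at h1 h2
      rcases hx with rfl | hx | hx
      · exact Or.inl h1.1
      · exact Or.inl (h1.2 hx)
      · exact Or.inr (h2.2 hx)
    · have h1 := iha hza
      rw [grow_of_notMem w hzb]
      simp only [Finset.insert_subset_iff] at h1
      rcases hx with rfl | hx | hx
      · exact Or.inl h1.1
      · exact Or.inl (h1.2 hx)
      · exact Or.inr hx
    · have h2 := ihb hzb
      rw [grow_of_notMem w hza]
      simp only [Finset.insert_subset_iff] at h2
      rcases hx with rfl | hx | hx
      · exact Or.inr h2.1
      · exact Or.inl hx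
      · exact Or.inr (h2.2 hx)
    · tauto

theorem valid_grow {z w : V} {τ : TreeCode V} (h : τ.Valid) (hw : w ∉ τ.verts) :
    (τ.grow z w).Valid := by
  induction τ with
  | leaf v =>
    simp only [verts, Finset.mem_singleton] at hw
    simp only [grow]
    split_ifs
    · simp [Valid, verts, Ne.symm hw]
    · trivial
  | join a b iha ihb =>
    simp only [verts, Finset.mem_union, not_or] at hw
    refine ⟨iha h.1 hw.1, ihb h.2.1 hw.2, ?_⟩
    by_cases hza : z ∈ a.verts
    · have hzb : z ∉ b.verts := Finset.disjoint_left.1 h.2.2 hza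
      rw [grow_of_notMem w hzb, verts_grow w hza, Finset.disjoint_insert_left]
      exact ⟨hw.2, h.2.2⟩
    · rw [grow_of_notMem w hza]
      by_cases hzb : z ∈ b.verts
      · rw [verts_grow w hzb, Finset.disjoint_insert_right]
        exact ⟨hw.1, h.2.2⟩
      · rw [grow_of_notMem w hzb]
        exact h.2.2

theorem edges_grow_subset (z w : V) (τ : TreeCode V) :
    (τ.grow z w).edges ⊆ insert s(z, w) τ.edges := by
  induction τ with
  | leaf v =>
    simp only [grow]
    split_ifs with h
    · subst h; simp [edges, root]
    · simp [edges]
  | join a b iha ihb =>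
    intro e he
    simp only [grow, edges, root_grow, Finset.mem_insert, Finset.mem_union] at he ⊢
    rcases he with he | he | he
    · tauto
    · have := iha he; simp at this; tauto
    · have := ihb he; simp at this; tauto

/-- Greedy spanning tree: while vertices of `W` are missing, `Grows` supplies an edge of `H` from
the tree to one of them. -/
theorem exists_of_grows [Fintype V] {H : SimpleGraph V} {W : Finset V} (hW : Grows H W)
    (hne : W.Nonempty) :
    ∃ τ : TreeCode V, τ.Valid ∧ τ.verts = W ∧ ∀ e ∈ τ.edges, e ∈ H.edgeSet := by
  suffices hs : ∀ m, m < W.card → ∃ τ : TreeCode V, τ.Valid ∧ τ.verts ⊆ W ∧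
      τ.verts.card = m + 1 ∧ ∀ e ∈ τ.edges, e ∈ H.edgeSet by
    obtain ⟨τ, h1, h2, h3, h4⟩ := hs (W.card - 1) (by have := hne.card_pos; omega)
    refine ⟨τ, h1, Finset.eq_of_subset_of_card_le h2 ?_, h4⟩
    have := hne.card_pos; omega
  intro m
  induction m with
  | zero =>
    intro _
    obtain ⟨v, hv⟩ := hne
    exact ⟨leaf v, trivial, by simpa [verts] using hv, by simp [verts], by simp [edges]⟩
  | succ m ih =>
    intro hm
    obtain ⟨τ, h1, h2, h3, h4⟩ := ih (by omega)
    obtain ⟨z, hz, w, hw, hwτ, hzw⟩ := hW τ.verts h2 ⟨_, τ.root_mem_verts⟩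
      (fun h => by rw [← h] at hm; omega)
    refine ⟨τ.grow z w, valid_grow h1 hwτ, ?_, ?_, ?_⟩
    · rw [verts_grow w hz]
      exact Finset.insert_subset hw h2
    · rw [verts_grow w hz, Finset.card_insert_of_notMem hwτ, h3]
    · intro e he
      rcases Finset.mem_insert.1 (edges_grow_subset z w τ he) with rfl | he
      · exact hzw
      · exact h4 e he

/-- Validity keeps the joining edge and the edges of the two branches distinct, so passing to a set
of edges loses no factor. -/
theorem prod_edges {Ω : Type*} {ψ : Ω → Ω → ℝ} {x : V → Ω} {φ : Sym2 V → ℝ} {τ : TreeCode V}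
    (h : τ.Valid) (hφ : ∀ u ∈ τ.verts, ∀ v ∈ τ.verts, u ≠ v → φ s(u, v) = ψ (x u) (x v)) :
    ∏ e ∈ τ.edges, φ e = τ.edgeProd ψ x := by
  induction τ with
  | leaf v => simp [edges, edgeProd]
  | join a b iha ihb =>
    have hd := Finset.disjoint_left.1 h.2.2
    have hab : s(a.root, b.root) ∉ a.edges ∪ b.edges := by
      rw [Finset.mem_union, not_or]
      constructor
      · intro he
        exact hd (mem_verts_of_mem_edges he (Sym2.mem_mk_right _ _)) b.root_mem_verts
      · intro he
        exact hd a.root_mem_verts (mem_verts_of_mem_edges he (Sym2.mem_mk_left _ _))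
    have hdE : Disjoint a.edges b.edges := by
      rw [Finset.disjoint_left]
      intro e hea heb
      induction e with
      | _ u v =>
        exact hd (mem_verts_of_mem_edges hea (Sym2.mem_mk_left _ _))
          (mem_verts_of_mem_edges heb (Sym2.mem_mk_left _ _))
    rw [edges, Finset.prod_insert hab, Finset.prod_union hdE, edgeProd,
      iha h.1 fun u hu v hv => hφ u (Finset.mem_union_left _ hu) v (Finset.mem_union_left _ hv),
      ihb h.2.1 fun u hu v hv => hφ u (Finset.mem_union_right _ hu) v (Finset.mem_union_right _ hv),
      hφ _ (Finset.mem_union_left _ a.root_mem_verts) _ (Finset.mem_union_right _ b.root_mem_verts)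
        (fun e => hd a.root_mem_verts (e ▸ b.root_mem_verts)), mul_assoc]

theorem dependsOn_edgeProd {Ω : Type*} (ψ : Ω → Ω → ℝ) (τ : TreeCode V) :
    DependsOn (fun x : V → Ω => τ.edgeProd ψ x) (τ.verts : Set V) := by
  induction τ with
  | leaf v => intro x y _; rfl
  | join a b iha ihb =>
    intro x y hxy
    simp only [verts, Finset.coe_union] at hxy
    have h1 := iha (x := x) (y := y) fun i hi => hxy i (Or.inl hi)
    have h2 := ihb (x := x) (y := y) fun i hi => hxy i (Or.inr hi)
    simp only at h1 h2
    simp only [edgeProd, h1, h2, hxy _ (Or.inl a.root_mem_verts),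
      hxy _ (Or.inr b.root_mem_verts)]

/-- The tree is stripped from the outside. For `join a b`, the induction hypothesis removes the
edges of `b` with everything else as prefactor `F`; then the root of `b` occurs only in the joining
edge and is averaged out at cost `p`; then `a` is removed. This is why `F` may depend on the root,
but on no other vertex of the tree. -/
theorem expect_mul_edgeProd_le [Fintype V] {Ω : Type*} [Fintype Ω] {ν : Ω → ℝ}
    (hν : ∀ y, 0 ≤ ν y) (hν1 : ∑ y, ν y = 1) {ψ : Ω → Ω → ℝ} (hψ : ∀ y z, 0 ≤ ψ y z) {p : ℝ}
    (hp0 : 0 ≤ p)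
    (hp : ∀ z, ν z ≠ 0 → ∑ y, ν y * ψ z y ≤ p) {τ : TreeCode V} (h : τ.Valid)
    {F : (V → Ω) → ℝ} (hF0 : ∀ x, 0 ≤ F x)
    (hF : DependsOn F ((τ.verts.erase τ.root : Finset V) : Set V)ᶜ) :
    expect ν (fun x => F x * τ.edgeProd ψ x) ≤ p ^ τ.size * expect ν F := by
  induction τ generalizing F with
  | leaf v => simp [edgeProd, size]
  | join a b iha ihb =>
    have hd := Finset.disjoint_left.1 h.2.2
    have hra := a.root_mem_verts
    have hrb := b.root_mem_verts
    have hFa : DependsOn F ((a.verts.erase a.root : Finset V) : Set V)ᶜ := by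
      refine hF.mono ?_
      intro v hv hv'
      refine hv ?_
      simp only [verts, root, Finset.coe_erase, Finset.coe_union] at hv' ⊢
      exact ⟨Or.inl hv'.1, hv'.2⟩
    have hFb : DependsOn (fun x => F x * a.edgeProd ψ x * ψ (x a.root) (x b.root))
        ((b.verts.erase b.root : Finset V) : Set V)ᶜ := by
      intro x y hxy
      have h1 : F x = F y := hF fun v hv => hxy v fun hv' => hv (by
        simp only [verts, root, Finset.coe_erase, Finset.coe_union] at hv' ⊢
        exact ⟨Or.inr hv'.1, fun e => hd hra (by rw [← Set.mem_singleton_iff.1 e]; exact hv'.1)⟩)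
      have h2 : a.edgeProd ψ x = a.edgeProd ψ y := dependsOn_edgeProd ψ a fun v hv =>
        hxy v fun hv' => hd hv (Finset.mem_of_mem_erase hv')
      have h3 : x a.root = y a.root := hxy _ fun hv' => hd hra (Finset.mem_of_mem_erase hv')
      have h4 : x b.root = y b.root := hxy _ fun hv' => Finset.notMem_erase _ _ hv'
      simp only [h1, h2, h3, h4]
    have hres : expect ν (fun x => F x * a.edgeProd ψ x * ψ (x a.root) (x b.root)) ≤
        p * expect ν (fun x => F x * a.edgeProd ψ x) := by
      rw [expect_resample hν1 b.root, ← expect_const_mul]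
      refine expect_mono hν fun x hx => ?_
      have hne : a.root ≠ b.root := fun e => hd hra (e ▸ hrb)
      have hb : b.root ∉ (a.verts : Set V) := fun hb => hd hb hrb
      have hb' : b.root ∉ (((join a b).verts.erase (join a b).root : Finset V) : Set V)ᶜ := by
        simp only [verts, root, Set.mem_compl_iff, not_not, Finset.mem_coe, Finset.mem_erase,
          Finset.mem_union]
        exact ⟨hne.symm, Or.inr hrb⟩
      have h2 : ∀ y, a.edgeProd ψ (Function.update x b.root y) = a.edgeProd ψ x :=
        fun y => dependsOn_update hb (dependsOn_edgeProd ψ a) x y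
      simp only [dependsOn_update hb' hF, h2, Function.update_self, Function.update_of_ne hne]
      have : ∀ y, ν y * (F x * a.edgeProd ψ x * ψ (x a.root) y) =
          F x * a.edgeProd ψ x * (ν y * ψ (x a.root) y) := fun y => by ring
      simp only [this, ← Finset.mul_sum]
      rw [mul_comm p]
      exact mul_le_mul_of_nonneg_left (hp _ (hx _))
        (mul_nonneg (hF0 x) (edgeProd_nonneg hψ x a))
    calc expect ν (fun x => F x * (join a b).edgeProd ψ x)
        = expect ν (fun x => F x * a.edgeProd ψ x * ψ (x a.root) (x b.root) *
            b.edgeProd ψ x) := expect_congr fun x _ => by rw [edgeProd]; ring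
      _ ≤ p ^ b.size * expect ν (fun x => F x * a.edgeProd ψ x * ψ (x a.root) (x b.root)) :=
          ihb h.2.1 (fun x => mul_nonneg (mul_nonneg (hF0 x) (edgeProd_nonneg hψ x a)) (hψ _ _)) hFb
      _ ≤ p ^ b.size * (p * (p ^ a.size * expect ν F)) := by
          refine mul_le_mul_of_nonneg_left (hres.trans ?_) (pow_nonneg hp0 _)
          exact mul_le_mul_of_nonneg_left (iha h.1 hF0 hFa) hp0
      _ = p ^ (join a b).size * expect ν F := by rw [size]; ring

end TreeCode

end RandomKeyGraph

namespace RandomKeyGraph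

open MeasureTheory ProbabilityTheory

/-! ### Probability that a set of nodes has no links to the outside. -/

section Isolation

variable {n r P : ℕ}

/-- The probability that none of the nodes in `T`, with states `x`, is linked to a node of
state `y`. -/
noncomputable def isoFactor (α : ℝ) (T : Finset (Fin n)) (x : Fin n → Fin r × Finset (Fin P))
    (y : Fin r × Finset (Fin P)) : ℝ :=
  ∏ u ∈ T, (1 - α * if ((x u).2 ∩ y.2).Nonempty then 1 else 0)

/-- The probability that none of the nodes in `T`, with states `x`, is linked to a further random
node. -/
noncomputable def isoProb (μ : Fin r → ℝ) (K : Fin r → ℕ) (α : ℝ) (T : Finset (Fin n))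
    (x : Fin n → Fin r × Finset (Fin P)) : ℝ :=
  ∑ y, nodeWeight μ K P y * isoFactor α T x y

/-- The probability that the ring of a random node meets a given set of `a` keys. -/
noncomputable def hitProb (μ : Fin r → ℝ) (K : Fin r → ℕ) (P a : ℕ) : ℝ :=
  ∑ j, μ j * (1 - missProb P (K j) a)

theorem sum_nodeWeight_mul_hit {μ : Fin r → ℝ} {K : Fin r → ℕ} (hK : ∀ i, K i ≤ P)
    (z : Finset (Fin P)) :
    ∑ y, nodeWeight μ K P y * (if (z ∩ y.2).Nonempty then 1 else 0) = hitProb μ K P z.card := by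
  rw [sum_nodeWeight_mul, hitProb]
  refine Finset.sum_congr rfl fun j _ => ?_
  rw [ringAvg_nonempty_inter (hK j)]

theorem meanEdgeProb_eq {μ : Fin r → ℝ} {K : Fin r → ℕ} (hK : ∀ i, K i ≤ P) (i : Fin r) :
    meanEdgeProb μ K P i = hitProb μ K P (K i) := by
  rw [meanEdgeProb, hitProb]
  refine Finset.sum_congr rfl fun j _ => ?_
  rw [keyEdgeProb_eq_one_sub (hK i) (hK j), mul_comm]

theorem hitProb_nonneg {μ : Fin r → ℝ} (hμ : ∀ i, 0 ≤ μ i) (K : Fin r → ℕ) (P a : ℕ) :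
    0 ≤ hitProb μ K P a :=
  Finset.sum_nonneg fun j _ => mul_nonneg (hμ j) (sub_nonneg.2 (missProb_le_one _ _ _))

theorem hitProb_le_one {μ : Fin r → ℝ} (hμ : ∀ i, 0 ≤ μ i) (hμ1 : ∑ i, μ i = 1) (K : Fin r → ℕ)
    (P a : ℕ) : hitProb μ K P a ≤ 1 := by
  rw [← hμ1]
  refine Finset.sum_le_sum fun j _ => mul_le_of_le_one_right (hμ j) ?_
  linarith [missProb_nonneg P (K j) a]

theorem hitProb_mono {μ : Fin r → ℝ} (hμ : ∀ i, 0 ≤ μ i) (K : Fin r → ℕ) (P : ℕ) {a b : ℕ}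
    (h : a ≤ b) : hitProb μ K P a ≤ hitProb μ K P b := by
  refine Finset.sum_le_sum fun j _ => mul_le_mul_of_nonneg_left ?_ (hμ j)
  linarith [missProb_anti P (K j) h]

theorem keyGraph_edge_iff {x : Fin n → Fin r × Finset (Fin P)} {u v : Fin n} (h : u ≠ v) :
    s(u, v) ∈ (keyGraph x).edgeSet ↔ ((x u).2 ∩ (x v).2).Nonempty := by
  rw [SimpleGraph.mem_edgeSet]
  exact ⟨fun h => h.2, fun h' => ⟨h, h'⟩⟩

theorem one_sub_mul_ite_nonneg (α : unitInterval) (p : Prop) [Decidable p] :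
    0 ≤ 1 - (α : ℝ) * if p then 1 else 0 := by
  have := α.2.2
  have := α.2.1
  split_ifs <;> linarith

theorem one_sub_mul_ite_le_one (α : unitInterval) (p : Prop) [Decidable p] :
    1 - (α : ℝ) * (if p then 1 else 0) ≤ 1 := by
  have := α.2.1
  split_ifs <;> linarith

theorem isoFactor_nonneg (α : unitInterval) (T : Finset (Fin n))
    (x : Fin n → Fin r × Finset (Fin P)) (y : Fin r × Finset (Fin P)) :
    0 ≤ isoFactor α T x y :=
  Finset.prod_nonneg fun _ _ => one_sub_mul_ite_nonneg _ _

theorem isoProb_nonneg {μ : Fin r → ℝ} (hμ : ∀ i, 0 ≤ μ i) (K : Fin r → ℕ) (α : unitInterval)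
    (T : Finset (Fin n)) (x : Fin n → Fin r × Finset (Fin P)) : 0 ≤ isoProb μ K α T x :=
  Finset.sum_nonneg fun y _ => mul_nonneg (nodeWeight_nonneg hμ K P y) (isoFactor_nonneg α T x y)

/-- The edges between `T` and the complement of `W`. -/
def crossEdges (T W : Finset (Fin n)) : Finset (Sym2 (Fin n)) :=
  (T ×ˢ Wᶜ).image fun p => s(p.1, p.2)

theorem prod_crossEdges {T W : Finset (Fin n)} (hTW : T ⊆ W) (φ : Sym2 (Fin n) → ℝ) :
    ∏ e ∈ crossEdges T W, φ e = ∏ w ∈ Wᶜ, ∏ u ∈ T, φ s(u, w) := by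
  rw [crossEdges, Finset.prod_image, Finset.prod_product_right]
  rintro ⟨u, w⟩ h ⟨u', w'⟩ h' he
  simp only [Finset.coe_product, Set.mem_prod, Finset.mem_coe, Finset.mem_compl] at h h'
  simp only [Sym2.eq_iff] at he
  rcases he with ⟨rfl, rfl⟩ | ⟨rfl, rfl⟩
  · rfl
  · exact absurd (hTW h.1) h'.2

open scoped Classical in
-- Fix the states of the nodes in `W`. The nodes outside are then independent, and each has no link
-- to `T` with probability `isoProb`, at most `ρ` when `Φ` holds. The event `Φ` and the edges in `F`
-- concern only nodes of `W` and stay in the prefactor.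
theorem modelLaw_real_isolated_le {μ : Fin r → ℝ} (hμ : ∀ i, 0 ≤ μ i) (hμ1 : ∑ i, μ i = 1)
    {K : Fin r → ℕ} (hK : ∀ i, K i ≤ P) (α : unitInterval) {T W : Finset (Fin n)}
    (hTW : T ⊆ W) {Φ : (Fin n → Fin r × Finset (Fin P)) → Prop} (hΦ : DependsOn Φ (T : Set (Fin n)))
    {ρ : ℝ} (hρ : ∀ x, (∀ v, nodeWeight μ K P (x v) ≠ 0) → Φ x → isoProb μ K α T x ≤ ρ)
    (hρ0 : 0 ≤ ρ)
    (F : Finset (Sym2 (Fin n))) (hF : ∀ e ∈ F, ¬ e.IsDiag) (hFW : ∀ e ∈ F, ∀ v ∈ e, v ∈ W) :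
    (modelLaw n μ K P α).real {ω | Φ ω.1 ∧ (∀ e ∈ F, e ∈ (intersectionGraph ω).edgeSet) ∧
      ∀ u ∈ T, ∀ w ∉ W, ¬ (intersectionGraph ω).Adj u w} ≤
    ρ ^ (n - W.card) * expect (nodeWeight μ K P) (fun x =>
      ∏ e ∈ F, (α : ℝ) * if e ∈ (keyGraph x).edgeSet then 1 else 0) := by
  have hν := nodeWeight_nonneg hμ K P
  have hν1 := sum_nodeWeight hμ1 hK
  have hset : {ω : (Fin n → Fin r × Finset (Fin P)) × SimpleGraph (Fin n) | Φ ω.1 ∧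
      (∀ e ∈ F, e ∈ (intersectionGraph ω).edgeSet) ∧
      ∀ u ∈ T, ∀ w ∉ W, ¬ (intersectionGraph ω).Adj u w} =
      {ω | Φ ω.1 ∧ (∀ e ∈ F, e ∈ (intersectionGraph ω).edgeSet) ∧
      ∀ e ∈ crossEdges T W, e ∉ (intersectionGraph ω).edgeSet} := by
    ext ω
    simp only [Set.mem_ofPred_eq, crossEdges, Finset.mem_image, Finset.mem_product,
      Finset.mem_compl, Prod.exists, forall_exists_index, and_imp]
    refine and_congr_right fun _ => and_congr_right fun _ => ⟨?_, ?_⟩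
    · rintro h e u w hu hw rfl
      exact h u hu w hw
    · intro h u hu w hw
      exact h _ u w hu hw rfl
  rw [hset, modelLaw_real_cylinder hμ hμ1 hK α Φ F (crossEdges T W) ?_ hF ?_]
  · have hcross : ∀ x : Fin n → Fin r × Finset (Fin P),
        ∏ e ∈ crossEdges T W, (1 - (α : ℝ) * if e ∈ (keyGraph x).edgeSet then 1 else 0) =
        ∏ w ∈ Wᶜ, isoFactor α T x (x w) := by
      intro x
      rw [prod_crossEdges hTW]
      refine Finset.prod_congr rfl fun w hw => Finset.prod_congr rfl fun u hu => ?_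
      have huw : u ≠ w := by rintro rfl; exact (Finset.mem_compl.1 hw) (hTW hu)
      simp only [keyGraph_edge_iff huw]
    simp only [hcross]
    have hG : DependsOn (fun x : Fin n → Fin r × Finset (Fin P) => (if Φ x then (1 : ℝ) else 0) *
        ∏ e ∈ F, (α : ℝ) * if e ∈ (keyGraph x).edgeSet then 1 else 0)
        (((Wᶜ : Finset (Fin n)) : Set (Fin n))ᶜ) := by
      intro x y hxy
      simp only [Finset.coe_compl, compl_compl] at hxy
      have h1 : Φ x = Φ y := hΦ fun i hi => hxy i (hTW hi)
      have h2 : ∏ e ∈ F, ((α : ℝ) * if e ∈ (keyGraph x).edgeSet then 1 else 0) =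
          ∏ e ∈ F, ((α : ℝ) * if e ∈ (keyGraph y).edgeSet then 1 else 0) := by
        refine Finset.prod_congr rfl fun e he => ?_
        have := hFW e he
        induction e with
        | _ u v =>
          have hxu := hxy u (this u (Sym2.mem_mk_left _ _))
          have hxv := hxy v (this v (Sym2.mem_mk_right _ _))
          simp only [SimpleGraph.mem_edgeSet, keyGraph, hxu, hxv]
      simp only [h1, h2]
    have hh : ∀ (w : Fin n) y, DependsOn (fun x : Fin n → Fin r × Finset (Fin P) =>
        isoFactor α T x y) (((Wᶜ : Finset (Fin n)) : Set (Fin n))ᶜ) := by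
      intro w y x x' hxy
      simp only [Finset.coe_compl, compl_compl] at hxy
      refine Finset.prod_congr rfl fun u hu => ?_
      rw [hxy u (hTW hu)]
    have := expect_mul_prod hν1 (Wᶜ : Finset (Fin n)) _ hG (fun _ y x => isoFactor α T x y) hh
    rw [this, ← expect_const_mul]
    refine expect_mono hν fun x hx => ?_
    rw [Finset.prod_const, Finset.card_compl, Fintype.card_fin]
    have hE : 0 ≤ ∏ e ∈ F, ((α : ℝ) * if e ∈ (keyGraph x).edgeSet then 1 else 0) :=
      Finset.prod_nonneg fun e _ => mul_nonneg α.2.1 (by split_ifs <;> norm_num)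
    by_cases hΦx : Φ x
    · rw [if_pos hΦx, one_mul, mul_comm]
      refine mul_le_mul_of_nonneg_right ?_ hE
      exact pow_le_pow_left₀ (isoProb_nonneg hμ K α T x) (hρ x hx hΦx) _
    · rw [if_neg hΦx, zero_mul, zero_mul]
      positivity
  · rw [Finset.disjoint_left]
    intro e he he'
    simp only [crossEdges, Finset.mem_image, Finset.mem_product, Finset.mem_compl,
      Prod.exists] at he'
    obtain ⟨u, w, ⟨hu, hw⟩, rfl⟩ := he'
    exact hw (hFW _ he w (Sym2.mem_mk_right _ _))
  · intro e he
    simp only [crossEdges, Finset.mem_image, Finset.mem_product, Finset.mem_compl,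
      Prod.exists] at he
    obtain ⟨u, w, ⟨hu, hw⟩, rfl⟩ := he
    rw [Sym2.mk_isDiag_iff]
    rintro rfl
    exact hw (hTW hu)

/-- Each tree edge costs at most `p`, since `p` bounds the link probability of a node of any class.
-/
theorem modelLaw_real_isolated_tree_le {μ : Fin r → ℝ} (hμ : ∀ i, 0 ≤ μ i) (hμ1 : ∑ i, μ i = 1)
    {K : Fin r → ℕ} (hK : ∀ i, K i ≤ P) (α : unitInterval) {τ : TreeCode (Fin n)} (hτ : τ.Valid)
    {T : Finset (Fin n)} (hT : T ⊆ τ.verts)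
    {Φ : (Fin n → Fin r × Finset (Fin P)) → Prop} (hΦ : DependsOn Φ (T : Set (Fin n)))
    {ρ p : ℝ} (hρ : ∀ x, (∀ v, nodeWeight μ K P (x v) ≠ 0) → Φ x → isoProb μ K α T x ≤ ρ)
    (hρ0 : 0 ≤ ρ) (hp0 : 0 ≤ p) (hp : ∀ j, (α : ℝ) * hitProb μ K P (K j) ≤ p) :
    (modelLaw n μ K P α).real {ω | Φ ω.1 ∧ (∀ e ∈ τ.edges, e ∈ (intersectionGraph ω).edgeSet) ∧
      ∀ u ∈ T, ∀ w ∉ τ.verts, ¬ (intersectionGraph ω).Adj u w} ≤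
    p ^ τ.size * ρ ^ (n - (τ.size + 1)) := by
  classical
  have hν := nodeWeight_nonneg hμ K P
  have hν1 := sum_nodeWeight hμ1 hK
  refine (modelLaw_real_isolated_le hμ hμ1 hK α hT hΦ hρ hρ0 τ.edges
    (fun e he => TreeCode.not_isDiag_of_mem_edges hτ he)
    (fun e he v hv => TreeCode.mem_verts_of_mem_edges he hv)).trans ?_
  rw [TreeCode.card_verts hτ, mul_comm]
  refine mul_le_mul_of_nonneg_right ?_ (by positivity)
  let ψ : Fin r × Finset (Fin P) → Fin r × Finset (Fin P) → ℝ := fun y z =>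
    (α : ℝ) * if (y.2 ∩ z.2).Nonempty then 1 else 0
  have hψ : ∀ y z, 0 ≤ ψ y z := fun y z => mul_nonneg α.2.1 (by split_ifs <;> norm_num)
  have h1 := TreeCode.expect_mul_edgeProd_le (V := Fin n) hν hν1 hψ hp0 (τ := τ) ?_ hτ
    (F := fun _ => 1) (fun _ => zero_le_one) (fun _ _ _ => rfl)
  · rw [expect_const hν1, mul_one] at h1
    refine le_trans (le_of_eq ?_) h1
    refine expect_congr fun x _ => ?_
    rw [one_mul, TreeCode.prod_edges hτ (x := x) (ψ := ψ)]
    intro u _ v _ huv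
    simp only [ψ, keyGraph_edge_iff huv]
  · intro z hz
    have hc := card_of_nodeWeight_ne_zero hz
    have : ∑ y, nodeWeight μ K P y * ψ z y = α * hitProb μ K P (K z.1) := by
      rw [← hc, ← sum_nodeWeight_mul_hit hK, Finset.mul_sum]
      exact Finset.sum_congr rfl fun y _ => by simp only [ψ]; ring
    rw [this]
    exact hp _

/-- The law of the neighbourhood of a node of a given class. -/
theorem modelLaw_real_class_neighbors {μ : Fin r → ℝ} (hμ : ∀ i, 0 ≤ μ i) (hμ1 : ∑ i, μ i = 1)
    {K : Fin r → ℕ} (hK : ∀ i, K i ≤ P) (α : unitInterval) (j : Fin r) (v : Fin n)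
    {S : Finset (Fin n)} (hv : v ∉ S) :
    (modelLaw n μ K P α).real {ω | (ω.1 v).1 = j ∧
      ∀ w, w ∈ S ↔ (intersectionGraph ω).Adj v w} =
    μ j * ((α * hitProb μ K P (K j)) ^ S.card *
      (1 - α * hitProb μ K P (K j)) ^ (n - 1 - S.card)) := by
  classical
  have hν1 := sum_nodeWeight hμ1 hK
  set R : Finset (Fin n) := (insert v S)ᶜ with hR
  have hset : {ω : (Fin n → Fin r × Finset (Fin P)) × SimpleGraph (Fin n) | (ω.1 v).1 = j ∧
      ∀ w, w ∈ S ↔ (intersectionGraph ω).Adj v w} =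
      {ω | (ω.1 v).1 = j ∧
        (∀ e ∈ S.image (fun w => s(v, w)), e ∈ (intersectionGraph ω).edgeSet) ∧
        ∀ e ∈ R.image (fun w => s(v, w)), e ∉ (intersectionGraph ω).edgeSet} := by
    ext ω
    simp only [Set.mem_ofPred_eq, Finset.mem_image, forall_exists_index, and_imp,
      forall_apply_eq_imp_iff₂, SimpleGraph.mem_edgeSet]
    refine and_congr_right fun _ => ⟨fun h => ⟨fun w hw => (h w).1 hw, fun w hw hadj => ?_⟩,
      fun h w => ⟨fun hw => h.1 w hw, fun hadj => ?_⟩⟩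
    · have := (h w).2 hadj
      simp [hR, this] at hw
    · by_contra hw
      refine h.2 w ?_ hadj
      have : w ≠ v := by rintro rfl; exact (intersectionGraph ω).irrefl hadj
      simp [hR, hw, this]
  have hinj : Function.Injective (fun w : Fin n => s(v, w)) := fun a b h => Sym2.congr_right.1 h
  have hvS : ∀ w ∈ S, v ≠ w := by rintro w hw rfl; exact hv hw
  have hvR : ∀ w ∈ R, v ≠ w := by rintro w hw rfl; simp [hR] at hw
  rw [hset, modelLaw_real_cylinder hμ hμ1 hK α (fun x => (x v).1 = j)]
  · have hprod : ∀ x : Fin n → Fin r × Finset (Fin P), (if (x v).1 = j then (1 : ℝ) else 0) *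
        (∏ e ∈ S.image (fun w => s(v, w)),
          (α : ℝ) * if e ∈ (keyGraph x).edgeSet then 1 else 0) *
        ∏ e ∈ R.image (fun w => s(v, w)),
          (1 - (α : ℝ) * if e ∈ (keyGraph x).edgeSet then 1 else 0) =
        (if (x v).1 = j then (1 : ℝ) else 0) * ∏ w ∈ S ∪ R,
          (if w ∈ S then (α : ℝ) * (if ((x v).2 ∩ (x w).2).Nonempty then 1 else 0)
            else 1 - (α : ℝ) * (if ((x v).2 ∩ (x w).2).Nonempty then 1 else 0)) := by
      intro x
      have hSR : Disjoint S R := by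
        rw [Finset.disjoint_left]; intro w hw hw'; simp [hR, hw] at hw'
      rw [Finset.prod_image hinj.injOn, Finset.prod_image hinj.injOn, Finset.prod_union hSR,
        mul_assoc]
      congr 2
      · refine Finset.prod_congr rfl fun w hw => ?_
        simp only [hw, if_true, keyGraph_edge_iff (hvS w hw)]
      · refine Finset.prod_congr rfl fun w hw => ?_
        have : w ∉ S := Finset.disjoint_right.1 hSR hw
        simp only [this, if_false, keyGraph_edge_iff (hvR w hw)]
    refine Eq.trans (expect_congr (G := fun x => (if (x v).1 = j then (1 : ℝ) else 0) *
      ∏ w ∈ S ∪ R, (if w ∈ S then (α : ℝ) * (if ((x v).2 ∩ (x w).2).Nonempty then 1 else 0)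
        else 1 - (α : ℝ) * (if ((x v).2 ∩ (x w).2).Nonempty then 1 else 0)))
      fun x _ => by convert hprod x) ?_
    have hvu : v ∉ S ∪ R := by simp [hv, hR]
    have hvc : v ∈ (((S ∪ R : Finset (Fin n)) : Set (Fin n))ᶜ) := by
      rw [Set.mem_compl_iff, Finset.mem_coe]; exact hvu
    rw [expect_mul_prod hν1 (S ∪ R) (fun x => if (x v).1 = j then (1 : ℝ) else 0)
      (by intro x y hxy; simp only [hxy v hvc])
      (fun w y x => if w ∈ S then (α : ℝ) * (if ((x v).2 ∩ y.2).Nonempty then 1 else 0)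
            else 1 - (α : ℝ) * (if ((x v).2 ∩ y.2).Nonempty then 1 else 0))
      (by intro w y x x' hxy; simp only [hxy v hvc])]
    have hcSR : (S ∪ R).card = n - 1 := by
      have : S ∪ R = {v}ᶜ := by
        ext w
        simp only [hR, Finset.mem_union, Finset.mem_compl, Finset.mem_insert,
          Finset.mem_singleton]
        constructor
        · rintro (h | h)
          · rintro rfl; exact hv h
          · tauto
        · intro h; by_cases hw : w ∈ S <;> tauto
      rw [this, Finset.card_compl, Fintype.card_fin, Finset.card_singleton]
    have hcR : R.card = n - 1 - S.card := by
      rw [hR, Finset.card_compl, Fintype.card_fin, Finset.card_insert_of_notMem hv]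
      omega
    set s := (α : ℝ) * hitProb μ K P (K j) with hs
    have hval : expect (nodeWeight μ K P) (fun x : Fin n → Fin r × Finset (Fin P) =>
        (if (x v).1 = j then (1 : ℝ) else 0) * (s ^ S.card * (1 - s) ^ (n - 1 - S.card))) =
        μ j * (s ^ S.card * (1 - s) ^ (n - 1 - S.card)) := by
      rw [expect_mul_const]
      congr 1
      rw [expect_resample hν1 v]
      simp only [Function.update_self]
      rw [expect_const hν1, sum_nodeWeight_mul]
      simp only
      rw [Finset.sum_eq_single j]
      · simp [ringAvg_const (hK j)]
      · intro b _ hb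
        simp [hb, ringAvg_const (hK b)]
      · simp
    rw [← hval]
    refine expect_congr fun x hx => ?_
    by_cases hj : (x v).1 = j
    swap
    · simp [hj]
    simp only [hj, if_true, one_mul]
    have hc := card_of_nodeWeight_ne_zero (hx v)
    rw [hj] at hc
    have hhit := sum_nodeWeight_mul_hit (μ := μ) hK (x v).2
    rw [hc] at hhit
    have e1 : ∑ y, nodeWeight μ K P y *
        ((α : ℝ) * (if ((x v).2 ∩ y.2).Nonempty then 1 else 0)) = s := by
      rw [hs, ← hhit, Finset.mul_sum]
      exact Finset.sum_congr rfl fun y _ => by ring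
    have e2 : ∑ y, nodeWeight μ K P y *
        (1 - (α : ℝ) * (if ((x v).2 ∩ y.2).Nonempty then 1 else 0)) = 1 - s := by
      simp only [mul_sub, mul_one, Finset.sum_sub_distrib, hν1, e1]
    have hSR : Disjoint S R := by
      rw [Finset.disjoint_left]; intro w hw hw'; simp [hR, hw] at hw'
    rw [Finset.prod_union hSR]
    congr 1
    · rw [← Finset.prod_const]
      refine Finset.prod_congr rfl fun w hw => ?_
      simp only [hw, if_true, e1]
    · rw [← hcR, ← Finset.prod_const]
      refine Finset.prod_congr rfl fun w hw => ?_
      have : w ∉ S := Finset.disjoint_right.1 hSR hw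
      simp only [this, if_false, e2]
  · rw [Finset.disjoint_left]
    intro e he he'
    obtain ⟨w, hw, rfl⟩ := Finset.mem_image.1 he
    obtain ⟨w', hw', h⟩ := Finset.mem_image.1 he'
    rw [hinj h] at hw'
    simp [hR, hw] at hw'
  · intro e he
    obtain ⟨w, hw, rfl⟩ := Finset.mem_image.1 he
    exact hvS w hw
  · intro e he
    obtain ⟨w, hw, rfl⟩ := Finset.mem_image.1 he
    exact hvR w hw

end Isolation

end RandomKeyGraph

namespace RandomKeyGraph

open MeasureTheory ProbabilityTheory

/-! ### Bounds on the isolation probability for well-behaved rings. -/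

section IsoProb

variable {n m P : ℕ}

/-- All keys held by the nodes in `T`. -/
def unionKeys {r : ℕ} (T : Finset (Fin n)) (x : Fin n → Fin r × Finset (Fin P)) :
    Finset (Fin P) :=
  T.biUnion fun u => (x u).2

/-- `A` is the set of nodes in `T` whose Erdős–Rényi link to the new node is present; the new ring
has to avoid all keys of `A`, while the other nodes of `T` impose nothing. -/
theorem isoFactor_eq_sum {r : ℕ} (α : ℝ) (T : Finset (Fin n))
    (x : Fin n → Fin r × Finset (Fin P)) (y : Fin r × Finset (Fin P)) :
    isoFactor α T x y = ∑ A ∈ T.powerset, α ^ A.card * (1 - α) ^ (T \ A).card *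
      if Disjoint y.2 (unionKeys A x) then 1 else 0 := by
  have h1 : isoFactor α T x y =
      ∏ u ∈ T, ((α * if Disjoint y.2 (x u).2 then 1 else 0) + (1 - α)) := by
    refine Finset.prod_congr rfl fun u _ => ?_
    simp only [disjoint_comm (a := y.2), ← Finset.not_disjoint_iff_nonempty_inter]
    split_ifs <;> simp_all
  rw [h1, Finset.prod_add]
  refine Finset.sum_congr rfl fun A _ => ?_
  rw [Finset.prod_mul_distrib, Finset.prod_const, Finset.prod_const, mul_right_comm]
  congr 1
  simp only [unionKeys, Finset.disjoint_biUnion_right]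
  split_ifs with h
  · exact Finset.prod_eq_one fun u hu => by simp [h u hu]
  · push Not at h
    obtain ⟨u, hu, hd⟩ := h
    exact Finset.prod_eq_zero hu (by simp [hd])

theorem isoProb_eq_sum {r : ℕ} (μ : Fin r → ℝ) (K : Fin r → ℕ) (α : ℝ)
    (T : Finset (Fin n)) (x : Fin n → Fin r × Finset (Fin P)) :
    isoProb μ K α T x = ∑ j, μ j * ∑ A ∈ T.powerset, α ^ A.card * (1 - α) ^ (T \ A).card *
      missProb P (K j) (unionKeys A x).card := by
  rw [isoProb, sum_nodeWeight_mul]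
  refine Finset.sum_congr rfl fun j _ => ?_
  congr 1
  simp only [isoFactor_eq_sum]
  rw [ringAvg_sum]
  refine Finset.sum_congr rfl fun A _ => ?_
  rw [ringAvg_const_mul, ringAvg_disjoint]

/-- Small subfamilies of the rings of the nodes in `T` cover many keys. -/
def SpreadOn {r : ℕ} (h i₀ : ℕ) (T : Finset (Fin n)) (x : Fin n → Fin r × Finset (Fin P)) : Prop :=
  ∀ A ⊆ T, A.card ≤ i₀ → h * A.card ≤ (unionKeys A x).card

theorem dependsOn_spreadOn {r : ℕ} (h i₀ : ℕ) (T : Finset (Fin n)) :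
    DependsOn (SpreadOn (P := P) (r := r) h i₀ T) (T : Set (Fin n)) := by
  intro x y hxy
  have : ∀ A ⊆ T, unionKeys A x = unionKeys A y := fun A hA =>
    Finset.biUnion_congr rfl fun u hu => by rw [hxy u (hA hu)]
  simp only [SpreadOn, eq_iff_iff]
  exact ⟨fun H A hA hc => this A hA ▸ H A hA hc, fun H A hA hc => (this A hA).symm ▸ H A hA hc⟩

theorem unionKeys_mono {r : ℕ} {A B : Finset (Fin n)} (h : A ⊆ B)
    (x : Fin n → Fin r × Finset (Fin P)) : unionKeys A x ⊆ unionKeys B x :=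
  Finset.biUnion_subset_biUnion_of_subset_left _ h

theorem card_unionKeys_le {r : ℕ} (A : Finset (Fin n)) (x : Fin n → Fin r × Finset (Fin P)) :
    (unionKeys A x).card ≤ P := by simpa using Finset.card_le_univ (unionKeys A x)

/-- The probability that the ring of a node of class `j` meets a ring of the smallest class. -/
noncomputable def firstEdgeProb (K : Fin (m + 1) → ℕ) (P : ℕ) (j : Fin (m + 1)) : ℝ :=
  1 - missProb P (K j) (K 0)

theorem firstEdgeProb_nonneg (K : Fin (m + 1) → ℕ) (P : ℕ) (j : Fin (m + 1)) :
    0 ≤ firstEdgeProb K P j := sub_nonneg.2 (missProb_le_one _ _ _)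

theorem firstEdgeProb_le_one (K : Fin (m + 1) → ℕ) (P : ℕ) (j : Fin (m + 1)) :
    firstEdgeProb K P j ≤ 1 := by
  unfold firstEdgeProb
  linarith [missProb_nonneg P (K j) (K 0)]

theorem firstEdgeProb_le_min {K : Fin (m + 1) → ℕ} (hK : ∀ i, K i ≤ P) (j : Fin (m + 1)) :
    firstEdgeProb K P j ≤ min 1 ((K 0 : ℝ) * K j / P) :=
  le_min (firstEdgeProb_le_one K P j) (one_sub_missProb_le (hK j) (hK 0))

theorem half_min_le_firstEdgeProb {K : Fin (m + 1) → ℕ} (hK : ∀ i, K i ≤ P) (j : Fin (m + 1)) :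
    min 1 ((K 0 : ℝ) * K j / P) / 2 ≤ firstEdgeProb K P j := by
  have h1 := half_min_le_one_sub_exp_neg (t := (K 0 : ℝ) * K j / P) (by positivity)
  have h2 := missProb_le_exp (hK j) (hK 0)
  unfold firstEdgeProb
  linarith

theorem hitProb_zero_eq (μ : Fin (m + 1) → ℝ) (K : Fin (m + 1) → ℕ) (P : ℕ) :
    hitProb μ K P (K 0) = ∑ j, μ j * firstEdgeProb K P j := rfl

/-- Condition on the set `A` of present Erdős–Rényi links. If `A` is small, its rings hold at least
`h * A.card` keys, so every node of `A` contributes a factor `exp (-h * K j / P)` and the binomial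
sum collapses to a power. If `A` has more than `i₀` nodes, its rings hold at least `P / 16` keys;
this yields the additive error, which occurs only if `T` itself has more than `i₀` nodes. -/
theorem isoProb_le_of_spreadOn {μ : Fin (m + 1) → ℝ} (hμ : ∀ i, 0 ≤ μ i) (hμ1 : ∑ i, μ i = 1)
    {K : Fin (m + 1) → ℕ} (hK : ∀ i, K i ≤ P) (hmono : Monotone K) (hK0 : 2 ≤ K 0)
    (h16 : 16 * K 0 ≤ P) (α : unitInterval) {T : Finset (Fin n)}
    {x : Fin n → Fin (m + 1) × Finset (Fin P)}
    (hx : SpreadOn (K 0 / 2) (P / (8 * (K 0 / 2))) T x) :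
    isoProb μ K α T x ≤
      ∑ j, μ j * Real.exp (-((T.card : ℝ) * (α * firstEdgeProb K P j) / 6)) +
        (if P / (8 * (K 0 / 2)) < T.card then Real.exp (-((K 0 : ℝ) / 16)) else 0) := by
  classical
  set h := K 0 / 2 with hh
  set i₀ := P / (8 * h) with hi₀
  have hh1 : 1 ≤ h := by omega
  have hP : (0 : ℝ) < P := by exact_mod_cast (by omega : 0 < P)
  set ε : ℝ := if i₀ < T.card then Real.exp (-((K 0 : ℝ) / 16)) else 0 with hε
  have hε0 : 0 ≤ ε := by rw [hε]; split_ifs <;> positivity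
  have hα0 : 0 ≤ (α : ℝ) := α.2.1
  have hα1 : 0 ≤ 1 - (α : ℝ) := by linarith [α.2.2]
  have hmiss : ∀ j, ∀ A ∈ T.powerset, missProb P (K j) (unionKeys A x).card ≤
      Real.exp (-((h : ℝ) * K j / P)) ^ A.card + ε := by
    intro j A hA
    rw [Finset.mem_powerset] at hA
    have hle := missProb_le_exp (hK j) (card_unionKeys_le A x)
    by_cases hAi : A.card ≤ i₀
    · have h1 : ((h * A.card : ℕ) : ℝ) ≤ ((unionKeys A x).card : ℝ) := by
        exact_mod_cast hx A hA hAi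
      have : missProb P (K j) (unionKeys A x).card ≤ Real.exp (-((h : ℝ) * K j / P)) ^ A.card := by
        refine hle.trans ?_
        rw [← Real.exp_nat_mul, Real.exp_le_exp]
        have : (h * A.card : ℝ) * (K j / P) ≤ (unionKeys A x).card * (K j / P) := by
          push_cast at h1
          exact mul_le_mul_of_nonneg_right h1 (by positivity)
        have e1 : (A.card : ℝ) * (-((h : ℝ) * K j / P)) = -((h * A.card : ℝ) * (K j / P)) := by ring
        rw [e1, mul_div_assoc]
        linarith
      linarith
    · push Not at hAi
      have hTi : i₀ < T.card := hAi.trans_le (Finset.card_le_card hA)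
      obtain ⟨A', hA', hA'c⟩ := Finset.exists_subset_card_eq hAi.le
      have h1 := hx A' (hA'.trans hA) hA'c.le
      rw [hA'c] at h1
      have h2 : h * i₀ ≤ (unionKeys A x).card :=
        h1.trans (Finset.card_le_card (unionKeys_mono hA' x))
      -- Rounding `P / (8 * h)` down loses less than `8 * h`, and `16 * K 0 ≤ P` makes this at most
      -- a quarter of `P`.
      have h3 : P ≤ 16 * (h * i₀) := by
        have h4 : P < 8 * h * (i₀ + 1) := by
          rw [hi₀, mul_comm]; exact Nat.lt_mul_of_div_lt (Nat.lt_succ_self _) (by omega)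
        have : 8 * h * (i₀ + 1) = 8 * (h * i₀) + 8 * h := by ring
        omega
      have h5 : (P : ℝ) ≤ 16 * (unionKeys A x).card := by exact_mod_cast h3.trans (by omega)
      have h6 : missProb P (K j) (unionKeys A x).card ≤ ε := by
        rw [hε, if_pos hTi]
        refine hle.trans (Real.exp_le_exp.2 (neg_le_neg ?_))
        rw [div_le_div_iff₀ (by norm_num) hP]
        have h7 : (K 0 : ℝ) ≤ K j := by exact_mod_cast hmono (Fin.zero_le j)
        calc (K 0 : ℝ) * P ≤ K j * (16 * (unionKeys A x).card) := by gcongr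
          _ = _ := by ring
      have : 0 ≤ Real.exp (-((h : ℝ) * K j / P)) ^ A.card := by positivity
      linarith
  have hsum1 : ∑ A ∈ T.powerset, (α : ℝ) ^ A.card * (1 - α) ^ (T \ A).card = 1 := by
    have := Finset.prod_add (fun _ : Fin n => (α : ℝ)) (fun _ => 1 - (α : ℝ)) T
    simp only [Finset.prod_const, add_sub_cancel, one_pow] at this
    exact this.symm
  have hsumj : ∀ j, ∑ A ∈ T.powerset, (α : ℝ) ^ A.card * (1 - α) ^ (T \ A).card *
      Real.exp (-((h : ℝ) * K j / P)) ^ A.card =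
      (1 - α * (1 - Real.exp (-((h : ℝ) * K j / P)))) ^ T.card := by
    intro j
    have := Finset.prod_add (fun _ : Fin n => (α : ℝ) * Real.exp (-((h : ℝ) * K j / P)))
      (fun _ => 1 - (α : ℝ)) T
    simp only [Finset.prod_const, mul_pow] at this
    rw [show 1 - (α : ℝ) * (1 - Real.exp (-((h : ℝ) * K j / P))) =
      α * Real.exp (-((h : ℝ) * K j / P)) + (1 - α) by ring, this]
    exact Finset.sum_congr rfl fun A _ => by ring
  have hjb : ∀ j, ∑ A ∈ T.powerset, (α : ℝ) ^ A.card * (1 - α) ^ (T \ A).card *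
      missProb P (K j) (unionKeys A x).card ≤
      Real.exp (-((T.card : ℝ) * (α * firstEdgeProb K P j) / 6)) + ε := by
    intro j
    calc _ ≤ ∑ A ∈ T.powerset, ((α : ℝ) ^ A.card * (1 - α) ^ (T \ A).card *
          (Real.exp (-((h : ℝ) * K j / P)) ^ A.card + ε)) := by
          refine Finset.sum_le_sum fun A hA => ?_
          exact mul_le_mul_of_nonneg_left (hmiss j A hA) (by positivity)
      _ = (1 - α * (1 - Real.exp (-((h : ℝ) * K j / P)))) ^ T.card + ε := by
          simp only [mul_add, Finset.sum_add_distrib, hsumj, ← Finset.sum_mul, hsum1, one_mul]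
      _ ≤ _ := by
          refine add_le_add_left ?_ ε
          set a := Real.exp (-((h : ℝ) * K j / P)) with ha
          have ha0 : 0 < a := Real.exp_pos _
          -- The 6 is 2 from `half_min_le_one_sub_exp_neg` times 3 from `K 0 ≤ 3 * h`, where the 3
          -- allows for rounding in `h = K 0 / 2`.
          have hlow : firstEdgeProb K P j / 6 ≤ 1 - a := by
            have h1 := half_min_le_one_sub_exp_neg (t := (h : ℝ) * K j / P) (by positivity)
            have h2 := firstEdgeProb_le_min hK j
            have h3 : min 1 ((K 0 : ℝ) * K j / P) / 3 ≤ min 1 ((h : ℝ) * K j / P) := by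
              refine le_min ?_ ?_
              · have := min_le_left 1 ((K 0 : ℝ) * K j / P); linarith
              · have h4 := min_le_right 1 ((K 0 : ℝ) * K j / P)
                have h5 : (K 0 : ℝ) ≤ 3 * h := by exact_mod_cast (by omega : K 0 ≤ 3 * h)
                have h6 : (K 0 : ℝ) * (K j / P) ≤ 3 * h * (K j / P) :=
                  mul_le_mul_of_nonneg_right h5 (by positivity)
                rw [mul_div_assoc] at h4 ⊢
                rw [mul_div_assoc]
                linarith
            linarith
          have h0 : 0 ≤ 1 - α * (1 - a) := by nlinarith [α.2.2]
          have h1 : 1 - α * (1 - a) ≤ Real.exp (-(α * (firstEdgeProb K P j / 6))) := by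
            refine le_trans ?_ (Real.one_sub_le_exp_neg _)
            have := mul_le_mul_of_nonneg_left hlow hα0
            linarith
          refine (pow_le_pow_left₀ h0 h1 _).trans (le_of_eq ?_)
          rw [← Real.exp_nat_mul]
          congr 1; ring
  rw [isoProb_eq_sum]
  calc _ ≤ ∑ j, μ j * (Real.exp (-((T.card : ℝ) * (α * firstEdgeProb K P j) / 6)) + ε) :=
        Finset.sum_le_sum fun j _ => mul_le_mul_of_nonneg_left (hjb j) (hμ j)
    _ = _ := by simp only [mul_add, Finset.sum_add_distrib, ← Finset.sum_mul, hμ1, one_mul]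

/-- No ring of a node in `T` shares more than half of its keys with another one. -/
def HalfOverlap {r : ℕ} (T : Finset (Fin n)) (x : Fin n → Fin r × Finset (Fin P)) : Prop :=
  ∀ u ∈ T, ∀ v ∈ T, u ≠ v → 2 * ((x u).2 ∩ (x v).2).card ≤ (x v).2.card

theorem dependsOn_halfOverlap {r : ℕ} (T : Finset (Fin n)) :
    DependsOn (HalfOverlap (P := P) (r := r) T) (T : Set (Fin n)) := by
  intro x y hxy
  simp only [HalfOverlap, eq_iff_iff]
  exact ⟨fun H u hu v hv => by rw [← hxy u hu, ← hxy v hv]; exact H u hu v hv,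
    fun H u hu v hv => by rw [hxy u hu, hxy v hv]; exact H u hu v hv⟩

/-- Two nodes `u`, `v` of `T` suffice. With `A` the ring of `u` and `B` the part of the ring of `v`
outside it, `A` and `B` are disjoint and `B` has at least `K 0 / 2` keys; by `missProb_add_le` the
bound factors over the two nodes. -/
theorem isoProb_le_of_halfOverlap {μ : Fin (m + 1) → ℝ} (hμ : ∀ i, 0 ≤ μ i)
    {K : Fin (m + 1) → ℕ} (hK : ∀ i, K i ≤ P) (hmono : Monotone K)
    (α : unitInterval) {T : Finset (Fin n)} (hT : 2 ≤ T.card)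
    {x : Fin n → Fin (m + 1) × Finset (Fin P)} (hc : ∀ v, (x v).2.card = K (x v).1)
    (hx : HalfOverlap T x) :
    isoProb μ K α T x ≤ ∑ j, μ j * ((1 - α * firstEdgeProb K P j) *
      (1 - α * (firstEdgeProb K P j / 4))) := by
  obtain ⟨u, hu, v, hv, huv⟩ := Finset.one_lt_card.1 hT
  have hα0 : 0 ≤ (α : ℝ) := α.2.1
  have hα1 : 0 ≤ 1 - (α : ℝ) := by linarith [α.2.2]
  rw [isoProb, sum_nodeWeight_mul]
  refine Finset.sum_le_sum fun j _ => mul_le_mul_of_nonneg_left ?_ (hμ j)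
  have hcB : K 0 ≤ 2 * ((x v).2 \ (x u).2).card := by
    have h1 := hx u hu v hv huv
    have h2 := Finset.card_sdiff_add_card_inter (x v).2 (x u).2
    rw [Finset.inter_comm] at h2
    have h3 : K 0 ≤ K (x v).1 := hmono (Fin.zero_le _)
    have h4 := hc v
    omega
  set A := (x u).2 with hA
  set B := (x v).2 \ (x u).2 with hB
  have hdAB : Disjoint A B := Finset.disjoint_sdiff
  have hcA : K 0 ≤ A.card := by rw [hA, hc u]; exact hmono (Fin.zero_le _)
  have hBP : B.card ≤ P := by simpa using Finset.card_le_univ B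
  have hAP : A.card ≤ P := by simpa using Finset.card_le_univ A
  -- The four terms correspond to the presence of the Erdős–Rényi links to `u` and to `v`. Replacing
  -- the ring of `v` by `B` only makes it easier to miss.
  calc ringAvg P (K j) (fun S => isoFactor α T x (j, S))
      ≤ ringAvg P (K j) (fun S => (1 - α) ^ 2 +
          ((α * (1 - α)) * (if Disjoint S A then 1 else 0) +
          ((α * (1 - α)) * (if Disjoint S B then 1 else 0) +
          (α : ℝ) ^ 2 * (if Disjoint S (A ∪ B) then 1 else 0)))) := by
        refine ringAvg_mono fun S _ => ?_
        have hsub : ({u, v} : Finset (Fin n)) ⊆ T := by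
          intro w hw
          rcases Finset.mem_insert.1 hw with rfl | hw
          · exact hu
          · rw [Finset.mem_singleton.1 hw]; exact hv
        have h1 : isoFactor α T x (j, S) ≤ isoFactor α {u, v} x (j, S) := by
          rw [isoFactor, isoFactor, ← Finset.prod_sdiff hsub]
          exact mul_le_of_le_one_left (Finset.prod_nonneg fun _ _ => one_sub_mul_ite_nonneg _ _)
            (Finset.prod_le_one (fun _ _ => one_sub_mul_ite_nonneg _ _)
              fun _ _ => one_sub_mul_ite_le_one _ _)
        refine h1.trans ?_
        rw [isoFactor, Finset.prod_pair huv]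
        have h2 : Disjoint S A ↔ ¬ (A ∩ S).Nonempty := by
          rw [← Finset.not_disjoint_iff_nonempty_inter, not_not, disjoint_comm]
        have h3 : ¬ ((x v).2 ∩ S).Nonempty → Disjoint S B := by
          rw [← Finset.not_disjoint_iff_nonempty_inter, not_not]
          intro hd
          exact (hd.mono_left Finset.sdiff_subset).symm
        have h4 : Disjoint S (A ∪ B) ↔ Disjoint S A ∧ Disjoint S B := Finset.disjoint_union_right
        simp only [h4]
        by_cases hSA : Disjoint S A
        · have e1 : ¬ (A ∩ S).Nonempty := h2.1 hSA
          by_cases hSB : Disjoint S B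
          · simp only [← hA, e1, hSA, hSB, if_true, if_false, and_self]
            have : 1 - (α : ℝ) * (if ((x v).2 ∩ S).Nonempty then 1 else 0) ≤ 1 := one_sub_mul_ite_le_one α _
            nlinarith
          · have e2 : ((x v).2 ∩ S).Nonempty := by by_contra h; exact hSB (h3 h)
            simp only [← hA, e1, e2, hSA, hSB, if_true, if_false, and_false]
            nlinarith
        · have e1 : (A ∩ S).Nonempty := by by_contra h; exact hSA (h2.2 h)
          by_cases hSB : Disjoint S B
          · simp only [← hA, e1, hSA, hSB, if_true, if_false, false_and]
            have : 1 - (α : ℝ) * (if ((x v).2 ∩ S).Nonempty then 1 else 0) ≤ 1 := one_sub_mul_ite_le_one α _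
            nlinarith
          · have e2 : ((x v).2 ∩ S).Nonempty := by by_contra h; exact hSB (h3 h)
            simp only [← hA, e1, e2, hSA, hSB, if_true, if_false, and_false]
            nlinarith
    _ = (1 - α) ^ 2 + ((α * (1 - α)) * missProb P (K j) A.card +
          ((α * (1 - α)) * missProb P (K j) B.card +
          (α : ℝ) ^ 2 * missProb P (K j) (A.card + B.card))) := by
        rw [ringAvg_add, ringAvg_add, ringAvg_add, ringAvg_const (hK j), ringAvg_const_mul,
          ringAvg_const_mul, ringAvg_const_mul, ringAvg_disjoint, ringAvg_disjoint,
          ringAvg_disjoint, Finset.card_union_of_disjoint hdAB]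
    _ ≤ (1 - α + α * missProb P (K j) A.card) * (1 - α + α * missProb P (K j) B.card) := by
        have := mul_le_mul_of_nonneg_left (missProb_add_le (a := A.card) (b := B.card) (hK j))
          (sq_nonneg (α : ℝ))
        nlinarith
    _ ≤ _ := by
        have hqA : missProb P (K j) A.card ≤ 1 - firstEdgeProb K P j := by
          unfold firstEdgeProb
          linarith [missProb_anti P (K j) hcA]
        -- The 4 is 2 because `B` may be only half of a smallest ring, times 2 from
        -- `half_min_le_one_sub_exp_neg`.
        have hqB : missProb P (K j) B.card ≤ 1 - firstEdgeProb K P j / 4 := by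
          have h1 := missProb_le_exp (hK j) hBP
          have h2 := half_min_le_one_sub_exp_neg (t := (B.card : ℝ) * K j / P) (by positivity)
          have h3 := firstEdgeProb_le_min hK j
          have h4 : min 1 ((K 0 : ℝ) * K j / P) / 2 ≤ min 1 ((B.card : ℝ) * K j / P) := by
            refine le_min ?_ ?_
            · have := min_le_left 1 ((K 0 : ℝ) * K j / P); linarith
            · have h4 := min_le_right 1 ((K 0 : ℝ) * K j / P)
              have h5 : (K 0 : ℝ) ≤ 2 * B.card := by exact_mod_cast hcB
              have h6 : (K 0 : ℝ) * (K j / P) ≤ 2 * B.card * (K j / P) :=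
                mul_le_mul_of_nonneg_right h5 (by positivity)
              rw [mul_div_assoc] at h4 ⊢
              rw [mul_div_assoc]
              linarith
          linarith
        have hA0 := missProb_nonneg P (K j) A.card
        have hB0 := missProb_nonneg P (K j) B.card
        have hp1 := firstEdgeProb_le_one K P j
        have h1 : 1 - α + α * missProb P (K j) A.card ≤ 1 - α * firstEdgeProb K P j := by nlinarith
        have h2 : 1 - α + α * missProb P (K j) B.card ≤ 1 - α * (firstEdgeProb K P j / 4) := by
          nlinarith
        refine mul_le_mul h1 h2 ?_ ?_
        · positivity
        · exact le_trans (by positivity) h1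

end IsoProb

end RandomKeyGraph

namespace RandomKeyGraph

open MeasureTheory ProbabilityTheory

/-! ### Irregular key rings are unlikely. -/

section Events

variable {n r P : ℕ}

theorem isProbabilityMeasure_modelLaw {μ : Fin r → ℝ} (hμ : ∀ i, 0 ≤ μ i) (hμ1 : ∑ i, μ i = 1)
    {K : Fin r → ℕ} (hK : ∀ i, K i ≤ P) (α : unitInterval) :
    IsProbabilityMeasure (modelLaw n μ K P α) := by
  have := isProbabilityMeasure_nodeLaw hμ hμ1 hK
  unfold modelLaw
  infer_instance

theorem modelLaw_real_fst {μ : Fin r → ℝ} (hμ : ∀ i, 0 ≤ μ i) (hμ1 : ∑ i, μ i = 1)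
    {K : Fin r → ℕ} (hK : ∀ i, K i ≤ P) (α : unitInterval)
    (Φ : (Fin n → Fin r × Finset (Fin P)) → Prop) [DecidablePred Φ] :
    (modelLaw n μ K P α).real {ω | Φ ω.1} =
      expect (nodeWeight μ K P) (fun x => if Φ x then 1 else 0) := by
  have := modelLaw_real_cylinder hμ hμ1 hK α Φ ∅ ∅ (by simp) (by simp) (by simp)
  simp only [Finset.notMem_empty, false_implies, implies_true, and_self, and_true,
    Finset.prod_empty, mul_one] at this
  rw [this]
  exact expect_congr fun x _ => by congr

theorem modelLaw_real_subset_le {μ : Fin r → ℝ} (hμ : ∀ i, 0 ≤ μ i) (hμ1 : ∑ i, μ i = 1)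
    {K : Fin r → ℕ} (hK : ∀ i, K i ≤ P) (hP : 0 < P) (α : unitInterval) (A : Finset (Fin n))
    (W : Finset (Fin P)) {b : ℕ} (hb : ∀ j, b ≤ K j) :
    (modelLaw n μ K P α).real {ω | ∀ u ∈ A, (ω.1 u).2 ⊆ W} ≤
      (((W.card : ℝ) / P) ^ b) ^ A.card := by
  classical
  have hν := nodeWeight_nonneg hμ K P
  have hν1 := sum_nodeWeight hμ1 hK
  rw [modelLaw_real_fst hμ hμ1 hK α (fun x => ∀ u ∈ A, (x u).2 ⊆ W)]
  have h1 : expect (nodeWeight μ K P) (fun x : Fin n → Fin r × Finset (Fin P) =>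
      if ∀ u ∈ A, (x u).2 ⊆ W then (1 : ℝ) else 0) =
      expect (nodeWeight μ K P) (fun x : Fin n → Fin r × Finset (Fin P) =>
        1 * ∏ u ∈ A, if (x u).2 ⊆ W then (1 : ℝ) else 0) := by
    refine expect_congr fun x _ => ?_
    rw [one_mul]
    split_ifs with h
    · exact (Finset.prod_eq_one fun u hu => by simp [h u hu]).symm
    · push Not at h
      obtain ⟨u, hu, hd⟩ := h
      exact (Finset.prod_eq_zero hu (by simp [hd])).symm
  rw [h1, expect_mul_prod hν1 A (fun _ => 1) (fun _ _ _ => rfl)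
    (fun _ y _ => if y.2 ⊆ W then (1 : ℝ) else 0) (fun _ _ _ _ _ => rfl)]
  simp only [Finset.prod_const, one_mul]
  rw [expect_const hν1]
  have hPr : (0 : ℝ) < P := by exact_mod_cast hP
  have hW : (W.card : ℝ) / P ≤ 1 :=
    div_le_one_of_le₀ (by exact_mod_cast (by simpa using Finset.card_le_univ W)) hPr.le
  refine pow_le_pow_left₀ (Finset.sum_nonneg fun y _ => mul_nonneg (hν y)
    (by split_ifs <;> norm_num)) ?_ _
  rw [sum_nodeWeight_mul]
  calc _ ≤ ∑ j, μ j * ((W.card : ℝ) / P) ^ b := by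
        refine Finset.sum_le_sum fun j _ => mul_le_mul_of_nonneg_left ?_ (hμ j)
        exact (ringAvg_subset_le (hK j) hP W).trans
          (pow_le_pow_of_le_one (by positivity) hW (hb j))
    _ = _ := by rw [← Finset.sum_mul, hμ1, one_mul]

theorem choose_le_exp_mul_div_pow (a b : ℕ) (hb : 0 < b) :
    (a.choose b : ℝ) ≤ (Real.exp 1 * a / b) ^ b := by
  have hb' : (0 : ℝ) < b := by exact_mod_cast hb
  have h1 : (a.choose b : ℝ) ≤ (a : ℝ) ^ b / (b.factorial : ℝ) := Nat.choose_le_pow_div b a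
  have h2 := Real.pow_div_factorial_le_exp (b : ℝ) hb'.le b
  have h3 : (Real.exp 1 * a / b) ^ b = (a : ℝ) ^ b * (Real.exp b / (b : ℝ) ^ b) := by
    rw [div_pow, mul_pow, ← Real.exp_nat_mul, mul_one]; ring
  rw [h3]
  refine h1.trans ?_
  rw [div_eq_mul_inv]
  refine mul_le_mul_of_nonneg_left ?_ (by positivity)
  rw [le_div_iff₀ (by positivity)]
  rw [div_eq_inv_mul] at h2
  exact h2

/-- Union bound over `i` nodes `A` and a set `W` of exactly `h * i` keys containing all their rings.
Every ring has at least `2 * h` keys, twice what `W` offers per node, so with `z = h * i / P` the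
power of `z` beats the number of choices of `W`. -/
theorem modelLaw_real_not_spreadOn_le {μ : Fin r → ℝ} (hμ : ∀ i, 0 ≤ μ i) (hμ1 : ∑ i, μ i = 1)
    {K : Fin r → ℕ} (hK : ∀ i, K i ≤ P) (hP : 0 < P) (α : unitInterval) {h : ℕ} (hh : 1 ≤ h)
    (hb : ∀ j, 2 * h ≤ K j) {ε : ℝ} (hε : 16 * ((n : ℝ) / P) * h * (1 / 2) ^ h ≤ ε)
    (hε2 : ε ≤ 1 / 2) :
    (modelLaw n μ K P α).real {ω | ¬ SpreadOn h (P / (8 * h)) Finset.univ ω.1} ≤ 2 * ε := by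
  classical
  have := isProbabilityMeasure_modelLaw (n := n) hμ hμ1 hK α
  set i₀ := P / (8 * h) with hi₀
  have hPr : (0 : ℝ) < P := by exact_mod_cast hP
  have hhr : (1 : ℝ) ≤ h := by exact_mod_cast hh
  have hε0 : 0 ≤ ε := le_trans (by positivity) hε
  have hi₀P : 8 * (h * i₀) ≤ P := by
    have := Nat.div_mul_le_self P (8 * h)
    calc 8 * (h * i₀) = i₀ * (8 * h) := by ring
      _ ≤ P := this
  have hsub : {ω : (Fin n → Fin r × Finset (Fin P)) × SimpleGraph (Fin n) |
      ¬ SpreadOn h i₀ Finset.univ ω.1} ⊆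
      ⋃ i ∈ Finset.Icc 1 i₀, ⋃ A ∈ (Finset.univ : Finset (Fin n)).powersetCard i,
        ⋃ W ∈ (Finset.univ : Finset (Fin P)).powersetCard (h * i),
          {ω | ∀ u ∈ A, (ω.1 u).2 ⊆ W} := by
    intro ω hω
    simp only [Set.mem_ofPred_eq, SpreadOn, not_forall, not_le] at hω
    obtain ⟨A, -, hA, hlt⟩ := hω
    have hA1 : 1 ≤ A.card := by
      by_contra hcon
      have : A.card = 0 := by omega
      rw [this] at hlt; omega
    have hle : h * A.card ≤ P := by nlinarith
    obtain ⟨W, hW, -, hWc⟩ := Finset.exists_subsuperset_card_eq (s := unionKeys A ω.1)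
      (t := Finset.univ) (Finset.subset_univ _) hlt.le (by simpa using hle)
    simp only [Set.mem_iUnion, Finset.mem_Icc, Finset.mem_powersetCard, Finset.subset_univ,
      true_and]
    refine ⟨A.card, ⟨hA1, hA⟩, A, rfl, W, hWc, fun u hu => ?_⟩
    exact (Finset.subset_biUnion_of_mem (fun u => (ω.1 u).2) hu).trans hW
  calc (modelLaw n μ K P α).real {ω | ¬ SpreadOn h i₀ Finset.univ ω.1}
      ≤ ∑ i ∈ Finset.Icc 1 i₀, ∑ A ∈ (Finset.univ : Finset (Fin n)).powersetCard i,
        ∑ W ∈ (Finset.univ : Finset (Fin P)).powersetCard (h * i),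
          (modelLaw n μ K P α).real {ω | ∀ u ∈ A, (ω.1 u).2 ⊆ W} := by
        refine (measureReal_mono hsub (measure_ne_top _ _)).trans ?_
        refine (measureReal_biUnion_finset_le _ _).trans (Finset.sum_le_sum fun i _ => ?_)
        refine (measureReal_biUnion_finset_le _ _).trans (Finset.sum_le_sum fun A _ => ?_)
        exact measureReal_biUnion_finset_le _ _
    _ ≤ ∑ i ∈ Finset.Icc 1 i₀, (n.choose i : ℝ) * (P.choose (h * i) *
          ((((h * i : ℕ) : ℝ) / P) ^ (2 * h)) ^ i) := by
        refine Finset.sum_le_sum fun i _ => ?_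
        have hcard : ∀ a b : ℕ, ((Finset.univ : Finset (Fin a)).powersetCard b).card =
          a.choose b := by simp
        rw [← hcard n i, ← nsmul_eq_mul]
        refine Finset.sum_le_card_nsmul _ _ _ fun A hA => ?_
        rw [← hcard P (h * i), ← nsmul_eq_mul]
        refine Finset.sum_le_card_nsmul _ _ _ fun W hW => ?_
        have := modelLaw_real_subset_le hμ hμ1 hK hP α A W hb
        rwa [(Finset.mem_powersetCard.1 hA).2, (Finset.mem_powersetCard.1 hW).2] at this
    _ ≤ ∑ i ∈ Finset.Icc 1 i₀, ε ^ i := by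
        refine Finset.sum_le_sum fun i hi => ?_
        rw [Finset.mem_Icc] at hi
        have hir : (0 : ℝ) < i := by exact_mod_cast hi.1
        have hhi : 0 < h * i := Nat.mul_pos hh hi.1
        set z : ℝ := ((h * i : ℕ) : ℝ) / P with hz
        have hz0 : 0 < z := by
          rw [hz]
          have : (0 : ℝ) < ((h * i : ℕ) : ℝ) := by exact_mod_cast hhi
          positivity
        have hz8 : z ≤ 1 / 8 := by
          rw [hz, div_le_div_iff₀ hPr (by norm_num), one_mul]
          have : h * i * 8 ≤ P := by nlinarith
          exact_mod_cast this
        have hc1 := choose_le_exp_mul_div_pow n i hi.1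
        have hc2 := choose_le_exp_mul_div_pow P (h * i) hhi
        have e2 : Real.exp 1 * P / ((h * i : ℕ) : ℝ) = Real.exp 1 / z := by
          rw [hz]; field_simp
        rw [e2, pow_mul] at hc2
        calc (n.choose i : ℝ) * (P.choose (h * i) * (z ^ (2 * h)) ^ i)
            ≤ (Real.exp 1 * n / i) ^ i * (((Real.exp 1 / z) ^ h) ^ i * (z ^ (2 * h)) ^ i) := by
              gcongr
          _ = (Real.exp 1 * n / i * (Real.exp 1 * z) ^ h) ^ i := by
              rw [← mul_pow, ← mul_pow]
              congr 1
              rw [mul_comm 2 h, pow_mul', ← mul_pow]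
              congr 2
              field_simp
          _ ≤ ε ^ i := by
              refine pow_le_pow_left₀ (by positivity) (le_trans ?_ hε) _
              have he : Real.exp 1 ≤ 2.8 := by linarith [Real.exp_one_lt_d9]
              -- As `z ≤ 1 / 8`, all but one of the factors `exp 1 * z` are replaced by `1 / 2`. The
              -- last is kept because its `i` cancels the `1 / i` from the choice of the nodes, so
              -- the bound is uniform in `i`.
              have h1 : (Real.exp 1 * z) ^ h ≤ Real.exp 1 * z * (1 / 2) ^ (h - 1) := by
                obtain ⟨g, rfl⟩ : ∃ g, h = g + 1 := ⟨h - 1, by omega⟩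
                rw [pow_succ, mul_comm, Nat.add_sub_cancel]
                refine mul_le_mul_of_nonneg_left ?_ (by positivity)
                refine pow_le_pow_left₀ (by positivity) ?_ _
                nlinarith
              have h2 : (1 / 2 : ℝ) ^ (h - 1) = 2 * (1 / 2) ^ h := by
                obtain ⟨g, rfl⟩ : ∃ g, h = g + 1 := ⟨h - 1, by omega⟩
                rw [pow_succ, Nat.add_sub_cancel]; ring
              rw [h2] at h1
              calc Real.exp 1 * n / i * (Real.exp 1 * z) ^ h
                  ≤ Real.exp 1 * n / i * (Real.exp 1 * z * (2 * (1 / 2) ^ h)) := by gcongr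
                _ = (Real.exp 1 * Real.exp 1 * 2) * ((n : ℝ) / P * h * (1 / 2) ^ h) := by
                    rw [hz]; push_cast; field_simp
                _ ≤ 16 * ((n : ℝ) / P * h * (1 / 2) ^ h) := by
                    refine mul_le_mul_of_nonneg_right ?_ (by positivity)
                    nlinarith [Real.exp_pos 1]
                _ = _ := by ring
    _ ≤ 2 * ε := by
        have hlt : ε < 1 := by linarith
        have h1 : ∑ i ∈ Finset.Ico 1 (i₀ + 1), ε ^ i ≤ ε ^ 1 / (1 - ε) :=
          geom_sum_Ico_le_of_lt_one hε0 hlt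
        have h2 : Finset.Icc 1 i₀ = Finset.Ico 1 (i₀ + 1) := by
          ext i; simp only [Finset.mem_Icc, Finset.mem_Ico]; omega
        rw [h2]
        refine h1.trans ?_
        rw [pow_one, div_le_iff₀ (by linarith)]
        nlinarith

/-- Union bound over ordered pairs, resampling the ring of `u` against the fixed ring of `v`. The 4
absorbs the choice of half of that ring. -/
theorem modelLaw_real_not_halfOverlap_le {m : ℕ} {μ : Fin (m + 1) → ℝ} (hμ : ∀ i, 0 ≤ μ i)
    (hμ1 : ∑ i, μ i = 1)
    {K : Fin (m + 1) → ℕ} (hK : ∀ i, K i ≤ P) (hmono : Monotone K) (α : unitInterval)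
    (h4 : 4 * K (Fin.last m) ≤ P) (hP : 0 < P) :
    (modelLaw n μ K P α).real {ω | ¬ HalfOverlap Finset.univ ω.1} ≤
      (n : ℝ) ^ 2 * (4 * (K (Fin.last m) : ℝ) / P) ^ ((K 0 + 1) / 2) := by
  have := isProbabilityMeasure_modelLaw (n := n) hμ hμ1 hK α
  have hν := nodeWeight_nonneg hμ K P
  have hν1 := sum_nodeWeight hμ1 hK
  have hPr : (0 : ℝ) < P := by exact_mod_cast hP
  set c : ℝ := 4 * (K (Fin.last m) : ℝ) / P with hc
  have hc0 : 0 ≤ c := by positivity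
  have hc1 : c ≤ 1 := div_le_one_of_le₀ (by exact_mod_cast h4) hPr.le
  have hsub : {ω : (Fin n → Fin (m + 1) × Finset (Fin P)) × SimpleGraph (Fin n) |
      ¬ HalfOverlap Finset.univ ω.1} ⊆
      ⋃ u ∈ (Finset.univ : Finset (Fin n)), ⋃ v ∈ (Finset.univ : Finset (Fin n)),
        {ω | u ≠ v ∧ (ω.1 v).2.card < 2 * ((ω.1 u).2 ∩ (ω.1 v).2).card} := by
    intro ω hω
    simp only [Set.mem_ofPred_eq, HalfOverlap, not_forall, not_le, Finset.mem_univ] at hω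
    obtain ⟨u, -, v, -, huv, hlt⟩ := hω
    simp only [Set.mem_iUnion]
    exact ⟨u, Finset.mem_univ _, v, Finset.mem_univ _, huv, hlt⟩
  calc _ ≤ ∑ u ∈ (Finset.univ : Finset (Fin n)), ∑ v ∈ (Finset.univ : Finset (Fin n)),
        (modelLaw n μ K P α).real
          {ω | u ≠ v ∧ (ω.1 v).2.card < 2 * ((ω.1 u).2 ∩ (ω.1 v).2).card} := by
        refine (measureReal_mono hsub (measure_ne_top _ _)).trans ?_
        refine (measureReal_biUnion_finset_le _ _).trans (Finset.sum_le_sum fun u _ => ?_)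
        exact measureReal_biUnion_finset_le _ _
    _ ≤ ∑ u ∈ (Finset.univ : Finset (Fin n)), ∑ v ∈ (Finset.univ : Finset (Fin n)),
        c ^ ((K 0 + 1) / 2) := by
        refine Finset.sum_le_sum fun u _ => Finset.sum_le_sum fun v _ => ?_
        by_cases huv : u = v
        · simp only [huv, ne_eq, not_true, false_and, Set.ofPred_false, measureReal_empty]
          positivity
        simp only [ne_eq, huv, not_false_eq_true, true_and]
        rw [modelLaw_real_fst hμ hμ1 hK α
          (fun x => (x v).2.card < 2 * ((x u).2 ∩ (x v).2).card), expect_resample hν1 u]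
        rw [← expect_const (V := Fin n) hν1 (c ^ ((K 0 + 1) / 2))]
        refine expect_mono hν fun x hx => ?_
        simp only [Function.update_self, Function.update_of_ne (Ne.symm huv)]
        rw [sum_nodeWeight_mul μ K P
          (fun y => if (x v).2.card < 2 * (y.2 ∩ (x v).2).card then (1 : ℝ) else 0)]
        have hcv := card_of_nodeWeight_ne_zero (hx v)
        have hKv : K 0 ≤ (x v).2.card := by rw [hcv]; exact hmono (Fin.zero_le _)
        calc _ ≤ ∑ j, μ j * c ^ ((K 0 + 1) / 2) := by
              refine Finset.sum_le_sum fun j _ => mul_le_mul_of_nonneg_left ?_ (hμ j)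
              refine (ringAvg_half_inter_le (hK j) (x v).2).trans ?_
              have hKj : (K j : ℝ) ≤ K (Fin.last m) := by exact_mod_cast hmono (Fin.le_last j)
              set b := (x v).2.card
              -- `2 ^ b` is at most `4 ^ ((b + 1) / 2)`, so that it merges with the other power.
              calc (2 : ℝ) ^ b * ((K j : ℝ) / P) ^ ((b + 1) / 2)
                  ≤ 2 ^ (2 * ((b + 1) / 2)) * ((K (Fin.last m) : ℝ) / P) ^ ((b + 1) / 2) := by
                    gcongr
                    · norm_num
                    · omega
                _ = c ^ ((b + 1) / 2) := by
                    rw [pow_mul, ← mul_pow, hc, mul_div_assoc]; norm_num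
                _ ≤ c ^ ((K 0 + 1) / 2) := pow_le_pow_of_le_one hc0 hc1 (by omega)
          _ = _ := by rw [← Finset.sum_mul, hμ1, one_mul]
    _ = _ := by simp [sq, mul_assoc]

end Events

end RandomKeyGraph

namespace RandomKeyGraph

open MeasureTheory ProbabilityTheory

/-! ### Union bounds over small cuts and nodes of small degree. -/

section UnionBound

variable {n m P : ℕ}

/-- The event that some vertex set of size `ℓ`, with well-behaved key rings, has fewer than `k`
outer neighbours, and forms a connected set together with them. -/
def smallCut (h i₀ k ℓ : ℕ) :
    Set ((Fin n → Fin (m + 1) × Finset (Fin P)) × SimpleGraph (Fin n)) :=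
  {ω | ∃ T : Finset (Fin n), T.card = ℓ ∧ (outerBoundary (intersectionGraph ω) T).card < k ∧
    Grows (intersectionGraph ω) (T ∪ outerBoundary (intersectionGraph ω) T) ∧
    SpreadOn h i₀ T ω.1 ∧ HalfOverlap T ω.1}

theorem not_adj_of_notMem_union_outerBoundary {H : SimpleGraph (Fin n)} {T : Finset (Fin n)}
    {u w : Fin n} (hu : u ∈ T) (hw : w ∉ T ∪ outerBoundary H T) : ¬ H.Adj u w := by
  intro hadj
  rw [Finset.mem_union, not_or] at hw
  exact hw.2 (mem_outerBoundary.2 ⟨hw.1, u, hu, hadj⟩)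

/-- Union bound over the boundary size `j`, a tree spanning `T` and its boundary, and the position
of `T` in the tree. The tree's edges offset all but one of the factors `n` from the choice of
vertices, up to powers of `n * p`. The 8 is 4 for the Catalan number times 2 for the choice of `T`.
-/
theorem modelLaw_real_smallCut_le_tree {μ : Fin (m + 1) → ℝ} (hμ : ∀ i, 0 ≤ μ i)
    (hμ1 : ∑ i, μ i = 1) {K : Fin (m + 1) → ℕ} (hK : ∀ i, K i ≤ P) (α : unitInterval)
    {h i₀ k ℓ : ℕ} (hℓ : 1 ≤ ℓ) {ρ p : ℝ} (hρ0 : 0 ≤ ρ) (hp0 : 0 ≤ p)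
    (hp : ∀ j, (α : ℝ) * hitProb μ K P (K j) ≤ p)
    (hρ : ∀ (T : Finset (Fin n)) x, (∀ v, nodeWeight μ K P (x v) ≠ 0) → T.card = ℓ →
      SpreadOn h i₀ T x → HalfOverlap T x → isoProb μ K α T x ≤ ρ) :
    (modelLaw n μ K P α).real (smallCut h i₀ k ℓ) ≤
      ∑ j ∈ Finset.range k, (8 : ℝ) ^ (ℓ + j) * (n : ℝ) ^ (ℓ + j) * p ^ (ℓ + j - 1) *
        ρ ^ (n - (ℓ + j)) := by
  classical
  have := isProbabilityMeasure_modelLaw (n := n) hμ hμ1 hK α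
  let ev : TreeCode (Fin n) → Finset (Fin n) →
      Set ((Fin n → Fin (m + 1) × Finset (Fin P)) × SimpleGraph (Fin n)) := fun τ T =>
    {ω | (SpreadOn h i₀ T ω.1 ∧ HalfOverlap T ω.1) ∧
      (∀ e ∈ τ.edges, e ∈ (intersectionGraph ω).edgeSet) ∧
      ∀ u ∈ T, ∀ w ∉ τ.verts, ¬ (intersectionGraph ω).Adj u w}
  have hsub : (smallCut h i₀ k ℓ : Set ((Fin n → Fin (m + 1) × Finset (Fin P)) ×
      SimpleGraph (Fin n))) ⊆
      ⋃ j ∈ Finset.range k, ⋃ τ ∈ (TreeCode.codes (Fin n) (ℓ + j - 1)).filter TreeCode.Valid,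
        ⋃ T ∈ τ.verts.powersetCard ℓ, ev τ T := by
    rintro ω ⟨T, hT, hbd, hgr, hsp, hho⟩
    set S := outerBoundary (intersectionGraph ω) T with hS
    have hne : (T ∪ S).Nonempty := by
      have : T.Nonempty := Finset.card_pos.1 (by omega)
      exact this.mono Finset.subset_union_left
    obtain ⟨τ, hτ, hv, he⟩ := TreeCode.exists_of_grows hgr hne
    have hcard := TreeCode.card_verts hτ
    rw [hv, Finset.card_union_of_disjoint (disjoint_outerBoundary _ _), hT, ← hS] at hcard
    have hmem := TreeCode.mem_codes τ
    rw [show τ.size = ℓ + S.card - 1 by omega] at hmem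
    simp only [Set.mem_iUnion, Finset.mem_range, Finset.mem_filter, Finset.mem_powersetCard]
    refine ⟨S.card, hbd, τ, ⟨hmem, hτ⟩, T, ⟨hv ▸ Finset.subset_union_left, hT⟩, ⟨hsp, hho⟩, he, ?_⟩
    intro u hu w hw
    rw [hv] at hw
    exact not_adj_of_notMem_union_outerBoundary hu hw
  calc _ ≤ ∑ j ∈ Finset.range k, ∑ τ ∈ (TreeCode.codes (Fin n) (ℓ + j - 1)).filter TreeCode.Valid,
        ∑ T ∈ τ.verts.powersetCard ℓ, (modelLaw n μ K P α).real (ev τ T) := by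
        refine (measureReal_mono hsub (measure_ne_top _ _)).trans ?_
        refine (measureReal_biUnion_finset_le _ _).trans (Finset.sum_le_sum fun j _ => ?_)
        refine (measureReal_biUnion_finset_le _ _).trans (Finset.sum_le_sum fun τ _ => ?_)
        exact measureReal_biUnion_finset_le _ _
    _ ≤ ∑ j ∈ Finset.range k, (4 ^ (ℓ + j) * n ^ (ℓ + j) : ℝ) *
          ((2 : ℝ) ^ (ℓ + j) * (p ^ (ℓ + j - 1) * ρ ^ (n - (ℓ + j)))) := by
        refine Finset.sum_le_sum fun j _ => ?_
        have hcodes : (((TreeCode.codes (Fin n) (ℓ + j - 1)).filter TreeCode.Valid).card : ℝ) ≤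
            4 ^ (ℓ + j) * n ^ (ℓ + j) := by
          have h1 := (Finset.card_filter_le (TreeCode.codes (Fin n) (ℓ + j - 1))
            TreeCode.Valid).trans (TreeCode.card_codes_le _)
          rw [Fintype.card_fin, show ℓ + j - 1 + 1 = ℓ + j by omega] at h1
          have h2 : catalan (ℓ + j - 1) ≤ 4 ^ (ℓ + j) :=
            (TreeCode.catalan_le_four_pow _).trans (Nat.pow_le_pow_right (by norm_num) (by omega))
          exact_mod_cast h1.trans (Nat.mul_le_mul_right _ h2)
        refine le_trans ?_ (mul_le_mul_of_nonneg_right hcodes (by positivity))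
        rw [← nsmul_eq_mul]
        refine Finset.sum_le_card_nsmul _ _ _ fun τ hτ => ?_
        rw [Finset.mem_filter] at hτ
        have hsize := TreeCode.size_of_mem_codes hτ.1
        have hcard := TreeCode.card_verts hτ.2
        have hpc : ((τ.verts.powersetCard ℓ).card : ℝ) ≤ 2 ^ (ℓ + j) := by
          rw [Finset.card_powersetCard]
          have h3 := Nat.choose_le_two_pow τ.verts.card ℓ
          rw [show τ.verts.card = ℓ + j by omega] at h3 ⊢
          exact_mod_cast h3
        refine le_trans ?_ (mul_le_mul_of_nonneg_right hpc (by positivity))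
        rw [← nsmul_eq_mul]
        refine Finset.sum_le_card_nsmul _ _ _ fun T hT => ?_
        rw [Finset.mem_powersetCard] at hT
        have hdep : DependsOn (fun x : Fin n → Fin (m + 1) × Finset (Fin P) =>
            SpreadOn h i₀ T x ∧ HalfOverlap T x) (T : Set (Fin n)) := by
          intro x y hxy
          simp only [dependsOn_spreadOn h i₀ T hxy, dependsOn_halfOverlap T hxy]
        have hb := modelLaw_real_isolated_tree_le hμ hμ1 hK α hτ.2 hT.1 hdep
          (fun x hx hΦ => hρ T x hx hT.2 hΦ.1 hΦ.2) hρ0 hp0 hp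
        rwa [hsize, show ℓ + j - 1 + 1 = ℓ + j by omega] at hb
    _ = _ := by
        refine Finset.sum_congr rfl fun j _ => ?_
        rw [show (8 : ℝ) = 4 * 2 by norm_num, mul_pow]
        ring

/-- For large `ℓ` the power of `ρ` outweighs even a free choice of `T` and of its boundary, so the
tree is dropped. -/
theorem modelLaw_real_smallCut_le_choose {μ : Fin (m + 1) → ℝ} (hμ : ∀ i, 0 ≤ μ i)
    (hμ1 : ∑ i, μ i = 1) {K : Fin (m + 1) → ℕ} (hK : ∀ i, K i ≤ P) (α : unitInterval)
    {h i₀ k ℓ : ℕ} {ρ : ℝ} (hρ0 : 0 ≤ ρ)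
    (hρ : ∀ (T : Finset (Fin n)) x, (∀ v, nodeWeight μ K P (x v) ≠ 0) → T.card = ℓ →
      SpreadOn h i₀ T x → HalfOverlap T x → isoProb μ K α T x ≤ ρ) :
    (modelLaw n μ K P α).real (smallCut h i₀ k ℓ) ≤
      (n.choose ℓ : ℝ) * ∑ j ∈ Finset.range k, (n : ℝ) ^ j * ρ ^ (n - (ℓ + j)) := by
  classical
  have := isProbabilityMeasure_modelLaw (n := n) hμ hμ1 hK α
  have hν1 := sum_nodeWeight hμ1 hK
  let ev : Finset (Fin n) → Finset (Fin n) →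
      Set ((Fin n → Fin (m + 1) × Finset (Fin P)) × SimpleGraph (Fin n)) := fun T S =>
    {ω | (SpreadOn h i₀ T ω.1 ∧ HalfOverlap T ω.1) ∧
      (∀ e ∈ (∅ : Finset (Sym2 (Fin n))), e ∈ (intersectionGraph ω).edgeSet) ∧
      ∀ u ∈ T, ∀ w ∉ T ∪ S, ¬ (intersectionGraph ω).Adj u w}
  have hsub : (smallCut h i₀ k ℓ : Set ((Fin n → Fin (m + 1) × Finset (Fin P)) ×
      SimpleGraph (Fin n))) ⊆
      ⋃ T ∈ (Finset.univ : Finset (Fin n)).powersetCard ℓ, ⋃ j ∈ Finset.range k,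
        ⋃ S ∈ (Tᶜ : Finset (Fin n)).powersetCard j, ev T S := by
    rintro ω ⟨T, hT, hbd, hgr, hsp, hho⟩
    simp only [Set.mem_iUnion, Finset.mem_range, Finset.mem_powersetCard, Finset.subset_univ,
      true_and]
    refine ⟨T, hT, _, hbd, outerBoundary (intersectionGraph ω) T, ⟨?_, rfl⟩, ⟨hsp, hho⟩,
      by simp, ?_⟩
    · rw [Finset.subset_compl_iff_disjoint_left]
      exact disjoint_outerBoundary _ _
    · intro u hu w hw
      exact not_adj_of_notMem_union_outerBoundary hu hw
  calc _ ≤ ∑ T ∈ (Finset.univ : Finset (Fin n)).powersetCard ℓ, ∑ j ∈ Finset.range k,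
        ∑ S ∈ (Tᶜ : Finset (Fin n)).powersetCard j, (modelLaw n μ K P α).real (ev T S) := by
        refine (measureReal_mono hsub (measure_ne_top _ _)).trans ?_
        refine (measureReal_biUnion_finset_le _ _).trans (Finset.sum_le_sum fun j _ => ?_)
        refine (measureReal_biUnion_finset_le _ _).trans (Finset.sum_le_sum fun τ _ => ?_)
        exact measureReal_biUnion_finset_le _ _
    _ ≤ _ := by
        have hcard : (n.choose ℓ : ℝ) = ((Finset.univ : Finset (Fin n)).powersetCard ℓ).card := by
          simp
        rw [hcard, ← nsmul_eq_mul]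
        refine Finset.sum_le_card_nsmul _ _ _ fun T hT => Finset.sum_le_sum fun j _ => ?_
        rw [Finset.mem_powersetCard] at hT
        have hpc : (((Tᶜ : Finset (Fin n)).powersetCard j).card : ℝ) ≤ (n : ℝ) ^ j := by
          rw [Finset.card_powersetCard]
          have h1 : (Tᶜ : Finset (Fin n)).card ≤ n := by
            simpa using Finset.card_le_univ (Tᶜ : Finset (Fin n))
          exact_mod_cast (Nat.choose_le_pow _ _).trans (Nat.pow_le_pow_left h1 j)
        refine le_trans ?_ (mul_le_mul_of_nonneg_right hpc (by positivity))
        rw [← nsmul_eq_mul]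
        refine Finset.sum_le_card_nsmul _ _ _ fun S hS => ?_
        rw [Finset.mem_powersetCard, Finset.subset_compl_iff_disjoint_left] at hS
        have hdep : DependsOn (fun x : Fin n → Fin (m + 1) × Finset (Fin P) =>
            SpreadOn h i₀ T x ∧ HalfOverlap T x) (T : Set (Fin n)) := by
          intro x y hxy
          simp only [dependsOn_spreadOn h i₀ T hxy, dependsOn_halfOverlap T hxy]
        have hb := modelLaw_real_isolated_le hμ hμ1 hK α
          (Finset.subset_union_left (s₁ := T) (s₂ := S)) hdep
          (fun x hx hΦ => hρ T x hx hT.2 hΦ.1 hΦ.2) hρ0 ∅ (by simp) (by simp)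
        simp only [Finset.prod_empty] at hb
        rwa [expect_const hν1, mul_one, Finset.card_union_of_disjoint hS.1, hT.2, hS.2] at hb

/-- Union bound over the node, its class and its exact set of neighbours. -/
theorem modelLaw_real_small_degree_le {μ : Fin (m + 1) → ℝ} (hμ : ∀ i, 0 ≤ μ i)
    (hμ1 : ∑ i, μ i = 1) {K : Fin (m + 1) → ℕ} (hK : ∀ i, K i ≤ P) (α : unitInterval) (k : ℕ) :
    (modelLaw n μ K P α).real {ω | ∃ v, (outerBoundary (intersectionGraph ω) {v}).card < k} ≤
      n * ∑ j ∈ Finset.range k, ∑ c, (n : ℝ) ^ j * (μ c *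
        ((α * hitProb μ K P (K c)) ^ j * (1 - α * hitProb μ K P (K c)) ^ (n - 1 - j))) := by
  classical
  have := isProbabilityMeasure_modelLaw (n := n) hμ hμ1 hK α
  let ev : Fin n → Fin (m + 1) → Finset (Fin n) →
      Set ((Fin n → Fin (m + 1) × Finset (Fin P)) × SimpleGraph (Fin n)) := fun v c S =>
    {ω | (ω.1 v).1 = c ∧ ∀ w, w ∈ S ↔ (intersectionGraph ω).Adj v w}
  have hsub : {ω : (Fin n → Fin (m + 1) × Finset (Fin P)) × SimpleGraph (Fin n) |
      ∃ v, (outerBoundary (intersectionGraph ω) {v}).card < k} ⊆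
      ⋃ v ∈ (Finset.univ : Finset (Fin n)), ⋃ j ∈ Finset.range k,
        ⋃ c ∈ (Finset.univ : Finset (Fin (m + 1))),
          ⋃ S ∈ ({v}ᶜ : Finset (Fin n)).powersetCard j, ev v c S := by
    rintro ω ⟨v, hv⟩
    simp only [Set.mem_iUnion, Finset.mem_range, Finset.mem_powersetCard]
    refine ⟨v, Finset.mem_univ _, _, hv, (ω.1 v).1, Finset.mem_univ _,
      outerBoundary (intersectionGraph ω) {v}, ⟨?_, rfl⟩, rfl, ?_⟩
    · rw [Finset.subset_compl_iff_disjoint_left]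
      exact disjoint_outerBoundary _ _
    · intro w
      rw [mem_outerBoundary]
      simp only [Finset.mem_singleton, exists_eq_left]
      exact ⟨fun h => h.2, fun h => ⟨fun e => (intersectionGraph ω).irrefl (e ▸ h), h⟩⟩
  calc _ ≤ ∑ v ∈ (Finset.univ : Finset (Fin n)), ∑ j ∈ Finset.range k,
        ∑ c ∈ (Finset.univ : Finset (Fin (m + 1))),
          ∑ S ∈ ({v}ᶜ : Finset (Fin n)).powersetCard j, (modelLaw n μ K P α).real (ev v c S) := by
        refine (measureReal_mono hsub (measure_ne_top _ _)).trans ?_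
        refine (measureReal_biUnion_finset_le _ _).trans (Finset.sum_le_sum fun j _ => ?_)
        refine (measureReal_biUnion_finset_le _ _).trans (Finset.sum_le_sum fun τ _ => ?_)
        refine (measureReal_biUnion_finset_le _ _).trans (Finset.sum_le_sum fun τ _ => ?_)
        exact measureReal_biUnion_finset_le _ _
    _ ≤ _ := by
        have hcard : (n : ℝ) = ((Finset.univ : Finset (Fin n))).card := by simp
        conv_rhs => rw [hcard, ← nsmul_eq_mul]
        refine Finset.sum_le_card_nsmul _ _ _ fun v _ => Finset.sum_le_sum fun j _ =>
          Finset.sum_le_sum fun c _ => ?_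
        have hs1 : 0 ≤ 1 - α * hitProb μ K P (K c) := by
          have := mul_le_one₀ α.2.2 (hitProb_nonneg hμ K P (K c))
            (hitProb_le_one hμ hμ1 K P (K c))
          linarith
        have hs0 : 0 ≤ α * hitProb μ K P (K c) := mul_nonneg α.2.1 (hitProb_nonneg hμ K P (K c))
        have hpc : ((({v}ᶜ : Finset (Fin n)).powersetCard j).card : ℝ) ≤
            ((Finset.univ : Finset (Fin n)).card : ℝ) ^ j := by
          rw [Finset.card_powersetCard]
          have h1 : ({v}ᶜ : Finset (Fin n)).card ≤ (Finset.univ : Finset (Fin n)).card :=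
            Finset.card_le_univ ({v}ᶜ : Finset (Fin n))
          exact_mod_cast (Nat.choose_le_pow _ _).trans (Nat.pow_le_pow_left h1 j)
        refine le_trans ?_ (mul_le_mul_of_nonneg_right hpc (mul_nonneg (hμ c) (by positivity)))
        rw [← nsmul_eq_mul]
        refine Finset.sum_le_card_nsmul _ _ _ fun S hS => ?_
        rw [Finset.mem_powersetCard] at hS
        have hvS : v ∉ S := fun h => by simpa using hS.1 h
        have := modelLaw_real_class_neighbors hμ hμ1 hK α c v hvS
        rw [hS.2] at this
        exact this.le

/-- Failure of `k`-connectivity is due to irregular key rings, a vertex of small degree or a small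
cut. -/
theorem one_sub_probKConnected_le {μ : Fin (m + 1) → ℝ} (hμ : ∀ i, 0 ≤ μ i)
    (hμ1 : ∑ i, μ i = 1) {K : Fin (m + 1) → ℕ} (hK : ∀ i, K i ≤ P) (α : unitInterval) {k : ℕ}
    (hkn : k < n) (h i₀ : ℕ) :
    1 - probKConnected k n μ K P α ≤
      (modelLaw n μ K P α).real {ω | ¬ SpreadOn h i₀ Finset.univ ω.1} +
      (modelLaw n μ K P α).real {ω | ¬ HalfOverlap Finset.univ ω.1} +
      (modelLaw n μ K P α).real {ω | ∃ v, (outerBoundary (intersectionGraph ω) {v}).card < k} +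
      ∑ ℓ ∈ Finset.Icc 2 (n / 2), (modelLaw n μ K P α).real (smallCut h i₀ k ℓ) := by
  have := isProbabilityMeasure_modelLaw (n := n) hμ hμ1 hK α
  have h1 : 1 - probKConnected k n μ K P α =
      (modelLaw n μ K P α).real {ω | IsKConnected k (intersectionGraph ω)}ᶜ := by
    rw [probReal_compl_eq_one_sub MeasurableSet.of_discrete]; rfl
  rw [h1]
  have hsub : {ω : (Fin n → Fin (m + 1) × Finset (Fin P)) × SimpleGraph (Fin n) |
      IsKConnected k (intersectionGraph ω)}ᶜ ⊆
      (({ω | ¬ SpreadOn h i₀ Finset.univ ω.1} ∪ {ω | ¬ HalfOverlap Finset.univ ω.1}) ∪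
        {ω | ∃ v, (outerBoundary (intersectionGraph ω) {v}).card < k}) ∪
        ⋃ ℓ ∈ Finset.Icc 2 (n / 2), smallCut h i₀ k ℓ := by
    intro ω hω
    by_cases hsp : SpreadOn h i₀ Finset.univ ω.1
    swap
    · exact Or.inl (Or.inl (Or.inl hsp))
    by_cases hho : HalfOverlap Finset.univ ω.1
    swap
    · exact Or.inl (Or.inl (Or.inr hho))
    obtain ⟨T, hne, hhalf, hbd, hgr⟩ := exists_grows_of_not_isKConnected (by simpa using hkn) hω
    rw [Fintype.card_fin] at hhalf
    have hpos := hne.card_pos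
    by_cases h1 : T.card = 1
    · obtain ⟨v, rfl⟩ := Finset.card_eq_one.1 h1
      exact Or.inl (Or.inr ⟨v, hbd⟩)
    · refine Or.inr ?_
      simp only [Set.mem_iUnion, Finset.mem_Icc]
      exact ⟨T.card, ⟨by omega, by omega⟩, T, rfl, hbd, hgr,
        fun A _ hA => hsp A (Finset.subset_univ _) hA,
        fun u _ v _ => hho u (Finset.mem_univ _) v (Finset.mem_univ _)⟩
  refine (measureReal_mono hsub (measure_ne_top _ _)).trans ?_
  refine (measureReal_union_le _ _).trans (add_le_add ?_ (measureReal_biUnion_finset_le _ _))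
  refine (measureReal_union_le _ _).trans (add_le_add ?_ le_rfl)
  exact measureReal_union_le _ _

end UnionBound

end RandomKeyGraph

namespace RandomKeyGraph

open MeasureTheory ProbabilityTheory

/-! ### Isolation bounds in terms of the class-0 link probability. -/

section CutBounds

variable {n m P : ℕ}

/-- Either some `t j` is at least 1, and its term alone is at least `c`, or none of the minima is
active. -/
theorem mul_min_one_le_sum {ι : Type*} [Fintype ι] {w : ι → ℝ} {c : ℝ} (hw : ∀ j, c ≤ w j)
    (hc0 : 0 ≤ c) {t : ι → ℝ} (ht : ∀ j, 0 ≤ t j) (hc1 : c ≤ 1) :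
    c * min 1 (∑ j, w j * t j) ≤ ∑ j, w j * min 1 (t j) := by
  by_cases h : ∃ j, 1 ≤ t j
  · obtain ⟨j, hj⟩ := h
    have h1 : w j * min 1 (t j) ≤ ∑ j, w j * min 1 (t j) :=
      Finset.single_le_sum (f := fun j => w j * min 1 (t j))
        (fun i _ => mul_nonneg (hc0.trans (hw i)) (le_min zero_le_one (ht i))) (Finset.mem_univ j)
    rw [min_eq_left hj, mul_one] at h1
    refine le_trans ?_ ((hw j).trans h1)
    exact mul_le_of_le_one_right hc0 (min_le_left _ _)
  · push Not at h
    have h1 : ∑ j, w j * min 1 (t j) = ∑ j, w j * t j :=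
      Finset.sum_congr rfl fun j _ => by rw [min_eq_right (h j).le]
    have h0 : 0 ≤ ∑ j, w j * t j :=
      Finset.sum_nonneg fun j _ => mul_nonneg (hc0.trans (hw j)) (ht j)
    rw [h1]
    calc c * min 1 (∑ j, w j * t j) ≤ 1 * ∑ j, w j * t j :=
          mul_le_mul hc1 (min_le_right _ _) (le_min zero_le_one h0) zero_le_one
      _ = _ := one_mul _

/-- The exponentials in `isoProb_le_of_spreadOn` average to at most `1 - c₀ / 12 * min 1 (ℓ * s)`,
with `12 = 2 * 6`. The additive error occurs only for `ℓ` of order at least `P / K 0`, hence `ℓ * s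
≥ 1 / (4 * C * K 0)` because `1 ≤ n * s` and `n ≤ C * P`; being exponentially small in `K 0`, it
uses up at most half of the gain. -/
theorem isoProb_le_one_sub_min {μ : Fin (m + 1) → ℝ} (hμ1 : ∑ i, μ i = 1) {c₀ C : ℝ}
    (hc : ∀ j, c₀ ≤ μ j) (hc0 : 0 < c₀) (hc1 : c₀ ≤ 1) (hC : 0 < C)
    {K : Fin (m + 1) → ℕ} (hK : ∀ i, K i ≤ P) (hmono : Monotone K) (hK0 : 2 ≤ K 0)
    (h16 : 16 * K 0 ≤ P) (α : unitInterval) (hnP : (n : ℝ) ≤ C * P)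
    (hX : 1 ≤ (n : ℝ) * ((α : ℝ) * hitProb μ K P (K 0)))
    (hsmall : Real.exp (-((K 0 : ℝ) / 16)) ≤ c₀ / 24 * min 1 (1 / (4 * C * K 0)))
    {T : Finset (Fin n)} {x : Fin n → Fin (m + 1) × Finset (Fin P)}
    (hx : SpreadOn (K 0 / 2) (P / (8 * (K 0 / 2))) T x) :
    isoProb μ K α T x ≤ 1 - c₀ / 24 * min 1 ((T.card : ℝ) * ((α : ℝ) * hitProb μ K P (K 0))) := by
  have hμ : ∀ i, 0 ≤ μ i := fun i => hc0.le.trans (hc i)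
  refine (isoProb_le_of_spreadOn hμ hμ1 hK hmono hK0 h16 α hx).trans ?_
  set s := (α : ℝ) * hitProb μ K P (K 0) with hs
  set ℓ : ℝ := (T.card : ℝ) with hℓ
  have hα0 : 0 ≤ (α : ℝ) := α.2.1
  have hs0 : 0 ≤ s := mul_nonneg hα0 (hitProb_nonneg hμ K P _)
  have hℓ0 : 0 ≤ ℓ := by positivity
  have hPr : (0 : ℝ) < P := by exact_mod_cast (by omega : 0 < P)
  have hKr : (0 : ℝ) < K 0 := by exact_mod_cast (by omega : 0 < K 0)
  set t : Fin (m + 1) → ℝ := fun j => ℓ * (α * firstEdgeProb K P j) / 6 with ht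
  have ht0 : ∀ j, 0 ≤ t j := fun j => by
    have := firstEdgeProb_nonneg K P j
    simp only [ht]; positivity
  have hsumt : ∑ j, μ j * t j = ℓ * s / 6 := by
    rw [hs, hitProb_zero_eq, Finset.mul_sum, Finset.mul_sum, Finset.sum_div]
    exact Finset.sum_congr rfl fun j _ => by simp only [ht]; ring
  have h1 : ∑ j, μ j * Real.exp (-(t j)) ≤ 1 - c₀ / 12 * min 1 (ℓ * s) := by
    have h2 : ∑ j, μ j * Real.exp (-(t j)) ≤ ∑ j, (μ j - μ j * min 1 (t j) / 2) := by
      refine Finset.sum_le_sum fun j _ => ?_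
      have := mul_le_mul_of_nonneg_left (half_min_le_one_sub_exp_neg (ht0 j)) (hμ j)
      linarith
    have h3 := mul_min_one_le_sum hc hc0.le ht0 hc1
    rw [Finset.sum_sub_distrib, hμ1, ← Finset.sum_div] at h2
    rw [hsumt] at h3
    have h4 : min 1 (ℓ * s) / 6 ≤ min 1 (ℓ * s / 6) := by
      refine le_min ?_ ?_
      · have := min_le_left 1 (ℓ * s); linarith
      · have := min_le_right 1 (ℓ * s); linarith
    have h5 := mul_le_mul_of_nonneg_left h4 hc0.le
    linarith
  have h2 : (if P / (8 * (K 0 / 2)) < T.card then Real.exp (-((K 0 : ℝ) / 16)) else 0) ≤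
      c₀ / 24 * min 1 (ℓ * s) := by
    split_ifs with hlt
    · refine hsmall.trans (mul_le_mul_of_nonneg_left (min_le_min le_rfl ?_) (by positivity))
      have h3 : P < 4 * K 0 * T.card := by
        have h4 : P < 8 * (K 0 / 2) * T.card := by
          rw [mul_comm]; exact Nat.lt_mul_of_div_lt hlt (by omega)
        refine h4.trans_le (Nat.mul_le_mul_right _ (by omega))
      have h4 : (P : ℝ) ≤ 4 * K 0 * ℓ := by rw [hℓ]; exact_mod_cast h3.le
      rw [div_le_iff₀ (by positivity)]
      calc (1 : ℝ) ≤ n * s := hX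
        _ ≤ C * P * s := by gcongr
        _ ≤ C * (4 * K 0 * ℓ) * s := by gcongr
        _ = ℓ * s * (4 * C * K 0) := by ring
    · have : 0 ≤ min 1 (ℓ * s) := le_min zero_le_one (by positivity)
      positivity
  linarith

theorem isoProb_le_of_large {μ : Fin (m + 1) → ℝ} (hμ : ∀ i, 0 ≤ μ i) (hμ1 : ∑ i, μ i = 1)
    {K : Fin (m + 1) → ℕ} (hK : ∀ i, K i ≤ P) (hmono : Monotone K) (hK0 : 2 ≤ K 0)
    (h16 : 16 * K 0 ≤ P) (α : unitInterval) {M : ℝ}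
    {T : Finset (Fin n)} {x : Fin n → Fin (m + 1) × Finset (Fin P)}
    (hM : ∀ j, M ≤ T.card * (α * firstEdgeProb K P j) / 6)
    (hx : SpreadOn (K 0 / 2) (P / (8 * (K 0 / 2))) T x) :
    isoProb μ K α T x ≤ Real.exp (-M) + Real.exp (-((K 0 : ℝ) / 16)) := by
  refine (isoProb_le_of_spreadOn hμ hμ1 hK hmono hK0 h16 α hx).trans (add_le_add ?_ ?_)
  · calc _ ≤ ∑ j, μ j * Real.exp (-M) := by
          refine Finset.sum_le_sum fun j _ => mul_le_mul_of_nonneg_left ?_ (hμ j)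
          exact Real.exp_le_exp.2 (neg_le_neg (hM j))
      _ = _ := by rw [← Finset.sum_mul, hμ1, one_mul]
  · split_ifs
    · exact le_rfl
    · positivity

/-- `(1 - y) * (1 - y / 4) ≤ 1 - 9 / 8 * y` for `0 ≤ y ≤ 1 / 2`. The excess of `9 / 8` over 1 is
what makes cuts around two or more nodes rarer than nodes of small degree. -/
theorem isoProb_le_of_pair {μ : Fin (m + 1) → ℝ} (hμ : ∀ i, 0 ≤ μ i) (hμ1 : ∑ i, μ i = 1)
    {K : Fin (m + 1) → ℕ} (hK : ∀ i, K i ≤ P) (hmono : Monotone K) (α : unitInterval)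
    (hsm : ∀ j, (α : ℝ) * firstEdgeProb K P j ≤ 1 / 2)
    {T : Finset (Fin n)} (hT : 2 ≤ T.card) {x : Fin n → Fin (m + 1) × Finset (Fin P)}
    (hc : ∀ v, (x v).2.card = K (x v).1) (hx : HalfOverlap T x) :
    isoProb μ K α T x ≤ Real.exp (-(9 / 8 * (α * hitProb μ K P (K 0)))) := by
  refine (isoProb_le_of_halfOverlap hμ hK hmono α hT hc hx).trans
    (le_trans ?_ (Real.one_sub_le_exp_neg _))
  calc _ ≤ ∑ j, (μ j - 9 / 8 * (α * (μ j * firstEdgeProb K P j))) := by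
        refine Finset.sum_le_sum fun j _ => ?_
        have h0 : 0 ≤ (α : ℝ) * firstEdgeProb K P j :=
          mul_nonneg α.2.1 (firstEdgeProb_nonneg K P j)
        have h1 := hsm j
        have h2 : (1 - (α : ℝ) * firstEdgeProb K P j) * (1 - α * (firstEdgeProb K P j / 4)) ≤
            1 - 9 / 8 * (α * firstEdgeProb K P j) := by nlinarith
        have h3 := mul_le_mul_of_nonneg_left h2 (hμ j)
        linarith
    _ = _ := by
        rw [Finset.sum_sub_distrib, hμ1, hitProb_zero_eq, Finset.mul_sum, Finset.mul_sum]

theorem isoProb_le_of_nonempty {μ : Fin (m + 1) → ℝ} (hμ : ∀ i, 0 ≤ μ i) (hμ1 : ∑ i, μ i = 1)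
    {K : Fin (m + 1) → ℕ} (hK : ∀ i, K i ≤ P) (hmono : Monotone K) (α : unitInterval)
    {T : Finset (Fin n)} (hT : 2 ≤ T.card) {x : Fin n → Fin (m + 1) × Finset (Fin P)}
    (hc : ∀ v, (x v).2.card = K (x v).1) (hx : HalfOverlap T x) :
    isoProb μ K α T x ≤ Real.exp (-(α * hitProb μ K P (K 0))) := by
  refine (isoProb_le_of_halfOverlap hμ hK hmono α hT hc hx).trans
    (le_trans ?_ (Real.one_sub_le_exp_neg _))
  calc _ ≤ ∑ j, (μ j - (α * (μ j * firstEdgeProb K P j))) := by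
        refine Finset.sum_le_sum fun j _ => ?_
        have h0 : 0 ≤ (α : ℝ) * firstEdgeProb K P j :=
          mul_nonneg α.2.1 (firstEdgeProb_nonneg K P j)
        have h1 : (α : ℝ) * firstEdgeProb K P j ≤ 1 :=
          mul_le_one₀ α.2.2 (firstEdgeProb_nonneg K P j) (firstEdgeProb_le_one K P j)
        have h2 : (1 - (α : ℝ) * firstEdgeProb K P j) * (1 - α * (firstEdgeProb K P j / 4)) ≤
            1 - (α * firstEdgeProb K P j) := by nlinarith
        have h3 := mul_le_mul_of_nonneg_left h2 (hμ j)
        linarith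
    _ = _ := by
        rw [Finset.sum_sub_distrib, hμ1, hitProb_zero_eq, Finset.mul_sum]

/-- With edge probability `X ^ 2 / n` the powers of `n` cancel up to a single factor. The terms are
then compared with the exponent `ℓ + k`, using `1 ≤ X` and `ρ ≤ 1`. -/
theorem tree_sum_le {n k ℓ : ℕ} (hn : 0 < n) (hℓ : 1 ≤ ℓ) {X ρ : ℝ} (hX : 1 ≤ X)
    (hρ0 : 0 ≤ ρ) (hρ1 : ρ ≤ 1) :
    ∑ j ∈ Finset.range k, (8 : ℝ) ^ (ℓ + j) * (n : ℝ) ^ (ℓ + j) * (X ^ 2 / n) ^ (ℓ + j - 1) *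
        ρ ^ (n - (ℓ + j)) ≤ k * (n * (8 * X ^ 2) ^ (ℓ + k) * ρ ^ (n - (ℓ + k))) := by
  have hnr : (0 : ℝ) < n := by exact_mod_cast hn
  have hX2 : 1 ≤ X ^ 2 := one_le_pow₀ hX
  have hcard : (k : ℝ) = (Finset.range k).card := by simp
  conv_rhs => rw [hcard, ← nsmul_eq_mul]
  refine Finset.sum_le_card_nsmul _ _ _ fun j hj => ?_
  rw [Finset.mem_range] at hj
  have h1 : (n : ℝ) ^ (ℓ + j) * (X ^ 2 / n) ^ (ℓ + j - 1) = n * (X ^ 2) ^ (ℓ + j - 1) := by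
    obtain ⟨i, hi⟩ : ∃ i, ℓ + j = i + 1 := ⟨ℓ + j - 1, by omega⟩
    rw [hi, Nat.add_sub_cancel, div_pow, pow_succ]
    field_simp
  rw [mul_assoc ((8 : ℝ) ^ (ℓ + j)), h1]
  calc (8 : ℝ) ^ (ℓ + j) * (n * (X ^ 2) ^ (ℓ + j - 1)) * ρ ^ (n - (ℓ + j))
      ≤ 8 ^ (ℓ + k) * (n * (X ^ 2) ^ (ℓ + k)) * ρ ^ (n - (ℓ + k)) := by
        refine mul_le_mul (mul_le_mul ?_ (mul_le_mul_of_nonneg_left ?_ hnr.le)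
          (by positivity) (by positivity)) ?_ (by positivity) (by positivity)
        · exact pow_le_pow_right₀ (by norm_num) (by omega)
        · exact pow_le_pow_right₀ hX2 (by omega)
        · exact pow_le_pow_of_le_one hρ0 hρ1 (by omega)
    _ = _ := by rw [mul_pow]; ring

theorem choose_sum_le {n k ℓ : ℕ} (hn : 0 < n) {ρ : ℝ} (hρ0 : 0 ≤ ρ) (hρ1 : ρ ≤ 1) :
    ∑ j ∈ Finset.range k, (n : ℝ) ^ j * ρ ^ (n - (ℓ + j)) ≤
      k * ((n : ℝ) ^ k * ρ ^ (n - (ℓ + k))) := by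
  have hnr : (1 : ℝ) ≤ n := by exact_mod_cast hn
  have hcard : (k : ℝ) = (Finset.range k).card := by simp
  conv_rhs => rw [hcard, ← nsmul_eq_mul]
  refine Finset.sum_le_card_nsmul _ _ _ fun j hj => ?_
  rw [Finset.mem_range] at hj
  exact mul_le_mul (pow_le_pow_right₀ hnr hj.le) (pow_le_pow_of_le_one hρ0 hρ1 (by omega))
    (by positivity) (by positivity)

theorem choose_mul_pow_le (n ℓ : ℕ) {x : ℝ} (hx : 0 ≤ x) :
    (n.choose ℓ : ℝ) * x ^ ℓ ≤ (1 + x) ^ n := by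
  by_cases h : ℓ ≤ n
  · rw [add_comm, add_pow]
    have := Finset.single_le_sum (f := fun i => x ^ i * 1 ^ (n - i) * (n.choose i : ℝ))
      (fun i _ => by positivity) (Finset.mem_range.2 (Nat.lt_succ_of_le h))
    simpa [mul_comm] using this
  · rw [Nat.choose_eq_zero_of_lt (by omega)]
    simp only [Nat.cast_zero, zero_mul]
    positivity

theorem exp_pow_le {a c : ℝ} (hc : 0 ≤ c) {N n : ℕ} (hN : a * n ≤ N) :
    Real.exp (-c) ^ N ≤ Real.exp (-(c * (a * n))) := by
  rw [← Real.exp_nat_mul, Real.exp_le_exp]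
  nlinarith

end CutBounds

end RandomKeyGraph

namespace RandomKeyGraph

open MeasureTheory ProbabilityTheory

/-! ### Cuts of all sizes from 2 to half of the nodes. -/

section CutRegime

variable {n m P : ℕ}

/-- The quantitative conditions on the parameters under which small cuts are unlikely. Here `c₀` is
a lower bound for the class probabilities and `C` an upper bound for `n / P`. -/
structure CutRegime (n : ℕ) (μ : Fin (m + 1) → ℝ) (K : Fin (m + 1) → ℕ) (P : ℕ) (α : unitInterval)
    (k : ℕ) (c₀ C : ℝ) : Prop where
  sum_eq : ∑ i, μ i = 1
  le_weight : ∀ j, c₀ ≤ μ j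
  c_pos : 0 < c₀
  c_le : c₀ ≤ 1
  C_pos : 0 < C
  le_pool : ∀ i, K i ≤ P
  mono : Monotone K
  two_le : 2 ≤ K 0
  sixteen : 16 * K 0 ≤ P
  nodes_le : (n : ℝ) ≤ C * P
  one_le : 1 ≤ (n : ℝ) * ((α : ℝ) * hitProb μ K P (K 0))
  log_le : Real.log n ≤ (n : ℝ) * ((α : ℝ) * hitProb μ K P (K 0))
  small : Real.exp (-((K 0 : ℝ) / 16)) ≤ c₀ / 24 * min 1 (1 / (4 * C * K 0))
  edge_le : ∀ j, (α : ℝ) * hitProb μ K P (K j) ≤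
    ((n : ℝ) * ((α : ℝ) * hitProb μ K P (K 0))) ^ 2 / n
  k_le : 8 * k ≤ n

variable {μ : Fin (m + 1) → ℝ} {K : Fin (m + 1) → ℕ} {α : unitInterval} {k : ℕ} {c₀ C : ℝ}

theorem CutRegime.nonneg (H : CutRegime n μ K P α k c₀ C) (i : Fin (m + 1)) : 0 ≤ μ i :=
  H.c_pos.le.trans (H.le_weight i)

theorem CutRegime.n_pos (H : CutRegime n μ K P α k c₀ C) : 0 < n := by
  have h1 := H.one_le
  rcases Nat.eq_zero_or_pos n with h | h
  · rw [h] at h1; norm_num at h1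
  · exact h

theorem CutRegime.edge_le_one (H : CutRegime n μ K P α k c₀ C) :
    (α : ℝ) * hitProb μ K P (K 0) ≤ 1 :=
  mul_le_one₀ α.2.2 (hitProb_nonneg H.nonneg K P _) (hitProb_le_one H.nonneg H.sum_eq K P _)

theorem CutRegime.smallCut_le_tree (H : CutRegime n μ K P α k c₀ C) {ℓ : ℕ} (hℓ : 1 ≤ ℓ)
    {ρ : ℝ} (hρ0 : 0 ≤ ρ) (hρ1 : ρ ≤ 1)
    (hρ : ∀ (T : Finset (Fin n)) x, (∀ v, nodeWeight μ K P (x v) ≠ 0) → T.card = ℓ →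
      SpreadOn (K 0 / 2) (P / (8 * (K 0 / 2))) T x → HalfOverlap T x → isoProb μ K α T x ≤ ρ) :
    (modelLaw n μ K P α).real (smallCut (K 0 / 2) (P / (8 * (K 0 / 2))) k ℓ) ≤
      k * (n * (8 * ((n : ℝ) * ((α : ℝ) * hitProb μ K P (K 0))) ^ 2) ^ (ℓ + k) *
        ρ ^ (n - (ℓ + k))) :=
  (modelLaw_real_smallCut_le_tree H.nonneg H.sum_eq H.le_pool α hℓ hρ0
    (by positivity) H.edge_le hρ).trans
    (tree_sum_le H.n_pos hℓ H.one_le hρ0 hρ1)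

theorem CutRegime.smallCut_le_choose (H : CutRegime n μ K P α k c₀ C) {ℓ : ℕ}
    {ρ : ℝ} (hρ0 : 0 ≤ ρ) (hρ1 : ρ ≤ 1)
    (hρ : ∀ (T : Finset (Fin n)) x, (∀ v, nodeWeight μ K P (x v) ≠ 0) → T.card = ℓ →
      SpreadOn (K 0 / 2) (P / (8 * (K 0 / 2))) T x → HalfOverlap T x → isoProb μ K α T x ≤ ρ) :
    (modelLaw n μ K P α).real (smallCut (K 0 / 2) (P / (8 * (K 0 / 2))) k ℓ) ≤
      (n.choose ℓ : ℝ) * (k * ((n : ℝ) ^ k * ρ ^ (n - (ℓ + k)))) :=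
  (modelLaw_real_smallCut_le_choose H.nonneg H.sum_eq H.le_pool α hρ0 hρ).trans
    (mul_le_mul_of_nonneg_left (choose_sum_le H.n_pos hρ0 hρ1) (by positivity))

/-- For bounded `ℓ` the tree costs `n` times a power of `X`, against a decay `exp (-(c * X))`.
Either `c = 9 / 8` and `X ≥ log n`, or `c = 1` and `X ≥ 2 * log n`; in both cases `(log n + X) / 16`
is left in the exponent, and its `X` part absorbs the power of `X`. -/
theorem CutRegime.smallCut_bounded (H : CutRegime n μ K P α k c₀ C) {L ℓ : ℕ} (hℓ2 : 2 ≤ ℓ)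
    (hℓL : ℓ ≤ L) (hLn : L + k ≤ n)
    (hpoly : (8 * ((n : ℝ) * ((α : ℝ) * hitProb μ K P (K 0))) ^ 2) ^ (L + k) ≤
      Real.exp (((n : ℝ) * ((α : ℝ) * hitProb μ K P (K 0))) / 16))
    (hcase : (∀ j, (α : ℝ) * firstEdgeProb K P j ≤ 1 / 2) ∨
      2 * Real.log n ≤ (n : ℝ) * ((α : ℝ) * hitProb μ K P (K 0))) :
    (modelLaw n μ K P α).real (smallCut (K 0 / 2) (P / (8 * (K 0 / 2))) k ℓ) ≤
      k * (Real.exp (2 * (L + k)) * Real.exp (-(Real.log n / 16))) := by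
  set s := (α : ℝ) * hitProb μ K P (K 0) with hs
  have hs1 : s ≤ 1 := H.edge_le_one
  have hs0 : 0 ≤ s := mul_nonneg α.2.1 (hitProb_nonneg H.nonneg K P _)
  have hnr : (0 : ℝ) < n := by exact_mod_cast H.n_pos
  have hX1 : 1 ≤ (n : ℝ) * s := H.one_le
  have hXl : Real.log n ≤ (n : ℝ) * s := H.log_le
  obtain ⟨c, hc1, hc2, hcc, hiso⟩ : ∃ c : ℝ, 1 ≤ c ∧ c ≤ 2 ∧
      Real.log n - c * (n * s) ≤ -(Real.log n / 16) - (n * s) / 16 ∧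
      ∀ (T : Finset (Fin n)) x, (∀ v, nodeWeight μ K P (x v) ≠ 0) → T.card = ℓ →
      SpreadOn (K 0 / 2) (P / (8 * (K 0 / 2))) T x → HalfOverlap T x →
        isoProb μ K α T x ≤ Real.exp (-(c * s)) := by
    rcases hcase with h | h
    · refine ⟨9 / 8, by norm_num, by norm_num, by linarith, fun T x hx hT _ ho => ?_⟩
      exact isoProb_le_of_pair H.nonneg H.sum_eq H.le_pool H.mono α h (by omega)
        (fun v => card_of_nodeWeight_ne_zero (hx v)) ho
    · refine ⟨1, le_rfl, by norm_num, ?_, fun T x hx hT _ ho => ?_⟩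
      · have : 0 ≤ Real.log n := Real.log_natCast_nonneg n
        linarith
      rw [one_mul]
      exact isoProb_le_of_nonempty H.nonneg H.sum_eq H.le_pool H.mono α (by omega)
        (fun v => card_of_nodeWeight_ne_zero (hx v)) ho
  have hρ1 : Real.exp (-(c * s)) ≤ 1 := Real.exp_le_one_iff.2 (by nlinarith)
  refine (H.smallCut_le_tree (by omega) (Real.exp_pos _).le hρ1 hiso).trans ?_
  refine mul_le_mul_of_nonneg_left ?_ (by positivity)
  have h8 : 1 ≤ 8 * ((n : ℝ) * s) ^ 2 := by nlinarith
  -- The `ℓ + k` nodes missing from the exponent cost at most `exp (2 * (L + k))`, since `c * s ≤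
  -- 2`.
  have h1 : Real.exp (-(c * s)) ^ (n - (ℓ + k)) ≤
      Real.exp (-(c * (n * s))) * Real.exp (2 * (L + k)) := by
    rw [← Real.exp_nat_mul, ← Real.exp_add, Real.exp_le_exp, Nat.cast_sub (by omega)]
    push_cast
    have h2 : (ℓ : ℝ) + k ≤ L + k := by
      have : (ℓ : ℝ) ≤ L := by exact_mod_cast hℓL
      linarith
    have h3 : ((ℓ : ℝ) + k) * (c * s) ≤ (L + k) * 2 := by
      refine mul_le_mul h2 (by nlinarith) (by positivity) (by positivity)
    nlinarith
  calc (n : ℝ) * (8 * ((n : ℝ) * s) ^ 2) ^ (ℓ + k) * Real.exp (-(c * s)) ^ (n - (ℓ + k))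
      ≤ Real.exp (Real.log n) * Real.exp ((n * s) / 16) *
        (Real.exp (-(c * (n * s))) * Real.exp (2 * (L + k))) := by
        refine mul_le_mul (mul_le_mul (Real.exp_log hnr).ge ?_ (by positivity) (by positivity)) h1
          (by positivity) (by positivity)
        exact (pow_le_pow_right₀ h8 (by omega)).trans hpoly
    _ = Real.exp (2 * (L + k)) * Real.exp (Real.log n + (n * s) / 16 - c * (n * s)) := by
        rw [← Real.exp_add, ← Real.exp_add, ← Real.exp_add, ← Real.exp_add]
        congr 1; ring
    _ ≤ _ := by
        refine mul_le_mul_of_nonneg_left (Real.exp_le_exp.2 ?_) (by positivity)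
        linarith

/-- Here the isolation bound is `exp (-(c₁ * ℓ * s))` with `c₁ = c₀ / 24`. At least `n / 4` nodes
lie outside, which gives `c₁ * ℓ * X / 4` in the exponent; the tree uses up half of it, and `c₁ * ℓ
≥ 24` turns the other half into at least `3 * X`. -/
theorem CutRegime.smallCut_moderate (H : CutRegime n μ K P α k c₀ C) {ℓ : ℕ} (hkℓ : k ≤ ℓ)
    (hℓ1 : 1 ≤ ℓ) (hℓn : 2 * ℓ ≤ n) (hℓs : (ℓ : ℝ) * ((α : ℝ) * hitProb μ K P (K 0)) ≤ 1)
    (hcℓ : 24 ≤ c₀ / 24 * ℓ)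
    (hpoly : 8 * ((n : ℝ) * ((α : ℝ) * hitProb μ K P (K 0))) ^ 2 ≤
      Real.exp (c₀ / 24 * ((n : ℝ) * ((α : ℝ) * hitProb μ K P (K 0))) / 16)) :
    (modelLaw n μ K P α).real (smallCut (K 0 / 2) (P / (8 * (K 0 / 2))) k ℓ) ≤
      k * Real.exp (-(2 * Real.log n)) := by
  set s := (α : ℝ) * hitProb μ K P (K 0) with hs
  set c₁ := c₀ / 24 with hc₁
  have hc₁0 : 0 < c₁ := by have := H.c_pos; positivity
  have hs0 : 0 ≤ s := mul_nonneg α.2.1 (hitProb_nonneg H.nonneg K P _)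
  have hnr : (0 : ℝ) < n := by exact_mod_cast H.n_pos
  have hX1 : 1 ≤ (n : ℝ) * s := H.one_le
  have hXl : Real.log n ≤ (n : ℝ) * s := H.log_le
  have hk8 := H.k_le
  have hiso : ∀ (T : Finset (Fin n)) x, (∀ v, nodeWeight μ K P (x v) ≠ 0) → T.card = ℓ →
      SpreadOn (K 0 / 2) (P / (8 * (K 0 / 2))) T x → HalfOverlap T x →
        isoProb μ K α T x ≤ Real.exp (-(c₁ * (ℓ * s))) := by
    intro T x hx hT hsp _
    refine (isoProb_le_one_sub_min H.sum_eq H.le_weight H.c_pos H.c_le H.C_pos H.le_pool H.mono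
      H.two_le H.sixteen α H.nodes_le H.one_le H.small hsp).trans ?_
    rw [hT, min_eq_right hℓs]
    exact Real.one_sub_le_exp_neg _
  have hρ1 : Real.exp (-(c₁ * (ℓ * s))) ≤ 1 := Real.exp_le_one_iff.2 (by
    have : 0 ≤ c₁ * (ℓ * s) := by positivity
    linarith)
  refine (H.smallCut_le_tree hℓ1 (Real.exp_pos _).le hρ1 hiso).trans ?_
  refine mul_le_mul_of_nonneg_left ?_ (by positivity)
  have h8 : 1 ≤ 8 * ((n : ℝ) * s) ^ 2 := by nlinarith
  have h1 : Real.exp (-(c₁ * (ℓ * s))) ^ (n - (ℓ + k)) ≤ Real.exp (-(c₁ * (ℓ * s) * (1 / 4 * n))) := by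
    refine exp_pow_le (by positivity) ?_
    rw [Nat.cast_sub (by omega)]
    have h2 : ((2 * ℓ : ℕ) : ℝ) ≤ n := by exact_mod_cast hℓn
    have h3 : ((8 * k : ℕ) : ℝ) ≤ n := by exact_mod_cast hk8
    push_cast at h2 h3 ⊢
    linarith
  have h2 : (8 * ((n : ℝ) * s) ^ 2) ^ (ℓ + k) ≤ Real.exp (c₁ * (n * s) / 16 * (2 * ℓ)) := by
    refine (pow_le_pow_right₀ h8 (by omega : ℓ + k ≤ 2 * ℓ)).trans ?_
    refine (pow_le_pow_left₀ (by positivity) hpoly _).trans (le_of_eq ?_)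
    rw [← Real.exp_nat_mul]
    congr 1; push_cast; ring
  calc (n : ℝ) * (8 * ((n : ℝ) * s) ^ 2) ^ (ℓ + k) * Real.exp (-(c₁ * (ℓ * s))) ^ (n - (ℓ + k))
      ≤ Real.exp (Real.log n) * Real.exp (c₁ * (n * s) / 16 * (2 * ℓ)) *
        Real.exp (-(c₁ * (ℓ * s) * (1 / 4 * n))) := by
        exact mul_le_mul (mul_le_mul (Real.exp_log hnr).ge h2 (by positivity) (by positivity)) h1
          (by positivity) (by positivity)
    _ = Real.exp (Real.log n - c₁ * ℓ * (n * s) / 8) := by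
        rw [← Real.exp_add, ← Real.exp_add]
        congr 1; ring
    _ ≤ _ := by
        refine Real.exp_le_exp.2 ?_
        have : 24 * (n * s) ≤ c₁ * ℓ * (n * s) := mul_le_mul_of_nonneg_right hcℓ (by positivity)
        linarith

/-- Every outside node now contributes a constant factor `exp (-c₁)`. Comparing with one term of `(1
+ x) ^ n`, `x = c₁ / 16`, bounds the choice of at most `θ * n` nodes by `exp (c₁ / 8 * n)`, half of
the available decay. -/
theorem CutRegime.smallCut_large (H : CutRegime n μ K P α k c₀ C) {ℓ : ℕ}
    (hℓn : 2 * ℓ ≤ n) (hℓs : 1 ≤ (ℓ : ℝ) * ((α : ℝ) * hitProb μ K P (K 0))) {θ : ℝ}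
    (hθ : θ * (-Real.log (c₀ / 24 / 16)) ≤ c₀ / 24 / 16) (hℓθ : (ℓ : ℝ) ≤ θ * n) :
    (modelLaw n μ K P α).real (smallCut (K 0 / 2) (P / (8 * (K 0 / 2))) k ℓ) ≤
      k * ((n : ℝ) ^ k * Real.exp (-(c₀ / 24 / 8 * n))) := by
  set s := (α : ℝ) * hitProb μ K P (K 0) with hs
  set c₁ := c₀ / 24 with hc₁
  have hc₁0 : 0 < c₁ := by have := H.c_pos; positivity
  have hc₁1 : c₁ ≤ 1 := by have := H.c_le; linarith
  have hnr : (0 : ℝ) < n := by exact_mod_cast H.n_pos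
  have hk8 := H.k_le
  have hiso : ∀ (T : Finset (Fin n)) x, (∀ v, nodeWeight μ K P (x v) ≠ 0) → T.card = ℓ →
      SpreadOn (K 0 / 2) (P / (8 * (K 0 / 2))) T x → HalfOverlap T x →
        isoProb μ K α T x ≤ Real.exp (-c₁) := by
    intro T x hx hT hsp _
    refine (isoProb_le_one_sub_min H.sum_eq H.le_weight H.c_pos H.c_le H.C_pos H.le_pool H.mono
      H.two_le H.sixteen α H.nodes_le H.one_le H.small hsp).trans ?_
    rw [hT, min_eq_left hℓs, mul_one]
    exact Real.one_sub_le_exp_neg _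
  have hρ1 : Real.exp (-c₁) ≤ 1 := Real.exp_le_one_iff.2 (by linarith)
  refine (H.smallCut_le_choose (Real.exp_pos _).le hρ1 hiso).trans ?_
  have h1 : Real.exp (-c₁) ^ (n - (ℓ + k)) ≤ Real.exp (-(c₁ * (1 / 4 * n))) := by
    refine exp_pow_le (by positivity) ?_
    rw [Nat.cast_sub (by omega)]
    have h2 : ((2 * ℓ : ℕ) : ℝ) ≤ n := by exact_mod_cast hℓn
    have h3 : ((8 * k : ℕ) : ℝ) ≤ n := by exact_mod_cast hk8
    push_cast at h2 h3 ⊢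
    linarith
  set x := c₁ / 16 with hx
  have hx0 : 0 < x := by positivity
  have hlogx : 0 ≤ -Real.log x := by
    have : Real.log x ≤ 0 := Real.log_nonpos hx0.le (by linarith)
    linarith
  have h2 : (n.choose ℓ : ℝ) ≤ Real.exp (c₁ / 8 * n) := by
    have h3 := choose_mul_pow_le n ℓ hx0.le
    have h4 : (1 + x) ^ n ≤ Real.exp (x * n) := by
      rw [add_comm, mul_comm, Real.exp_nat_mul]
      exact pow_le_pow_left₀ (by positivity) (Real.add_one_le_exp x) n
    have h5 : x ^ ℓ = Real.exp (-(ℓ * -Real.log x)) := by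
      rw [mul_neg, neg_neg, Real.exp_nat_mul, Real.exp_log hx0]
    rw [h5] at h3
    have h6 : (n.choose ℓ : ℝ) ≤ Real.exp (x * n) * Real.exp (ℓ * -Real.log x) := by
      have := mul_le_mul_of_nonneg_right (h3.trans h4) (Real.exp_pos (ℓ * -Real.log x)).le
      rwa [mul_assoc, ← Real.exp_add, neg_add_cancel, Real.exp_zero, mul_one] at this
    refine h6.trans ?_
    rw [← Real.exp_add, Real.exp_le_exp]
    have h7 : (ℓ : ℝ) * -Real.log x ≤ θ * n * -Real.log x :=
      mul_le_mul_of_nonneg_right hℓθ hlogx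
    have h8 : θ * -Real.log x * n ≤ x * n := mul_le_mul_of_nonneg_right hθ hnr.le
    have h9 : c₁ / 8 * n = x * n + x * n := by rw [hx]; ring
    linarith
  calc (n.choose ℓ : ℝ) * (k * ((n : ℝ) ^ k * Real.exp (-c₁) ^ (n - (ℓ + k))))
      ≤ Real.exp (c₁ / 8 * n) * (k * ((n : ℝ) ^ k * Real.exp (-(c₁ * (1 / 4 * n))))) := by
        gcongr
    _ = k * ((n : ℝ) ^ k * (Real.exp (c₁ / 8 * n) * Real.exp (-(c₁ * (1 / 4 * n))))) := by ring
    _ = _ := by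
        rw [← Real.exp_add]
        congr 3; ring

/-- The choice of `T` costs at most `2 ^ n ≤ exp n`. Each of at least `n / 4` outside nodes
contributes `exp (-8)`, from `2 * exp (-9) ≤ exp (-8)`, for a total of `exp (-(2 * n))`. -/
theorem CutRegime.smallCut_linear (H : CutRegime n μ K P α k c₀ C) {ℓ : ℕ}
    (hℓn : 2 * ℓ ≤ n) {θ : ℝ} (hℓθ : θ * n ≤ (ℓ : ℝ))
    (hM : ∀ j, 9 ≤ θ * (n * ((α : ℝ) * firstEdgeProb K P j)) / 6)
    (hK9 : Real.exp (-((K 0 : ℝ) / 16)) ≤ Real.exp (-9)) :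
    (modelLaw n μ K P α).real (smallCut (K 0 / 2) (P / (8 * (K 0 / 2))) k ℓ) ≤
      k * ((n : ℝ) ^ k * Real.exp (-(c₀ / 24 / 8 * n))) := by
  have hc := H.c_le
  have hk8 := H.k_le
  have hiso : ∀ (T : Finset (Fin n)) x, (∀ v, nodeWeight μ K P (x v) ≠ 0) → T.card = ℓ →
      SpreadOn (K 0 / 2) (P / (8 * (K 0 / 2))) T x → HalfOverlap T x →
        isoProb μ K α T x ≤ Real.exp (-8) := by
    intro T x hx hT hsp _
    refine (isoProb_le_of_large (M := 9) H.nonneg H.sum_eq H.le_pool H.mono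
      H.two_le H.sixteen α (fun j => ?_) hsp).trans ?_
    · refine (hM j).trans ?_
      rw [hT]
      have : 0 ≤ (α : ℝ) * firstEdgeProb K P j := mul_nonneg α.2.1 (firstEdgeProb_nonneg K P j)
      have := mul_le_mul_of_nonneg_right hℓθ this
      linarith
    · have h1 : Real.exp (-8) = Real.exp 1 * Real.exp (-9) := by
        rw [← Real.exp_add]; norm_num
      have h2 : 2 ≤ Real.exp 1 := by linarith [Real.add_one_le_exp 1]
      rw [h1]
      nlinarith [Real.exp_pos (-9)]
  have hρ1 : Real.exp (-8) ≤ 1 := Real.exp_le_one_iff.2 (by norm_num)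
  refine (H.smallCut_le_choose (Real.exp_pos _).le hρ1 hiso).trans ?_
  have h1 : Real.exp (-8) ^ (n - (ℓ + k)) ≤ Real.exp (-(8 * (1 / 4 * n))) := by
    refine exp_pow_le (by norm_num) ?_
    rw [Nat.cast_sub (by omega)]
    have h2 : ((2 * ℓ : ℕ) : ℝ) ≤ n := by exact_mod_cast hℓn
    have h3 : ((8 * k : ℕ) : ℝ) ≤ n := by exact_mod_cast hk8
    push_cast at h2 h3 ⊢
    linarith
  have h2 : (n.choose ℓ : ℝ) ≤ Real.exp n := by
    have h3 := choose_mul_pow_le n ℓ zero_le_one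
    rw [one_pow, mul_one] at h3
    refine h3.trans ?_
    have h4 : Real.exp n = Real.exp 1 ^ n := by rw [← Real.exp_nat_mul, mul_one]
    rw [h4]
    exact pow_le_pow_left₀ (by norm_num) (Real.add_one_le_exp 1) n
  calc (n.choose ℓ : ℝ) * (k * ((n : ℝ) ^ k * Real.exp (-8) ^ (n - (ℓ + k))))
      ≤ Real.exp n * (k * ((n : ℝ) ^ k * Real.exp (-(8 * (1 / 4 * n))))) := by gcongr
    _ = k * ((n : ℝ) ^ k * (Real.exp n * Real.exp (-(8 * (1 / 4 * n))))) := by ring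
    _ ≤ _ := by
        rw [← Real.exp_add]
        gcongr
        have : (0 : ℝ) ≤ n := by positivity
        nlinarith

/-- Four ranges: `ℓ ≤ L`; then `ℓ * s ≤ 1`; then `ℓ ≤ θ * n`; then the rest. Only the first uses
`HalfOverlap`; the bounds for the others are small enough to be multiplied by `n`. -/
theorem CutRegime.sum_smallCut_le (H : CutRegime n μ K P α k c₀ C) {L : ℕ} (hLk : k ≤ L)
    (hLn : L + k ≤ n) (hcL : 24 ≤ c₀ / 24 * L)
    (hpolyL : (8 * ((n : ℝ) * ((α : ℝ) * hitProb μ K P (K 0))) ^ 2) ^ (L + k) ≤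
      Real.exp (((n : ℝ) * ((α : ℝ) * hitProb μ K P (K 0))) / 16))
    (hcase : (∀ j, (α : ℝ) * firstEdgeProb K P j ≤ 1 / 2) ∨
      2 * Real.log n ≤ (n : ℝ) * ((α : ℝ) * hitProb μ K P (K 0)))
    (hpoly : 8 * ((n : ℝ) * ((α : ℝ) * hitProb μ K P (K 0))) ^ 2 ≤
      Real.exp (c₀ / 24 * ((n : ℝ) * ((α : ℝ) * hitProb μ K P (K 0))) / 16))
    {θ : ℝ} (hθ : θ * (-Real.log (c₀ / 24 / 16)) ≤ c₀ / 24 / 16)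
    (hM : ∀ j, 9 ≤ θ * (n * ((α : ℝ) * firstEdgeProb K P j)) / 6)
    (hK9 : Real.exp (-((K 0 : ℝ) / 16)) ≤ Real.exp (-9)) :
    ∑ ℓ ∈ Finset.Icc 2 (n / 2),
      (modelLaw n μ K P α).real (smallCut (K 0 / 2) (P / (8 * (K 0 / 2))) k ℓ) ≤
      L * (k * (Real.exp (2 * (L + k)) * Real.exp (-(Real.log n / 16)))) +
      n * (k * Real.exp (-(2 * Real.log n)) +
        k * ((n : ℝ) ^ k * Real.exp (-(c₀ / 24 / 8 * n)))) := by
  set b₀ := (k : ℝ) * (Real.exp (2 * (L + k)) * Real.exp (-(Real.log n / 16))) with hb₀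
  set b₁ := (k : ℝ) * Real.exp (-(2 * Real.log n)) with hb₁
  set b₂ := (k : ℝ) * ((n : ℝ) ^ k * Real.exp (-(c₀ / 24 / 8 * n))) with hb₂
  have h0 : 0 ≤ b₀ := by positivity
  have h1 : 0 ≤ b₁ := by positivity
  have h2 : 0 ≤ b₂ := by positivity
  have hbound : ∀ ℓ ∈ Finset.Icc 2 (n / 2),
      (modelLaw n μ K P α).real (smallCut (K 0 / 2) (P / (8 * (K 0 / 2))) k ℓ) ≤
      (if ℓ ≤ L then b₀ else 0) + (b₁ + b₂) := by
    intro ℓ hℓ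
    rw [Finset.mem_Icc] at hℓ
    by_cases hL : ℓ ≤ L
    · rw [if_pos hL]
      have := H.smallCut_bounded hℓ.1 hL hLn hpolyL hcase
      linarith
    · rw [if_neg hL, zero_add]
      push Not at hL
      rcases le_total ((ℓ : ℝ) * ((α : ℝ) * hitProb μ K P (K 0))) 1 with hs | hs
      · have hcℓ : 24 ≤ c₀ / 24 * ℓ := by
          have h3 : (L : ℝ) ≤ ℓ := by exact_mod_cast hL.le
          have := mul_le_mul_of_nonneg_left h3 (by have := H.c_pos; positivity : 0 ≤ c₀ / 24)
          linarith
        have := H.smallCut_moderate (by omega) (by omega) (by omega) hs hcℓ hpoly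
        linarith
      · rcases le_total (ℓ : ℝ) (θ * n) with ht | ht
        · have := H.smallCut_large (by omega) hs hθ ht
          linarith
        · have := H.smallCut_linear (by omega) ht hM hK9
          linarith
  refine (Finset.sum_le_sum hbound).trans ?_
  rw [Finset.sum_add_distrib]
  refine add_le_add ?_ ?_
  · rw [← Finset.sum_filter, Finset.sum_const, nsmul_eq_mul]
    refine mul_le_mul_of_nonneg_right ?_ h0
    have : ((Finset.Icc 2 (n / 2)).filter (· ≤ L)).card ≤ (Finset.Icc 1 L).card := by
      refine Finset.card_le_card fun ℓ hℓ => ?_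
      rw [Finset.mem_filter, Finset.mem_Icc] at hℓ
      rw [Finset.mem_Icc]; omega
    rw [Nat.card_Icc, Nat.add_sub_cancel] at this
    exact_mod_cast this
  · rw [Finset.sum_const, nsmul_eq_mul]
    refine mul_le_mul_of_nonneg_right ?_ (by positivity)
    rw [Nat.card_Icc]
    exact_mod_cast (by omega : n / 2 + 1 - 2 ≤ n)

end CutRegime

end RandomKeyGraph

namespace RandomKeyGraph

open MeasureTheory ProbabilityTheory

/-! ### Comparing link probabilities of different classes through the ratio of ring sizes. -/

section Ratio

variable {m P : ℕ} {μ : Fin (m + 1) → ℝ} {K : Fin (m + 1) → ℕ}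

theorem sum_weight_mul_le (hμ : ∀ i, 0 ≤ μ i) (hμ1 : ∑ i, μ i = 1) {f : Fin (m + 1) → ℝ} {B : ℝ}
    (h : ∀ i, f i ≤ B) : ∑ i, μ i * f i ≤ B :=
  calc ∑ i, μ i * f i ≤ ∑ i, μ i * B :=
        Finset.sum_le_sum fun i _ => mul_le_mul_of_nonneg_left (h i) (hμ i)
    _ = B := by rw [← Finset.sum_mul, hμ1, one_mul]

theorem min_one_mul_le {ρ t : ℝ} (hρ : 1 ≤ ρ) : min 1 (ρ * t) ≤ ρ * min 1 t := by
  rw [mul_min_of_nonneg _ _ (by linarith), mul_one]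
  exact min_le_min_right _ hρ

theorem one_le_ratio (hmono : Monotone K) (h0 : 0 < K 0) :
    1 ≤ (K (Fin.last m) : ℝ) / K 0 := by
  rw [le_div_iff₀ (by exact_mod_cast h0), one_mul]
  exact_mod_cast hmono (Fin.zero_le _)

theorem hitProb_zero_le_min (hμ : ∀ i, 0 ≤ μ i) (hμ1 : ∑ i, μ i = 1) (hK : ∀ i, K i ≤ P)
    (hmono : Monotone K) :
    hitProb μ K P (K 0) ≤ min 1 ((K 0 : ℝ) * K (Fin.last m) / P) := by
  rw [hitProb_zero_eq]
  refine sum_weight_mul_le hμ hμ1 fun j => ?_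
  refine (firstEdgeProb_le_min hK j).trans (min_le_min_left _ ?_)
  have : (K j : ℝ) ≤ K (Fin.last m) := by exact_mod_cast hmono (Fin.le_last j)
  gcongr

theorem mul_firstEdgeProb_le_hitProb (hμ : ∀ i, 0 ≤ μ i) (j : Fin (m + 1)) :
    μ j * firstEdgeProb K P j ≤ hitProb μ K P (K 0) :=
  Finset.single_le_sum (f := fun j => μ j * firstEdgeProb K P j)
    (fun i _ => mul_nonneg (hμ i) (firstEdgeProb_nonneg K P i)) (Finset.mem_univ j)

/-- Hitting probabilities are truncated products of ring sizes up to a factor 2, and `min 1 (ρ * t)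
≤ ρ * min 1 t` extracts the ratio. This bounds the cost of a tree edge. -/
theorem hitProb_le_ratio_mul (hμ : ∀ i, 0 ≤ μ i) (hμ1 : ∑ i, μ i = 1) (hK : ∀ i, K i ≤ P)
    (hmono : Monotone K) (h0 : 0 < K 0) {c₀ : ℝ} (hc₀ : 0 < c₀) (hc : c₀ ≤ μ (Fin.last m))
    (j : Fin (m + 1)) :
    hitProb μ K P (K j) ≤ (K (Fin.last m) : ℝ) / K 0 * (2 / c₀ * hitProb μ K P (K 0)) := by
  have h1 : hitProb μ K P (K j) ≤ min 1 ((K (Fin.last m) : ℝ) * K (Fin.last m) / P) := by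
    refine le_min (hitProb_le_one hμ hμ1 K P _) ?_
    refine sum_weight_mul_le hμ hμ1 fun i => ?_
    refine (one_sub_missProb_le (hK i) (hK j)).trans ?_
    have h1 : (K j : ℝ) ≤ K (Fin.last m) := by exact_mod_cast hmono (Fin.le_last j)
    have h2 : (K i : ℝ) ≤ K (Fin.last m) := by exact_mod_cast hmono (Fin.le_last i)
    gcongr
  have h0r : (0 : ℝ) < K 0 := by exact_mod_cast h0
  have h2 : (K (Fin.last m) : ℝ) * K (Fin.last m) / P =
      (K (Fin.last m) : ℝ) / K 0 * ((K 0 : ℝ) * K (Fin.last m) / P) := by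
    field_simp
  rw [h2] at h1
  refine h1.trans ((min_one_mul_le (one_le_ratio hmono h0)).trans ?_)
  refine mul_le_mul_of_nonneg_left ?_ (by positivity)
  have h3 := half_min_le_firstEdgeProb hK (Fin.last m)
  have h4 := mul_firstEdgeProb_le_hitProb (K := K) (P := P) hμ (Fin.last m)
  have h5 := mul_le_mul_of_nonneg_right hc (firstEdgeProb_nonneg K P (Fin.last m))
  rw [div_mul_eq_mul_div, le_div_iff₀ hc₀]
  nlinarith [mul_le_mul_of_nonneg_left h3 hc₀.le]

/-- The same comparison in the other direction: no class has too small a link probability to class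
0, as needed for cuts of linear size. -/
theorem hitProb_zero_le_ratio_mul (hμ : ∀ i, 0 ≤ μ i) (hμ1 : ∑ i, μ i = 1) (hK : ∀ i, K i ≤ P)
    (hmono : Monotone K) (h0 : 0 < K 0) (j : Fin (m + 1)) :
    hitProb μ K P (K 0) ≤ (K (Fin.last m) : ℝ) / K 0 * (2 * firstEdgeProb K P j) := by
  have h0r : (0 : ℝ) < K 0 := by exact_mod_cast h0
  have h1 := hitProb_zero_le_min hμ hμ1 hK hmono
  have h2 : (K 0 : ℝ) * K (Fin.last m) / P =
      (K (Fin.last m) : ℝ) / K 0 * ((K 0 : ℝ) * K 0 / P) := by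
    field_simp
  rw [h2] at h1
  refine h1.trans ((min_one_mul_le (one_le_ratio hmono h0)).trans ?_)
  refine mul_le_mul_of_nonneg_left ?_ (by positivity)
  have h3 := half_min_le_firstEdgeProb hK j
  have h4 : (K 0 : ℝ) * K 0 / P ≤ (K 0 : ℝ) * K j / P := by
    have : (K 0 : ℝ) ≤ K j := by exact_mod_cast hmono (Fin.zero_le _)
    gcongr
  linarith [min_le_min_left (1 : ℝ) h4]

end Ratio

/-! ### Analytic estimates for degrees and overlaps. -/

section Estimates

/-- Monotonicity beyond the maximum at `d`, from `y / x ≤ exp ((y - x) / x)`. -/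
theorem pow_mul_exp_neg_le {x y : ℝ} {d : ℕ} (hx : 0 < x) (hdx : d ≤ x) (hxy : x ≤ y) :
    y ^ d * Real.exp (-y) ≤ x ^ d * Real.exp (-x) := by
  have h1 : y / x ≤ Real.exp ((y - x) / x) := by
    have := Real.add_one_le_exp ((y - x) / x)
    have h2 : (y - x) / x + 1 = y / x := by field_simp; ring
    linarith
  have h2 : (y / x) ^ d ≤ Real.exp (y - x) := by
    refine (pow_le_pow_left₀ (by have := hx.trans_le hxy; positivity) h1 d).trans ?_
    rw [← Real.exp_nat_mul, Real.exp_le_exp, ← mul_div_assoc, div_le_iff₀ hx]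
    nlinarith
  have h3 : y ^ d = x ^ d * (y / x) ^ d := by rw [← mul_pow]; field_simp
  calc y ^ d * Real.exp (-y) = x ^ d * ((y / x) ^ d * Real.exp (-y)) := by rw [h3]; ring
    _ ≤ x ^ d * (Real.exp (y - x) * Real.exp (-y)) := by gcongr
    _ = x ^ d * Real.exp (-x) := by rw [← Real.exp_add]; ring_nf

/-- Reduces every class, with link probability `s`, to class 0, with link probability `t ≤ s`, by
that monotonicity. The factor `exp k` pays for the at most `k` factors missing from the power of `1
- s`. -/
theorem mul_pow_mul_one_sub_pow_le {n j k : ℕ} {s t : ℝ} (hj : j < k) (hkn : k ≤ n)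
    (hkt : (k : ℝ) ≤ n * t) (hts : t ≤ s) (hs1 : s ≤ 1) :
    (n : ℝ) ^ j * (s ^ j * (1 - s) ^ (n - 1 - j)) ≤
      Real.exp k * ((n * t) ^ (k - 1) * Real.exp (-(n * t))) := by
  have hk1 : (1 : ℝ) ≤ k := by exact_mod_cast (by omega : 1 ≤ k)
  have hns : (n : ℝ) * t ≤ n * s := mul_le_mul_of_nonneg_left hts (by positivity)
  have hns1 : 1 ≤ (n : ℝ) * s := by linarith
  have hn0 : (0 : ℝ) < n := by exact_mod_cast (by omega : 0 < n)
  have hs0 : 0 < s := by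
    by_contra h
    push Not at h
    nlinarith
  have h1 : (1 - s) ^ (n - 1 - j) ≤ Real.exp k * Real.exp (-(n * s)) := by
    have h2 : 1 - s ≤ Real.exp (-s) := by linarith [Real.add_one_le_exp (-s)]
    refine (pow_le_pow_left₀ (by linarith) h2 _).trans ?_
    rw [← Real.exp_nat_mul, ← Real.exp_add, Real.exp_le_exp]
    have h3 : (n : ℝ) - k ≤ ((n - 1 - j : ℕ) : ℝ) := by
      have : n ≤ (n - 1 - j) + k := by omega
      have : (n : ℝ) ≤ ((n - 1 - j : ℕ) : ℝ) + k := by exact_mod_cast this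
      linarith
    nlinarith [mul_le_mul_of_nonneg_right h3 hs0.le]
  have h4 : ((n : ℝ) * s) ^ j ≤ (n * s) ^ (k - 1) := pow_le_pow_right₀ hns1 (by omega)
  calc (n : ℝ) ^ j * (s ^ j * (1 - s) ^ (n - 1 - j))
      = (n * s) ^ j * (1 - s) ^ (n - 1 - j) := by rw [mul_pow]; ring
    _ ≤ (n * s) ^ (k - 1) * (Real.exp k * Real.exp (-(n * s))) :=
        mul_le_mul h4 h1 (pow_nonneg (by linarith) _) (by positivity)
    _ = Real.exp k * ((n * s) ^ (k - 1) * Real.exp (-(n * s))) := by ring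
    _ ≤ _ := by
        refine mul_le_mul_of_nonneg_left (pow_mul_exp_neg_le (by linarith) ?_ hns)
          (Real.exp_pos _).le
        rw [Nat.cast_sub (by omega)]
        push_cast
        linarith

theorem modelLaw_real_small_degree_le_exp {n m P : ℕ} {μ : Fin (m + 1) → ℝ} (hμ : ∀ i, 0 ≤ μ i)
    (hμ1 : ∑ i, μ i = 1) {K : Fin (m + 1) → ℕ} (hK : ∀ i, K i ≤ P) (hmono : Monotone K)
    (α : unitInterval) {k : ℕ} (hkn : k ≤ n)
    (hkX : (k : ℝ) ≤ n * ((α : ℝ) * hitProb μ K P (K 0))) :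
    (modelLaw n μ K P α).real {ω | ∃ v, (outerBoundary (intersectionGraph ω) {v}).card < k} ≤
      n * (k * (Real.exp k * ((n * ((α : ℝ) * hitProb μ K P (K 0))) ^ (k - 1) *
        Real.exp (-(n * ((α : ℝ) * hitProb μ K P (K 0))))))) := by
  refine (modelLaw_real_small_degree_le hμ hμ1 hK α k).trans
    (mul_le_mul_of_nonneg_left ?_ (by positivity))
  set B := Real.exp k * ((n * ((α : ℝ) * hitProb μ K P (K 0))) ^ (k - 1) *
        Real.exp (-(n * ((α : ℝ) * hitProb μ K P (K 0))))) with hB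
  calc _ ≤ ∑ j ∈ Finset.range k, B := by
        refine Finset.sum_le_sum fun j hj => ?_
        simp only [mul_left_comm ((n : ℝ) ^ j) (μ _)]
        refine sum_weight_mul_le hμ hμ1 fun c => ?_
        refine mul_pow_mul_one_sub_pow_le (Finset.mem_range.1 hj) hkn hkX ?_ ?_
        · exact mul_le_mul_of_nonneg_left (hitProb_mono hμ K P (hmono (Fin.zero_le _))) α.2.1
        · exact mul_le_one₀ α.2.2 (hitProb_nonneg hμ K P _) (hitProb_le_one hμ hμ1 K P _)
    _ = k * B := by simp

/-- If `y ≤ n ^ (-1/2)`, then six factors `y` already suffice. Otherwise `y * n` is large, so `hyn`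
forces `b ≥ 6 * log n`, and `y ≤ exp (-1)` yields `n ^ (-3)`. -/
theorem sq_mul_pow_le_inv {n b : ℕ} {y D : ℝ} (hn : 1 ≤ n) (hy0 : 0 ≤ y)
    (hy : y ≤ Real.exp (-1)) (hb : 12 ≤ b) (hD : 0 < D)
    (hyn : y * n ≤ D * (b * Real.log n)) (hlarge : (6 * D * Real.log n ^ 2) ^ 2 ≤ n)
    (hlog : 0 < Real.log n) :
    (n : ℝ) ^ 2 * y ^ ((b + 1) / 2) ≤ 1 / n := by
  have hnr : (0 : ℝ) < n := by exact_mod_cast hn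
  have hy1 : y ≤ 1 := hy.trans (Real.exp_le_one_iff.2 (by norm_num))
  rw [le_div_iff₀ hnr]
  rcases le_or_gt (y ^ 2 * n) 1 with h | h
  · have h1 : y ^ ((b + 1) / 2) ≤ y ^ 6 := pow_le_pow_of_le_one hy0 hy1 (by omega)
    calc (n : ℝ) ^ 2 * y ^ ((b + 1) / 2) * n ≤ (n : ℝ) ^ 2 * y ^ 6 * n := by gcongr
      _ = (y ^ 2 * n) ^ 3 := by ring
      _ ≤ 1 := pow_le_one₀ (by positivity) h
  · have h1 : (6 * D * Real.log n ^ 2) ^ 2 < (y * n) ^ 2 := by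
      refine hlarge.trans_lt ?_
      nlinarith
    have h2 : 6 * D * Real.log n ^ 2 < y * n := lt_of_pow_lt_pow_left₀ 2 (by positivity) h1
    have h3 : 6 * Real.log n ≤ b := by
      have h4 : (D * Real.log n) * (6 * Real.log n) ≤ (D * Real.log n) * b := by nlinarith
      exact le_of_mul_le_mul_left h4 (by positivity)
    have h5 : (b : ℝ) / 2 ≤ ((b + 1) / 2 : ℕ) := by
      have : b ≤ 2 * ((b + 1) / 2) := by omega
      have : (b : ℝ) ≤ 2 * ((b + 1) / 2 : ℕ) := by exact_mod_cast this
      linarith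
    have h6 : y ^ ((b + 1) / 2) ≤ Real.exp (-(3 * Real.log n)) := by
      refine (pow_le_pow_left₀ hy0 hy _).trans ?_
      rw [← Real.exp_nat_mul, Real.exp_le_exp]
      linarith
    have h7 : Real.exp (-(3 * Real.log n)) * (n : ℝ) ^ 3 = 1 := by
      have : (n : ℝ) ^ 3 = Real.exp (3 * Real.log n) := by
        rw [show (3 : ℝ) = (3 : ℕ) by norm_num, Real.exp_nat_mul, Real.exp_log hnr]
      rw [this, ← Real.exp_add]; simp
    calc (n : ℝ) ^ 2 * y ^ ((b + 1) / 2) * n ≤ (n : ℝ) ^ 2 * Real.exp (-(3 * Real.log n)) * n := by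
          gcongr
      _ = 1 := by rw [← h7]; ring

/-- The exponential supplies `n⁻¹ * (log n) ^ (-(k - 1)) * exp (-g)`, and the base of the power is
at most `log n * (k + g)`, so `n` and all logarithms cancel. -/
theorem mul_pow_mul_exp_neg_le {n k : ℕ} {g : ℝ} (hk : 1 ≤ k) (hn : 0 < n)
    (hlog : 1 ≤ Real.log n) (hg : 0 ≤ g) :
    (n : ℝ) * ((Real.log n + ((k : ℝ) - 1) * Real.log (Real.log n) + g) ^ (k - 1) *
      Real.exp (-(Real.log n + ((k : ℝ) - 1) * Real.log (Real.log n) + g))) ≤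
      (k + g) ^ (k - 1) * Real.exp (-g) := by
  have hnr : (0 : ℝ) < n := by exact_mod_cast hn
  have hk1 : (1 : ℝ) ≤ k := by exact_mod_cast hk
  set l := Real.log n with hl
  have hll0 : 0 ≤ Real.log l := Real.log_nonneg hlog
  have hll : Real.log l ≤ l := (Real.log_le_sub_one_of_pos (by linarith)).trans (by linarith)
  have hX : l + ((k : ℝ) - 1) * Real.log l + g ≤ l * (k + g) := by nlinarith
  have hX0 : 0 ≤ l + ((k : ℝ) - 1) * Real.log l + g := by
    have := mul_nonneg (sub_nonneg.2 hk1) hll0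
    linarith
  have he : Real.exp (-(l + ((k : ℝ) - 1) * Real.log l + g)) =
      (n : ℝ)⁻¹ * ((l ^ (k - 1))⁻¹ * Real.exp (-g)) := by
    have h1 : l ^ (k - 1) = Real.exp (((k : ℝ) - 1) * Real.log l) := by
      rw [show ((k : ℝ) - 1) = ((k - 1 : ℕ) : ℝ) by rw [Nat.cast_sub hk]; simp, Real.exp_nat_mul,
        Real.exp_log (by linarith)]
    rw [h1, ← Real.exp_neg, ← Real.exp_log (inv_pos.2 hnr), Real.log_inv, ← hl, ← Real.exp_add,
      ← Real.exp_add]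
    ring_nf
  have hl0 : 0 < l := by linarith
  rw [he]
  calc (n : ℝ) * ((l + ((k : ℝ) - 1) * Real.log l + g) ^ (k - 1) *
        ((n : ℝ)⁻¹ * ((l ^ (k - 1))⁻¹ * Real.exp (-g))))
      = (l + ((k : ℝ) - 1) * Real.log l + g) ^ (k - 1) * (l ^ (k - 1))⁻¹ * Real.exp (-g) := by
        field_simp
    _ ≤ (l * (k + g)) ^ (k - 1) * (l ^ (k - 1))⁻¹ * Real.exp (-g) := by gcongr
    _ = _ := by rw [mul_pow]; field_simp

end Estimates

end RandomKeyGraph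

namespace RandomKeyGraph

open MeasureTheory ProbabilityTheory

/-! ### Above the threshold. -/

section Connected

open Filter Asymptotics Topology

theorem eventually_mul_pow_le_exp (c : ℝ) {b : ℝ} (hb : 0 < b) (N : ℕ) :
    ∀ᶠ x : ℝ in atTop, c * x ^ N ≤ Real.exp (b * x) := by
  have h := (isLittleO_pow_exp_pos_mul_atTop N hb).def
    (inv_pos.2 (by positivity : 0 < |c| + 1))
  filter_upwards [h, eventually_ge_atTop 0] with x hx h0
  rw [Real.norm_of_nonneg (by positivity), Real.norm_of_nonneg (Real.exp_pos _).le,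
    inv_mul_eq_div, le_div_iff₀ (by positivity)] at hx
  have : c * x ^ N ≤ (|c| + 1) * x ^ N :=
    mul_le_mul_of_nonneg_right ((le_abs_self c).trans (by linarith)) (by positivity)
  linarith

theorem tendsto_log_natCast : Tendsto (fun n : ℕ => Real.log n) atTop atTop :=
  Real.tendsto_log_atTop.comp tendsto_natCast_atTop_atTop

theorem tendsto_probKConnected_one {m k : ℕ} (hk : 1 ≤ k) {μ : Fin (m + 1) → ℝ}
    (hμ_pos : ∀ i, 0 < μ i) (hμ1 : ∑ i, μ i = 1)
    {K : ℕ → Fin (m + 1) → ℕ} {P : ℕ → ℕ} (hKP : IsKeyScaling K P)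
    {α : ℕ → unitInterval} {γ : ℕ → ℝ}
    (hγ : ∀ n : ℕ, 2 ≤ n → (α n : ℝ) * hitProb μ (K n) (P n) (K n 0) =
      (Real.log n + ((k : ℝ) - 1) * Real.log (Real.log n) + γ n) / n)
    (hP : (fun n : ℕ => (n : ℝ)) =O[atTop] (fun n : ℕ => (P n : ℝ)))
    (hsmall : (fun n : ℕ => (K n (Fin.last m) : ℝ) / (P n : ℝ)) =o[atTop] (fun _ => (1 : ℝ)))
    (hratio : (fun n : ℕ => (K n (Fin.last m) : ℝ) / (K n 0 : ℝ)) =o[atTop]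
      (fun n : ℕ => Real.log n))
    (hγtop : Tendsto γ atTop atTop) :
    Tendsto (fun n : ℕ => probKConnected k n μ (K n) (P n) (α n)) atTop (𝓝 1) := by
  have hμ : ∀ i, 0 ≤ μ i := fun i => (hμ_pos i).le
  have hk1 : (1 : ℝ) ≤ k := by exact_mod_cast hk
  obtain ⟨c₀, hc₀, hc₀μ⟩ : ∃ c₀ : ℝ, 0 < c₀ ∧ ∀ j, c₀ ≤ μ j := by
    obtain ⟨i, hi⟩ := Finite.exists_min μ
    exact ⟨μ i, hμ_pos i, hi⟩
  have hc₀1 : c₀ ≤ 1 := (hc₀μ 0).trans (by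
    rw [← hμ1]; exact Finset.single_le_sum (fun i _ => hμ i) (Finset.mem_univ 0))
  obtain ⟨C, hC, hCP⟩ := hP.exists_pos
  have hCP' : ∀ᶠ n : ℕ in atTop, (n : ℝ) ≤ C * P n := by
    filter_upwards [hCP.bound] with n hn
    simpa using hn
  have hsmall' : ∀ ε > 0, ∀ᶠ n : ℕ in atTop, (K n (Fin.last m) : ℝ) / (P n : ℝ) ≤ ε := by
    intro ε hε
    filter_upwards [hsmall.def hε] with n hn
    rw [Real.norm_of_nonneg (by positivity)] at hn
    simpa using hn
  have hlog1 : ∀ᶠ n : ℕ in atTop, 1 ≤ Real.log n := tendsto_log_natCast.eventually_ge_atTop 1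
  have hratio' : ∀ ε > 0, ∀ᶠ n : ℕ in atTop,
      (K n (Fin.last m) : ℝ) / (K n 0 : ℝ) ≤ ε * Real.log n := by
    intro ε hε
    filter_upwards [hratio.def hε, hlog1] with n hn hl
    rwa [Real.norm_of_nonneg (by positivity), Real.norm_of_nonneg (by linarith)] at hn
  set X : ℕ → ℝ := fun n => (n : ℝ) * ((α n : ℝ) * hitProb μ (K n) (P n) (K n 0)) with hXdef
  have hX : ∀ n : ℕ, 2 ≤ n →
      X n = Real.log n + ((k : ℝ) - 1) * Real.log (Real.log n) + γ n := by
    intro n hn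
    have : (0 : ℝ) < n := by exact_mod_cast (by omega : 0 < n)
    simp only [hXdef]
    rw [hγ n hn]
    field_simp
  have hlogX : ∀ᶠ n : ℕ in atTop, Real.log n ≤ X n := by
    filter_upwards [eventually_ge_atTop 2, hlog1, hγtop.eventually_ge_atTop 0] with n hn hl hg
    rw [hX n hn]
    have := mul_nonneg (sub_nonneg.2 hk1) (Real.log_nonneg hl)
    linarith
  have hXtop : Tendsto X atTop atTop := tendsto_atTop_mono' _ hlogX tendsto_log_natCast
  have hbasic : ∀ᶠ n : ℕ in atTop, 2 ≤ K n 0 ∧ Monotone (K n) ∧ (∀ i, K n i ≤ P n) ∧ 0 < P n := by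
    filter_upwards [eventually_ge_atTop 2] with n hn
    obtain ⟨h1, h2, h3⟩ := hKP n hn
    have h4 : K n (Fin.last m) ≤ P n := by
      have : (K n (Fin.last m) : ℝ) ≤ P n := h3.trans (by linarith [(P n).cast_nonneg (α := ℝ)])
      exact_mod_cast this
    have h5 : ∀ i, K n i ≤ P n := fun i => (h2 (Fin.le_last i)).trans h4
    exact ⟨h1, h2, h5, by have := h5 0; omega⟩
  -- `log n ≤ X ≤ C * K 0 * K (Fin.last m)`, while `K (Fin.last m)` is `o(log n)` times `K 0`; hence
  -- `K 0 ^ 2` exceeds every constant.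
  have hK0 : Tendsto (fun n => (K n 0 : ℝ)) atTop atTop := by
    rw [tendsto_atTop]
    intro M
    set M' := max M 1 with hM'
    have hM0 : 0 < M' := lt_of_lt_of_le one_pos (le_max_right _ _)
    filter_upwards [hbasic, hCP', hlogX, hlog1, hratio' (1 / (C * M' ^ 2)) (by positivity)] with
      n ⟨h2, hmono, hK, hP0⟩ hCn hlX hl hr
    refine (le_max_left M 1).trans ?_
    rw [← hM']
    have hPr : (0 : ℝ) < P n := by exact_mod_cast hP0
    have hKr : (0 : ℝ) < K n 0 := by exact_mod_cast (by omega : 0 < K n 0)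
    have h1 : X n ≤ C * ((K n 0 : ℝ) * K n (Fin.last m)) := by
      have h3 := (hitProb_zero_le_min hμ hμ1 hK hmono).trans (min_le_right _ _)
      have h4 : (α n : ℝ) * hitProb μ (K n) (P n) (K n 0) ≤ hitProb μ (K n) (P n) (K n 0) :=
        mul_le_of_le_one_left (hitProb_nonneg hμ _ _ _) (α n).2.2
      calc X n ≤ (n : ℝ) * ((K n 0 : ℝ) * K n (Fin.last m) / P n) :=
            mul_le_mul_of_nonneg_left (h4.trans h3) (by positivity)
        _ ≤ (C * P n) * ((K n 0 : ℝ) * K n (Fin.last m) / P n) := by gcongr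
        _ = _ := by field_simp
    rw [div_le_iff₀ hKr] at hr
    have h5 : Real.log n * 1 ≤ Real.log n * ((K n 0 : ℝ) ^ 2 / M' ^ 2) := by
      calc Real.log n * 1 ≤ X n := by linarith
        _ ≤ C * ((K n 0 : ℝ) * (1 / (C * M' ^ 2) * Real.log n * K n 0)) := h1.trans (by gcongr)
        _ = _ := by field_simp
    have h6 := le_of_mul_le_mul_left h5 (by linarith)
    rw [le_div_iff₀ (by positivity), one_mul] at h6
    exact le_of_sq_le_sq h6 hKr.le
  obtain ⟨L, hLk, hcL⟩ : ∃ L : ℕ, k ≤ L ∧ 24 ≤ c₀ / 24 * L := by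
    obtain ⟨N, hN⟩ := exists_nat_ge (24 / (c₀ / 24))
    refine ⟨max k N, le_max_left _ _, ?_⟩
    rw [div_le_iff₀ (by positivity)] at hN
    have : (N : ℝ) ≤ (max k N : ℕ) := by exact_mod_cast le_max_right _ _
    nlinarith [mul_le_mul_of_nonneg_left this (by positivity : 0 ≤ c₀ / 24)]
  -- `θ` is so small that choosing at most `θ * n` nodes costs no more than half of the decay in
  -- `smallCut_large`.
  obtain ⟨θ, hθ0, hθ⟩ : ∃ θ : ℝ, 0 < θ ∧ θ * (-Real.log (c₀ / 24 / 16)) ≤ c₀ / 24 / 16 := by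
    have : Real.log (c₀ / 24 / 16) < 0 := Real.log_neg (by positivity) (by linarith)
    refine ⟨c₀ / 24 / 16 / (-Real.log (c₀ / 24 / 16)), div_pos (by positivity) (by linarith), ?_⟩
    rw [div_mul_cancel₀ _ (by linarith)]
  have hreg : ∀ᶠ n : ℕ in atTop, CutRegime n μ (K n) (P n) (α n) k c₀ C := by
    have hexp1 := hK0.eventually (eventually_mul_pow_le_exp (24 / c₀)
      (by norm_num : (0 : ℝ) < 1 / 16) 0)
    have hexp2 := hK0.eventually (eventually_mul_pow_le_exp (24 / c₀ * (4 * C))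
      (by norm_num : (0 : ℝ) < 1 / 16) 1)
    filter_upwards [hbasic, hCP', hlogX, hlog1, hsmall' (1 / 16) (by norm_num), hexp1, hexp2,
      hratio' (c₀ / 2) (by positivity), eventually_ge_atTop (8 * k), eventually_ge_atTop 2] with
      n ⟨h2, hmono, hK, hP0⟩ hCn hlX hl hs he1 he2 hr hkn hn2
    have hPr : (0 : ℝ) < P n := by exact_mod_cast hP0
    have hnr : (0 : ℝ) < n := by exact_mod_cast (by omega : 0 < n)
    have hKr : (0 : ℝ) < K n 0 := by exact_mod_cast (by omega : 0 < K n 0)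
    have hs0 : 0 ≤ (α n : ℝ) * hitProb μ (K n) (P n) (K n 0) :=
      mul_nonneg (α n).2.1 (hitProb_nonneg hμ _ _ _)
    refine ⟨hμ1, hc₀μ, hc₀, hc₀1, hC, hK, hmono, h2, ?_, hCn, hl.trans hlX, hlX, ?_, ?_, hkn⟩
    · have h3 := hmono (Fin.zero_le (Fin.last m))
      rw [div_le_iff₀ hPr] at hs
      have h4 : (16 * K n (Fin.last m) : ℝ) ≤ P n := by linarith
      have h5 : 16 * K n (Fin.last m) ≤ P n := by exact_mod_cast h4
      omega
    · rw [pow_zero, mul_one, div_mul_eq_mul_div, one_mul, div_le_iff₀ hc₀] at he1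
      rw [pow_one, div_mul_eq_mul_div _ _ ((K n 0 : ℝ)), one_mul] at he2
      rw [mul_min_of_nonneg _ _ (by positivity), le_min_iff, Real.exp_neg]
      constructor
      · rw [inv_le_iff_one_le_mul₀ (Real.exp_pos _)]
        linarith
      · rw [inv_le_iff_one_le_mul₀ (Real.exp_pos _)]
        calc (1 : ℝ) = c₀ / 24 * (1 / (4 * C * K n 0)) * (24 / c₀ * (4 * C) * K n 0) := by
              field_simp
          _ ≤ _ := by gcongr
    · intro j
      have h3 := hitProb_le_ratio_mul hμ hμ1 hK hmono (by omega) hc₀ (hc₀μ (Fin.last m)) j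
      calc (α n : ℝ) * hitProb μ (K n) (P n) (K n j)
          ≤ (α n : ℝ) * (c₀ / 2 * Real.log n * (2 / c₀ * hitProb μ (K n) (P n) (K n 0))) := by
            refine mul_le_mul_of_nonneg_left (h3.trans ?_) (α n).2.1
            refine mul_le_mul_of_nonneg_right hr ?_
            exact mul_nonneg (by positivity) (hitProb_nonneg hμ _ _ _)
        _ = Real.log n * ((α n : ℝ) * hitProb μ (K n) (P n) (K n 0)) := by field_simp
        _ ≤ X n * ((α n : ℝ) * hitProb μ (K n) (P n) (K n 0)) := by gcongr
        _ = X n ^ 2 / n := by simp only [hXdef]; field_simp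
  have hcuts : ∀ᶠ n : ℕ in atTop, ∑ ℓ ∈ Finset.Icc 2 (n / 2), (modelLaw n μ (K n) (P n) (α n)).real
      (smallCut (K n 0 / 2) (P n / (8 * (K n 0 / 2))) k ℓ) ≤
      L * (k * (Real.exp (2 * (L + k)) * Real.exp (-(Real.log n / 16)))) + 2 * k / n := by
    have hp1 := hXtop.eventually (eventually_mul_pow_le_exp (8 ^ (L + k))
      (by norm_num : (0 : ℝ) < 1 / 16) (2 * (L + k)))
    have hp2 := hXtop.eventually (eventually_mul_pow_le_exp 8
      (by positivity : (0 : ℝ) < c₀ / 24 / 16) 2)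
    have hp3 := (tendsto_natCast_atTop_atTop (R := ℝ)).eventually (eventually_mul_pow_le_exp 1
      (by positivity : (0 : ℝ) < c₀ / 24 / 8) (k + 2))
    have hp4 := tendsto_log_natCast.eventually (eventually_mul_pow_le_exp (4 / c₀) one_pos 1)
    filter_upwards [hreg, hp1, hp2, hp3, hp4, hratio' (θ / 108) (by positivity),
      hK0.eventually_ge_atTop 144, eventually_ge_atTop (L + k), hlog1] with
      n H h1 h2 h3 h4 hr hK9 hLn hl
    have hnr : (0 : ℝ) < n := by exact_mod_cast H.n_pos
    have hX0 : 0 < X n := by have := H.one_le; simp only [hXdef]; linarith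
    have hKr : (0 : ℝ) < K n 0 := by linarith
    have hmain := H.sum_smallCut_le hLk hLn hcL (θ := θ) ?_ ?_ ?_ hθ ?_ ?_
    · refine hmain.trans (add_le_add le_rfl ?_)
      have h5 : Real.exp (-(2 * Real.log n)) = 1 / (n : ℝ) ^ 2 := by
        rw [Real.exp_neg, show (2 : ℝ) = (2 : ℕ) by norm_num, Real.exp_nat_mul,
          Real.exp_log hnr, one_div]
      have h6 : (n : ℝ) ^ k * Real.exp (-(c₀ / 24 / 8 * n)) ≤ 1 / (n : ℝ) ^ 2 := by
        rw [le_div_iff₀ (by positivity), Real.exp_neg]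
        calc (n : ℝ) ^ k * (Real.exp (c₀ / 24 / 8 * n))⁻¹ * (n : ℝ) ^ 2
            = 1 * (n : ℝ) ^ (k + 2) * (Real.exp (c₀ / 24 / 8 * n))⁻¹ := by ring
          _ ≤ Real.exp (c₀ / 24 / 8 * n) * (Real.exp (c₀ / 24 / 8 * n))⁻¹ := by gcongr
          _ = 1 := mul_inv_cancel₀ (Real.exp_pos _).ne'
      calc (n : ℝ) * (k * Real.exp (-(2 * Real.log n)) +
              k * ((n : ℝ) ^ k * Real.exp (-(c₀ / 24 / 8 * n))))
          ≤ n * (k * (1 / (n : ℝ) ^ 2) + k * (1 / (n : ℝ) ^ 2)) := by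
            rw [h5]; gcongr
        _ = 2 * k / n := by field_simp; ring
    · rw [mul_pow, ← pow_mul, div_eq_inv_mul, ← one_div]
      exact h1
    -- If `α * firstEdgeProb` exceeds `1 / 2` for some class, then `s ≥ c₀ / 2`, so `X` is linear in
    -- `n` and exceeds `2 * log n`.
    · by_cases hall : ∀ j, (α n : ℝ) * firstEdgeProb (K n) (P n) j ≤ 1 / 2
      · exact Or.inl hall
      · right
        push Not at hall
        obtain ⟨j, hj⟩ := hall
        have h5 := mul_firstEdgeProb_le_hitProb (K := K n) (P := P n) hμ j
        have h6 : c₀ / 2 ≤ (α n : ℝ) * hitProb μ (K n) (P n) (K n 0) := by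
          have h7 := mul_le_mul_of_nonneg_left h5 (α n).2.1
          have h8 : c₀ * ((α n : ℝ) * firstEdgeProb (K n) (P n) j) ≤
              μ j * ((α n : ℝ) * firstEdgeProb (K n) (P n) j) :=
            mul_le_mul_of_nonneg_right (hc₀μ j) (by linarith)
          nlinarith
        rw [one_mul, Real.exp_log hnr, pow_one, div_mul_eq_mul_div, div_le_iff₀ hc₀] at h4
        have := mul_le_mul_of_nonneg_left h6 hnr.le
        linarith
    · have h5 : c₀ / 24 * X n / 16 = c₀ / 24 / 16 * X n := by ring
      have h6 : c₀ / 24 * ((n : ℝ) * ((α n : ℝ) * hitProb μ (K n) (P n) (K n 0))) / 16 =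
        c₀ / 24 / 16 * X n := h5
      rw [h6]
      exact h2
    -- The ratio of ring sizes is at most `θ / 108 * X`; dividing by `X` leaves `54 ≤ θ * n * α *
    -- firstEdgeProb`, and `54 / 6 = 9`.
    · intro j
      have h5 := hitProb_zero_le_ratio_mul hμ hμ1 H.le_pool H.mono (by have := H.two_le; omega) j
      have hfe := firstEdgeProb_nonneg (K n) (P n) j
      have h6 : X n ≤ X n * (θ / 108 * (2 * (n * ((α n : ℝ) * firstEdgeProb (K n) (P n) j)))) := by
        have hα0 := (α n).2.1
        have hXX : Real.log n ≤ X n := H.log_le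
        calc X n ≤ (n : ℝ) * ((α n : ℝ) * ((K n (Fin.last m) : ℝ) / K n 0 *
                (2 * firstEdgeProb (K n) (P n) j))) := by
              simp only [hXdef]; gcongr
          _ ≤ (n : ℝ) * ((α n : ℝ) * (θ / 108 * X n * (2 * firstEdgeProb (K n) (P n) j))) := by
              have : (K n (Fin.last m) : ℝ) / K n 0 ≤ θ / 108 * X n :=
                hr.trans (by gcongr)
              gcongr
          _ = _ := by ring
      have h7 := le_of_mul_le_mul_left ((mul_one (X n)).trans_le h6) hX0
      linarith
    · rw [Real.exp_le_exp]; linarith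
  have ht : Tendsto (fun n => 16 * C * (((K n 0 / 2 : ℕ) : ℝ) * (1 / 2 : ℝ) ^ (K n 0 / 2)))
      atTop (𝓝 0) := by
    have h1 : Tendsto (fun n => K n 0 / 2) atTop atTop :=
      (Nat.tendsto_div_const_atTop two_ne_zero).comp (tendsto_natCast_atTop_iff.1 hK0)
    have h2 := (tendsto_self_mul_const_pow_of_lt_one (r := (1 / 2 : ℝ)) (by norm_num)
      (by norm_num)).comp h1
    simpa using h2.const_mul (16 * C)
  have hspread : ∀ᶠ n : ℕ in atTop, (modelLaw n μ (K n) (P n) (α n)).real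
      {ω | ¬ SpreadOn (K n 0 / 2) (P n / (8 * (K n 0 / 2))) Finset.univ ω.1} ≤
      2 * (16 * C * (((K n 0 / 2 : ℕ) : ℝ) * (1 / 2) ^ (K n 0 / 2))) := by
    filter_upwards [hreg, ht.eventually (ge_mem_nhds (by norm_num : (0 : ℝ) < 1 / 2))] with n H h1
    have hP0 : 0 < P n := by have := H.le_pool 0; have := H.two_le; omega
    have hPr : (0 : ℝ) < P n := by exact_mod_cast hP0
    refine modelLaw_real_not_spreadOn_le hμ hμ1 H.le_pool hP0 (α n) (by have := H.two_le; omega)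
      (fun j => ?_) ?_ h1
    · have := H.mono (Fin.zero_le j)
      omega
    · have : (n : ℝ) / P n ≤ C := by rw [div_le_iff₀ hPr]; exact H.nodes_le
      calc _ ≤ 16 * C * ((K n 0 / 2 : ℕ) : ℝ) * (1 / 2) ^ (K n 0 / 2) := by gcongr
        _ = _ := by ring
  have hoverlap : ∀ᶠ n : ℕ in atTop, (modelLaw n μ (K n) (P n) (α n)).real
      {ω | ¬ HalfOverlap Finset.univ ω.1} ≤ 1 / n := by
    have hp := tendsto_log_natCast.eventually (eventually_mul_pow_le_exp ((6 * (4 * C)) ^ 2)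
      one_pos 4)
    filter_upwards [hreg, hsmall' (Real.exp (-1) / 4) (by positivity), hratio' 1 one_pos, hp,
      hK0.eventually_ge_atTop 12, hlog1] with n H hs hr h1 h12 hl
    have hP0 : 0 < P n := by have := H.le_pool 0; have := H.two_le; omega
    have hPr : (0 : ℝ) < P n := by exact_mod_cast hP0
    have hnr : (0 : ℝ) < n := by exact_mod_cast H.n_pos
    have hKr : (0 : ℝ) < K n 0 := by linarith
    have hy : 4 * (K n (Fin.last m) : ℝ) / P n ≤ Real.exp (-1) := by
      rw [mul_div_assoc]; linarith
    have h4 : 4 * K n (Fin.last m) ≤ P n := by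
      have h5 := hy.trans (Real.exp_le_one_iff.2 (by norm_num : (-1 : ℝ) ≤ 0))
      rw [div_le_one hPr] at h5
      exact_mod_cast h5
    refine (modelLaw_real_not_halfOverlap_le hμ hμ1 H.le_pool H.mono (α n) h4 hP0).trans ?_
    refine sq_mul_pow_le_inv H.n_pos (by positivity) hy (by exact_mod_cast h12)
      (by positivity : 0 < 4 * C) ?_ ?_ (by linarith)
    · rw [one_mul, div_le_iff₀ hKr] at hr
      calc 4 * (K n (Fin.last m) : ℝ) / P n * n
          ≤ 4 * (Real.log n * K n 0) / P n * (C * P n) := by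
            gcongr
            exact H.nodes_le
        _ = _ := by field_simp
    · rw [one_mul, Real.exp_log hnr] at h1
      calc _ = (6 * (4 * C)) ^ 2 * Real.log n ^ 4 := by ring
        _ ≤ n := h1
  have hdegree : ∀ᶠ n : ℕ in atTop, (modelLaw n μ (K n) (P n) (α n)).real
      {ω | ∃ v, (outerBoundary (intersectionGraph ω) {v}).card < k} ≤
      k * (Real.exp k * ((k + γ n) ^ (k - 1) * Real.exp (-γ n))) := by
    filter_upwards [hreg, hXtop.eventually_ge_atTop (k : ℝ), hγtop.eventually_ge_atTop 0, hlog1,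
      eventually_ge_atTop 2, eventually_ge_atTop k] with n H hkX hg hl hn2 hkn
    refine (modelLaw_real_small_degree_le_exp hμ hμ1 H.le_pool H.mono (α n) hkn hkX).trans ?_
    have h1 := mul_pow_mul_exp_neg_le hk H.n_pos hl hg
    rw [← hX n hn2] at h1
    calc _ = k * (Real.exp k * (n * (X n ^ (k - 1) * Real.exp (-X n)))) := by
          simp only [hXdef]; ring
      _ ≤ _ := by gcongr
  have hbound : Tendsto (fun n : ℕ =>
      2 * (16 * C * (((K n 0 / 2 : ℕ) : ℝ) * (1 / 2 : ℝ) ^ (K n 0 / 2))) + 1 / n +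
      k * (Real.exp k * ((k + γ n) ^ (k - 1) * Real.exp (-γ n))) +
      (L * (k * (Real.exp (2 * (L + k)) * Real.exp (-(Real.log n / 16)))) + 2 * k / n))
      atTop (𝓝 0) := by
    have t1 := ht.const_mul 2
    have t2 : Tendsto (fun n : ℕ => 1 / (n : ℝ)) atTop (𝓝 0) := tendsto_one_div_atTop_nhds_zero_nat
    have t3 : Tendsto (fun n : ℕ => (k : ℝ) * (Real.exp k *
        ((k + γ n) ^ (k - 1) * Real.exp (-γ n)))) atTop (𝓝 0) := by
      have h1 := (Real.tendsto_pow_mul_exp_neg_atTop_nhds_zero (k - 1)).comp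
        (tendsto_const_nhds.add_atTop hγtop : Tendsto (fun n => (k : ℝ) + γ n) atTop atTop)
      have h2 := h1.const_mul (k * (Real.exp k * Real.exp k))
      rw [mul_zero] at h2
      refine h2.congr fun n => ?_
      have : Real.exp (-γ n) = Real.exp k * Real.exp (-(k + γ n)) := by
        rw [← Real.exp_add]; ring_nf
      simp only [Function.comp, this]
      ring
    have t4 : Tendsto (fun n : ℕ => (L : ℝ) * (k * (Real.exp (2 * (L + k)) *
        Real.exp (-(Real.log n / 16))))) atTop (𝓝 0) := by
      have h1 := Real.tendsto_exp_neg_atTop_nhds_zero.comp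
        (tendsto_log_natCast.atTop_div_const (by norm_num : (0 : ℝ) < 16))
      have h2 := h1.const_mul ((L : ℝ) * (k * Real.exp (2 * (L + k))))
      rw [mul_zero] at h2
      refine h2.congr fun n => ?_
      simp only [Function.comp]
      ring
    have t5 : Tendsto (fun n : ℕ => 2 * (k : ℝ) / n) atTop (𝓝 0) :=
      tendsto_const_div_atTop_nhds_zero_nat _
    simpa using ((t1.add t2).add t3).add (t4.add t5)
  have hlow := (tendsto_const_nhds (x := (1 : ℝ))).sub hbound
  rw [sub_zero] at hlow
  refine tendsto_of_tendsto_of_tendsto_of_le_of_le' hlow tendsto_const_nhds ?_ ?_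
  · filter_upwards [hreg, hcuts, hspread, hoverlap, hdegree, eventually_gt_atTop k] with
      n H h1 h2 h3 h4 hkn
    have := one_sub_probKConnected_le hμ hμ1 H.le_pool (α n) hkn (K n 0 / 2)
      (P n / (8 * (K n 0 / 2)))
    linarith
  · filter_upwards [hreg] with n H
    have := isProbabilityMeasure_modelLaw (n := n) hμ hμ1 H.le_pool (α n)
    exact measureReal_le_one

end Connected

end RandomKeyGraph

namespace RandomKeyGraph

open MeasureTheory ProbabilityTheory

/-! ### One ring meeting two given rings. -/

section PairHit

variable {m P : ℕ}

/-- By inclusion–exclusion, negative correlation of missing is negative correlation of hitting. -/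
theorem ringAvg_hit_disjoint_le {K : ℕ} (hK : K ≤ P) {U W : Finset (Fin P)} (h : Disjoint U W) :
    ringAvg P K (fun S => (if (U ∩ S).Nonempty then 1 else 0) *
      (if (W ∩ S).Nonempty then 1 else 0)) ≤
      (1 - missProb P K U.card) * (1 - missProb P K W.card) := by
  have h1 : ringAvg P K (fun S => (if (U ∩ S).Nonempty then (1 : ℝ) else 0) *
      (if (W ∩ S).Nonempty then 1 else 0)) =
      ringAvg P K (fun S => (if (U ∩ S).Nonempty then 1 else 0)) +
      ringAvg P K (fun S => (if (W ∩ S).Nonempty then 1 else 0)) -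
      ringAvg P K (fun S => (if ((U ∪ W) ∩ S).Nonempty then 1 else 0)) := by
    rw [← ringAvg_add, ← ringAvg_sub]
    refine ringAvg_congr fun S _ => ?_
    have h3 : ((U ∪ W) ∩ S).Nonempty ↔ (U ∩ S).Nonempty ∨ (W ∩ S).Nonempty := by
      rw [Finset.union_inter_distrib_right, Finset.union_nonempty]
    simp only [h3]
    by_cases h1 : (U ∩ S).Nonempty <;> by_cases h2 : (W ∩ S).Nonempty <;> simp [h1, h2]
  rw [h1, ringAvg_nonempty_inter hK, ringAvg_nonempty_inter hK, ringAvg_nonempty_inter hK,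
    Finset.card_union_of_disjoint h]
  nlinarith [missProb_add_le (P := P) (a := U.card) (b := W.card) hK]

/-- A ring meeting both sets either meets `U ∩ W`, or meets the disjoint sets `U` and `W \ U`. -/
theorem ringAvg_hit_both_le {K : ℕ} (hK : K ≤ P) (U W : Finset (Fin P)) :
    ringAvg P K (fun S => (if (U ∩ S).Nonempty then 1 else 0) *
      (if (W ∩ S).Nonempty then 1 else 0)) ≤
      ((U ∩ W).card : ℝ) * K / P + (1 - missProb P K U.card) * (1 - missProb P K W.card) := by
  have h1 : ringAvg P K (fun S => (if (U ∩ S).Nonempty then (1 : ℝ) else 0) *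
      (if (W ∩ S).Nonempty then 1 else 0)) ≤
      ringAvg P K (fun S => if ((U ∩ W) ∩ S).Nonempty then 1 else 0) +
      ringAvg P K (fun S => (if (U ∩ S).Nonempty then 1 else 0) *
        (if ((W \ U) ∩ S).Nonempty then 1 else 0)) := by
    rw [← ringAvg_add]
    refine ringAvg_mono fun S _ => ?_
    have hW : (W ∩ S).Nonempty → ((U ∩ W) ∩ S).Nonempty ∨ ((W \ U) ∩ S).Nonempty := by
      rintro ⟨w, hw⟩
      rw [Finset.mem_inter] at hw
      by_cases hU : w ∈ U
      · exact Or.inl ⟨w, by simp [hw, hU]⟩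
      · exact Or.inr ⟨w, by simp [hw, hU]⟩
    split_ifs with h1 h2 h3 h4 <;> first | (exfalso; tauto) | norm_num
  refine h1.trans (add_le_add ?_ ?_)
  · rw [ringAvg_nonempty_inter hK]
    exact one_sub_missProb_le hK (by simpa using Finset.card_le_univ (U ∩ W))
  · refine (ringAvg_hit_disjoint_le hK Finset.disjoint_sdiff).trans ?_
    refine mul_le_mul_of_nonneg_left ?_ (sub_nonneg.2 (missProb_le_one _ _ _))
    have := missProb_anti P K (Finset.card_le_card (Finset.sdiff_subset : W \ U ⊆ W))
    linarith

/-- The mean size of a key ring, relative to the size of the pool. -/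
noncomputable def meanRingDensity (μ : Fin (m + 1) → ℝ) (K : Fin (m + 1) → ℕ) (P : ℕ) : ℝ :=
  ∑ j, μ j * ((K j : ℝ) / P)

theorem meanRingDensity_nonneg {μ : Fin (m + 1) → ℝ} (hμ : ∀ i, 0 ≤ μ i) (K : Fin (m + 1) → ℕ)
    (P : ℕ) : 0 ≤ meanRingDensity μ K P :=
  Finset.sum_nonneg fun j _ => mul_nonneg (hμ j) (by positivity)

/-- The probability that the ring of a random node meets both of two given sets of keys. -/
noncomputable def bothHitProb (μ : Fin (m + 1) → ℝ) (K : Fin (m + 1) → ℕ) {P : ℕ}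
    (U W : Finset (Fin P)) : ℝ :=
  ∑ y, nodeWeight μ K P y * ((if (U ∩ y.2).Nonempty then 1 else 0) *
    (if (W ∩ y.2).Nonempty then 1 else 0))

/-- The quadratic term uses that every class has weight at least `c₀`, so `firstEdgeProb` is at most
`hitProb / c₀` for each class separately. -/
theorem bothHitProb_le {μ : Fin (m + 1) → ℝ} (hμ : ∀ i, 0 ≤ μ i) {K : Fin (m + 1) → ℕ}
    (hK : ∀ i, K i ≤ P) {c₀ : ℝ} (hc₀ : 0 < c₀) (hc : ∀ j, c₀ ≤ μ j) {U W : Finset (Fin P)}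
    (hU : U.card = K 0) (hW : W.card = K 0) :
    bothHitProb μ K U W ≤ ((U ∩ W).card : ℝ) * meanRingDensity μ K P +
      hitProb μ K P (K 0) ^ 2 / c₀ := by
  rw [bothHitProb, sum_nodeWeight_mul μ K P (fun y => (if (U ∩ y.2).Nonempty then (1 : ℝ) else 0) *
    (if (W ∩ y.2).Nonempty then 1 else 0)), meanRingDensity, Finset.mul_sum,
    sq, mul_div_assoc]
  nth_rw 1 [hitProb_zero_eq]
  rw [Finset.sum_mul, ← Finset.sum_add_distrib]
  refine Finset.sum_le_sum fun j _ => ?_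
  have h1 := ringAvg_hit_both_le (hK j) U W
  rw [hU, hW] at h1
  change _ ≤ _ + firstEdgeProb K P j * firstEdgeProb K P j at h1
  have h2 : firstEdgeProb K P j ≤ hitProb μ K P (K 0) / c₀ := by
    rw [le_div_iff₀ hc₀, mul_comm]
    exact (mul_le_mul_of_nonneg_right (hc j) (firstEdgeProb_nonneg K P j)).trans
      (mul_firstEdgeProb_le_hitProb hμ j)
  have h3 := mul_le_mul_of_nonneg_left h2 (firstEdgeProb_nonneg K P j)
  calc _ ≤ μ j * (((U ∩ W).card : ℝ) * K j / P +
        firstEdgeProb K P j * (hitProb μ K P (K 0) / c₀)) :=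
        mul_le_mul_of_nonneg_left (h1.trans (by linarith)) (hμ j)
    _ = _ := by ring

theorem bothHitProb_nonneg {μ : Fin (m + 1) → ℝ} (hμ : ∀ i, 0 ≤ μ i) (K : Fin (m + 1) → ℕ)
    (U W : Finset (Fin P)) : 0 ≤ bothHitProb μ K U W :=
  Finset.sum_nonneg fun y _ => mul_nonneg (nodeWeight_nonneg hμ K P y)
    (mul_nonneg (by split_ifs <;> norm_num) (by split_ifs <;> norm_num))

theorem bothHitProb_le_hitProb {μ : Fin (m + 1) → ℝ} (hμ : ∀ i, 0 ≤ μ i) {K : Fin (m + 1) → ℕ}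
    (hK : ∀ i, K i ≤ P) (U W : Finset (Fin P)) :
    bothHitProb μ K U W ≤ hitProb μ K P U.card := by
  rw [← sum_nodeWeight_mul_hit hK]
  refine Finset.sum_le_sum fun y _ => mul_le_mul_of_nonneg_left ?_ (nodeWeight_nonneg hμ K P y)
  split_ifs <;> norm_num

end PairHit

/-! ### Joint law of the neighbourhoods of two nodes. -/

section PairLaw

variable {n m P : ℕ}

/-- The probability that the link between nodes with key rings `U` and `S` is present, if `p`
holds, or absent, if `p` fails. -/
noncomputable def linkFactor (α : ℝ) (p : Prop) [Decidable p] (U S : Finset (Fin P)) : ℝ :=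
  if p then α * (if (U ∩ S).Nonempty then 1 else 0)
    else 1 - α * (if (U ∩ S).Nonempty then 1 else 0)

/-- The four cells of the joint law of two link indicators, determined by their common mean and by
the probability of both; equal ring sizes give the common mean. -/
theorem sum_nodeWeight_linkFactor {μ : Fin (m + 1) → ℝ} (hμ1 : ∑ i, μ i = 1)
    {K : Fin (m + 1) → ℕ} (hK : ∀ i, K i ≤ P) (α : ℝ) (p q : Prop) [Decidable p] [Decidable q]
    {U W : Finset (Fin P)} (hUW : U.card = W.card) :
    ∑ y, nodeWeight μ K P y * (linkFactor α p U y.2 * linkFactor α q W y.2) =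
      if p then (if q then α ^ 2 * bothHitProb μ K U W
          else α * hitProb μ K P U.card - α ^ 2 * bothHitProb μ K U W)
        else (if q then α * hitProb μ K P U.card - α ^ 2 * bothHitProb μ K U W
          else 1 - 2 * (α * hitProb μ K P U.card) + α ^ 2 * bothHitProb μ K U W) := by
  have hν1 := sum_nodeWeight hμ1 hK
  have hU := sum_nodeWeight_mul_hit (μ := μ) hK U
  have hW := sum_nodeWeight_mul_hit (μ := μ) hK W
  rw [← hUW] at hW
  unfold linkFactor bothHitProb
  by_cases hp : p <;> by_cases hq : q <;> simp only [hp, hq, if_true, if_false]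
  · rw [Finset.mul_sum]
    exact Finset.sum_congr rfl fun y _ => by ring
  · rw [← hU, Finset.mul_sum, Finset.mul_sum, ← Finset.sum_sub_distrib]
    exact Finset.sum_congr rfl fun y _ => by ring
  · rw [← hW, Finset.mul_sum, Finset.mul_sum, ← Finset.sum_sub_distrib]
    exact Finset.sum_congr rfl fun y _ => by ring
  · have h2 : ∀ b : ℝ, 1 - 2 * (α * hitProb μ K P U.card) + b = (∑ y, nodeWeight μ K P y) -
        α * (∑ y, nodeWeight μ K P y * (if (U ∩ y.2).Nonempty then 1 else 0)) -
        α * (∑ y, nodeWeight μ K P y * (if (W ∩ y.2).Nonempty then 1 else 0)) + b := by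
      intro b
      rw [hU, hW, hν1]; ring
    rw [h2, Finset.mul_sum, Finset.mul_sum, Finset.mul_sum, ← Finset.sum_sub_distrib,
      ← Finset.sum_sub_distrib, ← Finset.sum_add_distrib]
    exact Finset.sum_congr rfl fun y _ => by ring

theorem prod_image_star {R A : Finset (Fin n)} (hA : A ⊆ R) {u : Fin n} (hu : u ∉ R)
    (α : ℝ) (x : Fin n → Fin (m + 1) × Finset (Fin P))
    [DecidablePred (· ∈ (keyGraph x).edgeSet)] :
    (∏ e ∈ A.image (fun w => s(u, w)), α * if e ∈ (keyGraph x).edgeSet then 1 else 0) *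
      ∏ e ∈ (R \ A).image (fun w => s(u, w)),
        (1 - α * if e ∈ (keyGraph x).edgeSet then 1 else 0) =
      ∏ w ∈ R, linkFactor α (w ∈ A) (x u).2 (x w).2 := by
  have hinj : Function.Injective (fun w : Fin n => s(u, w)) := fun a b h => Sym2.congr_right.1 h
  have huR : ∀ w ∈ R, u ≠ w := by rintro w hw rfl; exact hu hw
  rw [Finset.prod_image hinj.injOn, Finset.prod_image hinj.injOn,
    ← Finset.prod_sdiff hA, mul_comm]
  congr 1
  · refine Finset.prod_congr rfl fun w hw => ?_
    rw [Finset.mem_sdiff] at hw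
    simp only [linkFactor, hw.2, if_false, keyGraph_edge_iff (huR w hw.1)]
  · refine Finset.prod_congr rfl fun w hw => ?_
    simp only [linkFactor, hw, if_true, keyGraph_edge_iff (huR w (hA hw))]

/-- Only links to nodes other than `u` and `v` are prescribed. The link between `u` and `v` is left
free, so that given the two states the event is a product over the remaining nodes. -/
theorem modelLaw_real_pair_neighbors {μ : Fin (m + 1) → ℝ} (hμ : ∀ i, 0 ≤ μ i)
    (hμ1 : ∑ i, μ i = 1) {K : Fin (m + 1) → ℕ} (hK : ∀ i, K i ≤ P) (α : unitInterval)
    (j : Fin (m + 1)) {u v : Fin n} (huv : u ≠ v) {A B : Finset (Fin n)}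
    (hA : A ⊆ {u, v}ᶜ) (hB : B ⊆ {u, v}ᶜ) :
    (modelLaw n μ K P α).real {ω | ((ω.1 u).1 = j ∧ (ω.1 v).1 = j) ∧
      ∀ w ∈ ({u, v}ᶜ : Finset (Fin n)), (w ∈ A ↔ (intersectionGraph ω).Adj u w) ∧
        (w ∈ B ↔ (intersectionGraph ω).Adj v w)} =
    expect (nodeWeight μ K P) (fun x => (if (x u).1 = j ∧ (x v).1 = j then 1 else 0) *
      ∏ w ∈ ({u, v}ᶜ : Finset (Fin n)), ∑ y, nodeWeight μ K P y *
        (linkFactor (α : ℝ) (w ∈ A) (x u).2 y.2 * linkFactor (α : ℝ) (w ∈ B) (x v).2 y.2)) := by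
  classical
  have hν1 := sum_nodeWeight hμ1 hK
  set R : Finset (Fin n) := {u, v}ᶜ with hR
  have huR : u ∉ R := by simp [hR]
  have hvR : v ∉ R := by simp [hR]
  have hstar : ∀ {C D : Finset (Fin n)}, C ⊆ R → D ⊆ R →
      Disjoint (C.image (fun w => s(u, w))) (D.image (fun w => s(v, w))) := by
    intro C D hC hD
    rw [Finset.disjoint_left]
    intro e he he'
    obtain ⟨w, hw, rfl⟩ := Finset.mem_image.1 he
    obtain ⟨w', hw', h⟩ := Finset.mem_image.1 he'
    rcases Sym2.eq_iff.1 h with ⟨h1, -⟩ | ⟨h1, -⟩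
    · exact huv h1.symm
    · exact hvR (h1 ▸ hC hw)
  have hself : ∀ (z : Fin n) {C D : Finset (Fin n)}, Disjoint C D →
      Disjoint (C.image (fun w => s(z, w))) (D.image (fun w => s(z, w))) := by
    intro z C D hCD
    exact (Finset.disjoint_image fun a b h => Sym2.congr_right.1 h).2 hCD
  have hdiag : ∀ {z : Fin n} {C : Finset (Fin n)}, z ∉ R → C ⊆ R →
      ∀ e ∈ C.image (fun w => s(z, w)), ¬ e.IsDiag := by
    intro z C hz hC e he
    obtain ⟨w, hw, rfl⟩ := Finset.mem_image.1 he
    rw [Sym2.mk_isDiag_iff]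
    rintro rfl
    exact hz (hC hw)
  have hset : {ω : (Fin n → Fin (m + 1) × Finset (Fin P)) × SimpleGraph (Fin n) |
      ((ω.1 u).1 = j ∧ (ω.1 v).1 = j) ∧
      ∀ w ∈ R, (w ∈ A ↔ (intersectionGraph ω).Adj u w) ∧
        (w ∈ B ↔ (intersectionGraph ω).Adj v w)} =
      {ω | ((ω.1 u).1 = j ∧ (ω.1 v).1 = j) ∧
        (∀ e ∈ A.image (fun w => s(u, w)) ∪ B.image (fun w => s(v, w)),
          e ∈ (intersectionGraph ω).edgeSet) ∧
        ∀ e ∈ (R \ A).image (fun w => s(u, w)) ∪ (R \ B).image (fun w => s(v, w)),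
          e ∉ (intersectionGraph ω).edgeSet} := by
    ext ω
    simp only [Set.mem_ofPred_eq, Finset.mem_union, or_imp, forall_and, Finset.mem_image,
      forall_exists_index, and_imp, forall_apply_eq_imp_iff₂, SimpleGraph.mem_edgeSet]
    refine and_congr_right fun _ => ⟨fun h => ⟨⟨fun w hw => (h.1 w (hA hw)).1 hw,
      fun w hw => (h.2 w (hB hw)).1 hw⟩, fun w hw hadj => ?_, fun w hw hadj => ?_⟩,
      fun h => ⟨fun w hw => ⟨h.1.1 w, fun hadj => ?_⟩, fun w hw => ⟨h.1.2 w, fun hadj => ?_⟩⟩⟩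
    · exact (Finset.mem_sdiff.1 hw).2 ((h.1 w (Finset.mem_sdiff.1 hw).1).2 hadj)
    · exact (Finset.mem_sdiff.1 hw).2 ((h.2 w (Finset.mem_sdiff.1 hw).1).2 hadj)
    · by_contra hw'
      exact h.2.1 w (Finset.mem_sdiff.2 ⟨hw, hw'⟩) hadj
    · by_contra hw'
      exact h.2.2 w (Finset.mem_sdiff.2 ⟨hw, hw'⟩) hadj
  rw [hset, modelLaw_real_cylinder hμ hμ1 hK α (fun x => (x u).1 = j ∧ (x v).1 = j)]
  rotate_left
  · rw [Finset.disjoint_union_left, Finset.disjoint_union_right, Finset.disjoint_union_right]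
    exact ⟨⟨hself u Finset.disjoint_sdiff, hstar hA Finset.sdiff_subset⟩,
      (hstar Finset.sdiff_subset hB).symm, hself v Finset.disjoint_sdiff⟩
  · intro e he
    rcases Finset.mem_union.1 he with h | h
    exacts [hdiag huR hA e h, hdiag hvR hB e h]
  · intro e he
    rcases Finset.mem_union.1 he with h | h
    exacts [hdiag huR Finset.sdiff_subset e h, hdiag hvR Finset.sdiff_subset e h]
  have hprod : ∀ x : Fin n → Fin (m + 1) × Finset (Fin P),
      (if (x u).1 = j ∧ (x v).1 = j then (1 : ℝ) else 0) *
      (∏ e ∈ A.image (fun w => s(u, w)) ∪ B.image (fun w => s(v, w)),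
        (α : ℝ) * if e ∈ (keyGraph x).edgeSet then 1 else 0) *
      ∏ e ∈ (R \ A).image (fun w => s(u, w)) ∪ (R \ B).image (fun w => s(v, w)),
        (1 - (α : ℝ) * if e ∈ (keyGraph x).edgeSet then 1 else 0) =
      (if (x u).1 = j ∧ (x v).1 = j then (1 : ℝ) else 0) *
        ∏ w ∈ R, (linkFactor (α : ℝ) (w ∈ A) (x u).2 (x w).2 *
          linkFactor (α : ℝ) (w ∈ B) (x v).2 (x w).2) := by
    intro x
    rw [Finset.prod_union (hstar hA hB), Finset.prod_union (hstar Finset.sdiff_subset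
      Finset.sdiff_subset), Finset.prod_mul_distrib (s := R), ← prod_image_star hA huR,
      ← prod_image_star hB hvR]
    ring
  refine Eq.trans (expect_congr (G := fun x =>
      (if (x u).1 = j ∧ (x v).1 = j then (1 : ℝ) else 0) *
        ∏ w ∈ R, (linkFactor (α : ℝ) (w ∈ A) (x u).2 (x w).2 *
          linkFactor (α : ℝ) (w ∈ B) (x v).2 (x w).2)) fun x _ => by convert hprod x) ?_
  have huc : u ∈ ((R : Set (Fin n))ᶜ) := by
    rw [Set.mem_compl_iff, Finset.mem_coe]; exact huR
  have hvc : v ∈ ((R : Set (Fin n))ᶜ) := by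
    rw [Set.mem_compl_iff, Finset.mem_coe]; exact hvR
  exact expect_mul_prod hν1 R (fun x => if (x u).1 = j ∧ (x v).1 = j then (1 : ℝ) else 0)
    (by intro x y hxy; simp only [hxy u huc, hxy v hvc])
    (fun w y x => linkFactor (α : ℝ) (w ∈ A) (x u).2 y.2 *
      linkFactor (α : ℝ) (w ∈ B) (x v).2 y.2)
    (by intro w y x x' hxy; simp only [hxy u huc, hxy v hvc])

end PairLaw

end RandomKeyGraph

namespace RandomKeyGraph

open MeasureTheory ProbabilityTheory

/-! ### Joint degrees of two nodes of class 0. -/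

section PairDegree

variable {n m P : ℕ}

/-- For fixed `A` the sum over `B` is a moment generating function of a hypergeometric variable, so
`ringAvg_pow_inter_le` applies with the `n` nodes in the role of the keys. -/
theorem sum_pow_card_inter_le {a : ℕ} (hn : 0 < n) (ha : a ≤ n) (R : Finset (Fin n)) {t : ℝ}
    (ht : 1 ≤ t) :
    ∑ A ∈ R.powersetCard a, ∑ B ∈ R.powersetCard a, t ^ (A ∩ B).card ≤
      (n.choose a : ℝ) ^ 2 * Real.exp ((t - 1) * ((a : ℝ) ^ 2 / n)) := by
  have hnr : (0 : ℝ) < n := by exact_mod_cast hn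
  have hch : (0 : ℝ) < n.choose a := by exact_mod_cast Nat.choose_pos ha
  have hsub : R.powersetCard a ⊆ (Finset.univ : Finset (Fin n)).powersetCard a :=
    Finset.powersetCard_mono (Finset.subset_univ _)
  have hinner : ∀ A ∈ R.powersetCard a, ∑ B ∈ R.powersetCard a, t ^ (A ∩ B).card ≤
      n.choose a * Real.exp ((t - 1) * ((a : ℝ) ^ 2 / n)) := by
    intro A hA
    have hAc : A.card = a := (Finset.mem_powersetCard.1 hA).2
    have h1 := ringAvg_pow_inter_le ha A ht
    rw [ringAvg, div_le_iff₀ hch, hAc] at h1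
    have h2 : (1 + (t - 1) * ((a : ℝ) / n)) ^ a ≤ Real.exp ((t - 1) * ((a : ℝ) ^ 2 / n)) := by
      have h3 : 1 + (t - 1) * ((a : ℝ) / n) ≤ Real.exp ((t - 1) * ((a : ℝ) / n)) := by
        linarith [Real.add_one_le_exp ((t - 1) * ((a : ℝ) / n))]
      have h4 : 0 ≤ (t - 1) * ((a : ℝ) / n) := mul_nonneg (by linarith) (by positivity)
      refine (pow_le_pow_left₀ (by linarith) h3 a).trans ?_
      rw [← Real.exp_nat_mul]
      refine le_of_eq ?_
      congr 1
      ring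
    calc ∑ B ∈ R.powersetCard a, t ^ (A ∩ B).card
        ≤ ∑ B ∈ (Finset.univ : Finset (Fin n)).powersetCard a, t ^ (A ∩ B).card :=
          Finset.sum_le_sum_of_subset_of_nonneg hsub fun _ _ _ => by positivity
      _ ≤ (1 + (t - 1) * ((a : ℝ) / n)) ^ a * n.choose a := h1
      _ ≤ _ := by rw [mul_comm]; gcongr
  refine (Finset.sum_le_sum hinner).trans ?_
  rw [Finset.sum_const, nsmul_eq_mul, sq (n.choose a : ℝ), mul_assoc]
  have : (R.powersetCard a).card ≤ n.choose a := by
    have := Finset.card_le_card hsub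
    rwa [Finset.card_powersetCard _ Finset.univ, Finset.card_univ, Fintype.card_fin] at this
  gcongr

/-- Each node of `A ∩ B` costs `β ≤ t * s ^ 2` and each node of exactly one of the sets at most `s`.
Each node of neither costs `(1 - s) ^ 2 + (β - s ^ 2)`, which exceeds the independent value by at
most `(t - 1) * s ^ 2`. -/
theorem prod_pair_le {R A B : Finset (Fin n)} {a : ℕ} (hA : A ∈ R.powersetCard a)
    (hB : B ∈ R.powersetCard a) {s β t : ℝ} (hs0 : 0 ≤ s) (hs1 : s < 1)
    (hβ0 : 0 ≤ β) (hβs : β ≤ s) (ht : 1 ≤ t) (hβt : β ≤ t * s ^ 2) (hτ : 0 ≤ 1 - 2 * s + β) :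
    ∏ w ∈ R, (if w ∈ A then (if w ∈ B then β else s - β)
      else (if w ∈ B then s - β else 1 - 2 * s + β)) ≤
      s ^ (2 * a) * t ^ (A ∩ B).card *
        ((1 - s) ^ 2 * Real.exp ((t - 1) * (s ^ 2 / (1 - s) ^ 2))) ^ (R.card - 2 * a) := by
  rw [Finset.mem_powersetCard] at hA hB
  set τ := 1 - 2 * s + β with hτdef
  have hτ1 : τ ≤ 1 := by linarith
  have hτe : τ ≤ (1 - s) ^ 2 * Real.exp ((t - 1) * (s ^ 2 / (1 - s) ^ 2)) := by
    have h1 : 0 < (1 - s) ^ 2 := pow_pos (by linarith) 2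
    have h2 := Real.add_one_le_exp ((t - 1) * (s ^ 2 / (1 - s) ^ 2))
    calc τ ≤ (1 - s) ^ 2 * ((t - 1) * (s ^ 2 / (1 - s) ^ 2) + 1) := by
          have : (1 - s) ^ 2 * ((t - 1) * (s ^ 2 / (1 - s) ^ 2) + 1) =
            (t - 1) * s ^ 2 + (1 - s) ^ 2 := by
            rw [mul_add, mul_left_comm, mul_div_cancel₀ _ h1.ne', mul_one]
          rw [this]; nlinarith
      _ ≤ _ := mul_le_mul_of_nonneg_left h2 h1.le
  have hcard : R.card - 2 * a ≤ (R ∩ (R \ (A ∪ B))).card := by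
    have h1 : R ∩ (R \ (A ∪ B)) = R \ (A ∪ B) := Finset.inter_eq_right.2 Finset.sdiff_subset
    have h2 := Finset.le_card_sdiff (A ∪ B) R
    have h3 := Finset.card_union_le A B
    rw [h1]; omega
  calc _ ≤ ∏ w ∈ R, ((if w ∈ A then s else 1) * (if w ∈ B then s else 1) *
        (if w ∈ A ∩ B then t else 1) * (if w ∈ R \ (A ∪ B) then τ else 1)) := by
        refine Finset.prod_le_prod (fun w _ => ?_) fun w hw => ?_
        · split_ifs <;> linarith
        · by_cases h1 : w ∈ A <;> by_cases h2 : w ∈ B <;> simp [h1, h2, hw, hβ0]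
          nlinarith
    _ = s ^ (2 * a) * t ^ (A ∩ B).card * τ ^ (R ∩ (R \ (A ∪ B))).card := by
        rw [Finset.prod_mul_distrib, Finset.prod_mul_distrib, Finset.prod_mul_distrib,
          Finset.prod_ite_mem, Finset.prod_ite_mem, Finset.prod_ite_mem, Finset.prod_ite_mem,
          Finset.prod_const, Finset.prod_const, Finset.prod_const, Finset.prod_const,
          Finset.inter_eq_right.2 hA.1, Finset.inter_eq_right.2 hB.1, hA.2, hB.2,
          Finset.inter_eq_right.2 (Finset.inter_subset_left.trans hA.1)]
        ring
    _ ≤ s ^ (2 * a) * t ^ (A ∩ B).card * τ ^ (R.card - 2 * a) := by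
        have := pow_le_pow_of_le_one hτ hτ1 hcard
        gcongr
    _ ≤ _ := by gcongr

theorem expect_pair {V Ω : Type*} [Fintype V] [DecidableEq V] [Fintype Ω] {ν : Ω → ℝ}
    (hν1 : ∑ y, ν y = 1) {u v : V} (huv : u ≠ v) (f : Ω → Ω → ℝ) :
    expect ν (fun x => f (x u) (x v)) = ∑ y, ν y * ∑ z, ν z * f y z := by
  rw [expect_resample hν1 u]
  simp only [Function.update_self, Function.update_of_ne huv.symm]
  rw [expect_resample hν1 v]
  simp only [Function.update_self]
  rw [expect_const hν1]
  simp only [Finset.mul_sum]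
  rw [Finset.sum_comm]
  exact Finset.sum_congr rfl fun y _ => Finset.sum_congr rfl fun z _ => by ring

theorem expect_pair_pow_inter_le {μ : Fin (m + 1) → ℝ} (hμ1 : ∑ i, μ i = 1)
    {K : Fin (m + 1) → ℕ} (hK : ∀ i, K i ≤ P) (j : Fin (m + 1))
    {u v : Fin n} (huv : u ≠ v) {c : ℝ} (hc : 1 ≤ c) :
    expect (nodeWeight μ K P) (fun x => (if (x u).1 = j ∧ (x v).1 = j then 1 else 0) *
      c ^ ((x u).2 ∩ (x v).2).card) ≤
      μ j ^ 2 * Real.exp ((c - 1) * ((K j : ℝ) * K j / P)) := by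
  rw [expect_pair (sum_nodeWeight hμ1 hK) huv
      (fun y z => (if y.1 = j ∧ z.1 = j then (1 : ℝ) else 0) *
      c ^ (y.2 ∩ z.2).card)]
  have hone : ∀ g : Fin (m + 1) × Finset (Fin P) → ℝ,
      ∑ y, nodeWeight μ K P y * ((if y.1 = j then 1 else 0) * g y) =
        μ j * ringAvg P (K j) (fun S => g (j, S)) := by
    intro g
    rw [sum_nodeWeight_mul μ K P (fun y => (if y.1 = j then 1 else 0) * g y),
      Finset.sum_eq_single j]
    · simp
    · intro b _ hb
      simp [hb, ringAvg_const (hK b)]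
    · simp
  have hsplit : ∀ y z : Fin (m + 1) × Finset (Fin P),
      (if y.1 = j ∧ z.1 = j then (1 : ℝ) else 0) * c ^ (y.2 ∩ z.2).card =
      (if y.1 = j then 1 else 0) * ((if z.1 = j then 1 else 0) * c ^ (y.2 ∩ z.2).card) := by
    intro y z
    by_cases h1 : y.1 = j <;> by_cases h2 : z.1 = j <;> simp [h1, h2]
  have hswap : ∀ y : Fin (m + 1) × Finset (Fin P), ∑ z, nodeWeight μ K P z *
      ((if y.1 = j ∧ z.1 = j then (1 : ℝ) else 0) * c ^ (y.2 ∩ z.2).card) =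
      (if y.1 = j then 1 else 0) * ∑ z, nodeWeight μ K P z *
        ((if z.1 = j then 1 else 0) * c ^ (y.2 ∩ z.2).card) := by
    intro y
    rw [Finset.mul_sum]
    refine Finset.sum_congr rfl fun z _ => ?_
    rw [hsplit]; ring
  simp only [hswap]
  rw [hone]
  simp only [hone _]
  rw [ringAvg_const_mul, ← mul_assoc, ← sq]
  refine mul_le_mul_of_nonneg_left ?_ (by positivity)
  rw [← ringAvg_const (hK j) (Real.exp _)]
  refine ringAvg_mono fun S hS => ?_
  refine (ringAvg_pow_inter_le (hK j) S hc).trans ?_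
  rw [hS]
  have h3 : 1 + (c - 1) * ((K j : ℝ) / P) ≤ Real.exp ((c - 1) * ((K j : ℝ) / P)) := by
    linarith [Real.add_one_le_exp ((c - 1) * ((K j : ℝ) / P))]
  have h4 : 0 ≤ (c - 1) * ((K j : ℝ) / P) := mul_nonneg (by linarith) (by positivity)
  refine (pow_le_pow_left₀ (by linarith) h3 _).trans (le_of_eq ?_)
  rw [← Real.exp_nat_mul]
  congr 1
  ring

set_option maxHeartbeats 400000 in
-- `Q` bounds the product of the two degree probabilities as if the links were independent. The two
-- corrections are a moment generating function for shared neighbours and a factor for nodes linked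
-- to neither; `Ψ` collects both, for a total of `exp ((t - 1) * Ψ)`. Since `t - 1` is affine in the
-- overlap of the rings, this is geometric in the overlap.
theorem sum_prod_linkFactor_le {μ : Fin (m + 1) → ℝ} (hμ : ∀ i, 0 ≤ μ i)
    (hμ1 : ∑ i, μ i = 1) {K : Fin (m + 1) → ℕ} (hK : ∀ i, K i ≤ P) (α : unitInterval)
    {c₀ : ℝ} (hc₀ : 0 < c₀) (hc : ∀ j, c₀ ≤ μ j) (hlam : 0 < hitProb μ K P (K 0))
    {s : ℝ} (hs : s = (α : ℝ) * hitProb μ K P (K 0)) (hs1 : s < 1)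
    {R : Finset (Fin n)} (hRc : R.card = n - 2) {a : ℕ} (ha : 2 * a + 2 ≤ n) {Ψ : ℝ}
    (hΨ : (a : ℝ) ^ 2 / n + n * (s ^ 2 / (1 - s) ^ 2) ≤ Ψ) {U W : Finset (Fin P)}
    (hU : U.card = K 0) (hW : W.card = K 0) :
    ∑ A ∈ R.powersetCard a, ∑ B ∈ R.powersetCard a, ∏ w ∈ R, ∑ y, nodeWeight μ K P y *
      (linkFactor (α : ℝ) (w ∈ A) U y.2 * linkFactor (α : ℝ) (w ∈ B) W y.2) ≤
    (n.choose a * s ^ a * (1 - s) ^ (n - 2 - 2 * a)) ^ 2 * (Real.exp (Ψ / c₀) *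
      Real.exp (Ψ * (meanRingDensity μ K P / hitProb μ K P (K 0) ^ 2)) ^ (U ∩ W).card) := by
  have hν := nodeWeight_nonneg hμ K P
  have hs0 : 0 ≤ s := by rw [hs]; exact mul_nonneg α.2.1 hlam.le
  have hn : 0 < n := by omega
  have hκ := meanRingDensity_nonneg hμ K P
  set lam := hitProb μ K P (K 0) with hlamdef
  set κ := meanRingDensity μ K P with hκdef
  set Q : ℝ := (n.choose a * s ^ a * (1 - s) ^ (n - 2 - 2 * a)) ^ 2 with hQ
  set M := (U ∩ W).card with hM
  set t : ℝ := 1 + (1 / c₀ + M * (κ / lam ^ 2)) with ht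
  have ht1 : 1 ≤ t := by
    have : 0 ≤ 1 / c₀ + M * (κ / lam ^ 2) := by positivity
    linarith
  set β := (α : ℝ) ^ 2 * bothHitProb μ K U W with hβ
  have hb := bothHitProb_le hμ hK hc₀ hc hU hW
  have hb0 := bothHitProb_nonneg hμ K U W
  have hb1 := bothHitProb_le_hitProb hμ hK U W
  rw [hU] at hb1
  have hβ0 : 0 ≤ β := by positivity
  have hβs : β ≤ s := by
    rw [hβ, hs]
    have hα0 := α.2.1
    have hα1 := α.2.2
    have : (α : ℝ) ^ 2 ≤ α := by nlinarith
    exact mul_le_mul this hb1 hb0 hα0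
  have hβt : β ≤ t * s ^ 2 := by
    rw [hβ, hs, mul_pow, mul_left_comm]
    refine mul_le_mul_of_nonneg_left (hb.trans ?_) (by positivity)
    have : t * lam ^ 2 = lam ^ 2 + (lam ^ 2 / c₀ + M * κ) := by
      rw [ht]; field_simp
    rw [this, ← hM, ← hκdef, ← hlamdef]
    nlinarith [sq_nonneg lam]
  have hτ : 0 ≤ 1 - 2 * s + β := by
    have h1 := sum_nodeWeight_linkFactor hμ1 hK (α : ℝ) False False (hU.trans hW.symm)
    simp only [if_false, hU] at h1
    rw [hβ, hs, ← h1]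
    refine Finset.sum_nonneg fun y _ => mul_nonneg (hν y) (mul_nonneg ?_ ?_) <;>
    · simp only [linkFactor, if_false]
      exact one_sub_mul_ite_nonneg _ _
  have hterm : ∀ A ∈ R.powersetCard a, ∀ B ∈ R.powersetCard a,
      ∏ w ∈ R, ∑ y, nodeWeight μ K P y * (linkFactor (α : ℝ) (w ∈ A) U y.2 *
        linkFactor (α : ℝ) (w ∈ B) W y.2) ≤
      s ^ (2 * a) * ((1 - s) ^ 2 * Real.exp ((t - 1) * (s ^ 2 / (1 - s) ^ 2))) ^
        (n - 2 - 2 * a) * t ^ (A ∩ B).card := by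
    intro A hA B hB
    have h1 := prod_pair_le hA hB hs0 hs1 hβ0 hβs ht1 hβt hτ
    rw [hRc] at h1
    refine le_trans (le_of_eq (Finset.prod_congr rfl fun w _ => ?_)) (h1.trans (le_of_eq (by ring)))
    rw [sum_nodeWeight_linkFactor hμ1 hK (α : ℝ) (w ∈ A) (w ∈ B) (hU.trans hW.symm), hU, hs]
  refine (Finset.sum_le_sum fun A hA => Finset.sum_le_sum fun B hB => hterm A hA B hB).trans ?_
  simp only [← Finset.mul_sum]
  have hsum := sum_pow_card_inter_le hn (by omega : a ≤ n) R ht1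
  have hexp : Real.exp ((t - 1) * (s ^ 2 / (1 - s) ^ 2)) ^ (n - 2 - 2 * a) ≤
      Real.exp ((t - 1) * (n * (s ^ 2 / (1 - s) ^ 2))) := by
    rw [← Real.exp_nat_mul, Real.exp_le_exp]
    have h1 : ((n - 2 - 2 * a : ℕ) : ℝ) ≤ n := by exact_mod_cast (by omega : n - 2 - 2 * a ≤ n)
    have h2 : 0 ≤ (t - 1) * (s ^ 2 / (1 - s) ^ 2) :=
      mul_nonneg (by linarith) (by positivity)
    nlinarith
  rw [mul_pow ((1 - s) ^ 2)]
  have h1s : 0 ≤ 1 - s := by linarith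
  calc _ ≤ s ^ (2 * a) * (((1 - s) ^ 2) ^ (n - 2 - 2 * a) *
          Real.exp ((t - 1) * (n * (s ^ 2 / (1 - s) ^ 2)))) *
          ((n.choose a : ℝ) ^ 2 * Real.exp ((t - 1) * ((a : ℝ) ^ 2 / n))) := by gcongr
    _ = Q * Real.exp ((t - 1) * ((a : ℝ) ^ 2 / n + n * (s ^ 2 / (1 - s) ^ 2))) := by
        rw [mul_add, Real.exp_add, hQ, ← pow_mul (1 - s), mul_pow, mul_pow, ← pow_mul, ← pow_mul,
          mul_comm 2 a, mul_comm 2 (n - 2 - a * 2)]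
        ring
    _ ≤ Q * Real.exp ((t - 1) * Ψ) := by
        have : 0 ≤ t - 1 := by linarith
        gcongr
    _ = _ := by
        rw [← Real.exp_nat_mul, ← Real.exp_add]
        congr 2
        rw [ht]
        ring

/-- The geometric bound given the rings is averaged over the hypergeometric overlap by
`expect_pair_pow_inter_le`, hence the iterated exponential. -/
theorem modelLaw_real_pair_degree_le {μ : Fin (m + 1) → ℝ} (hμ : ∀ i, 0 ≤ μ i)
    (hμ1 : ∑ i, μ i = 1) {K : Fin (m + 1) → ℕ} (hK : ∀ i, K i ≤ P) (α : unitInterval)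
    {c₀ : ℝ} (hc₀ : 0 < c₀) (hc : ∀ j, c₀ ≤ μ j) (hlam : 0 < hitProb μ K P (K 0))
    {s : ℝ} (hs : s = (α : ℝ) * hitProb μ K P (K 0)) (hs1 : s < 1)
    {u v : Fin n} (huv : u ≠ v) {a : ℕ} (ha : 2 * a + 2 ≤ n) {Ψ : ℝ}
    (hΨ : (a : ℝ) ^ 2 / n + n * (s ^ 2 / (1 - s) ^ 2) ≤ Ψ) :
    (modelLaw n μ K P α).real {ω | ((ω.1 u).1 = 0 ∧ (ω.1 v).1 = 0) ∧
      ∃ A ∈ ({u, v}ᶜ : Finset (Fin n)).powersetCard a,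
      ∃ B ∈ ({u, v}ᶜ : Finset (Fin n)).powersetCard a,
      ∀ w ∈ ({u, v}ᶜ : Finset (Fin n)), (w ∈ A ↔ (intersectionGraph ω).Adj u w) ∧
        (w ∈ B ↔ (intersectionGraph ω).Adj v w)} ≤
    (μ 0 * (n.choose a * s ^ a * (1 - s) ^ (n - 2 - 2 * a))) ^ 2 *
      Real.exp (Ψ / c₀ + (Real.exp (Ψ * (meanRingDensity μ K P / hitProb μ K P (K 0) ^ 2)) - 1) *
        ((K 0 : ℝ) * K 0 / P)) := by
  classical
  have := isProbabilityMeasure_modelLaw (n := n) hμ hμ1 hK α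
  have hν := nodeWeight_nonneg hμ K P
  have hs0 : 0 ≤ s := by rw [hs]; exact mul_nonneg α.2.1 hlam.le
  have hn : 0 < n := by omega
  have hnr : (0 : ℝ) < n := by exact_mod_cast hn
  have hκ := meanRingDensity_nonneg hμ K P
  have hΨ0 : 0 ≤ Ψ := le_trans (by positivity) hΨ
  set R : Finset (Fin n) := {u, v}ᶜ with hR
  have hRc : R.card = n - 2 := by
    rw [hR, Finset.card_compl, Fintype.card_fin, Finset.card_pair huv]
  set lam := hitProb μ K P (K 0) with hlamdef
  set κ := meanRingDensity μ K P with hκdef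
  set Q : ℝ := (n.choose a * s ^ a * (1 - s) ^ (n - 2 - 2 * a)) ^ 2 with hQ
  let ev : Finset (Fin n) → Finset (Fin n) →
      Set ((Fin n → Fin (m + 1) × Finset (Fin P)) × SimpleGraph (Fin n)) := fun A B =>
    {ω | ((ω.1 u).1 = 0 ∧ (ω.1 v).1 = 0) ∧ ∀ w ∈ R,
      (w ∈ A ↔ (intersectionGraph ω).Adj u w) ∧ (w ∈ B ↔ (intersectionGraph ω).Adj v w)}
  have hcover : {ω : (Fin n → Fin (m + 1) × Finset (Fin P)) × SimpleGraph (Fin n) |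
      ((ω.1 u).1 = 0 ∧ (ω.1 v).1 = 0) ∧ ∃ A ∈ R.powersetCard a, ∃ B ∈ R.powersetCard a,
      ∀ w ∈ R, (w ∈ A ↔ (intersectionGraph ω).Adj u w) ∧
        (w ∈ B ↔ (intersectionGraph ω).Adj v w)} ⊆
      ⋃ A ∈ R.powersetCard a, ⋃ B ∈ R.powersetCard a, ev A B := by
    rintro ω ⟨h1, A, hA, B, hB, h2⟩
    simp only [Set.mem_iUnion]
    exact ⟨A, hA, B, hB, h1, h2⟩
  have hpoint : ∀ x : Fin n → Fin (m + 1) × Finset (Fin P),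
      (∀ w, nodeWeight μ K P (x w) ≠ 0) → (x u).1 = 0 → (x v).1 = 0 →
      ∑ A ∈ R.powersetCard a, ∑ B ∈ R.powersetCard a, ∏ w ∈ R, ∑ y, nodeWeight μ K P y *
        (linkFactor (α : ℝ) (w ∈ A) (x u).2 y.2 * linkFactor (α : ℝ) (w ∈ B) (x v).2 y.2) ≤
      Q * (Real.exp (Ψ / c₀) * Real.exp (Ψ * (κ / lam ^ 2)) ^ ((x u).2 ∩ (x v).2).card) := by
    intro x hx hu hv
    exact sum_prod_linkFactor_le hμ hμ1 hK α hc₀ hc hlam hs hs1 hRc ha hΨ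
      (by rw [card_of_nodeWeight_ne_zero (hx u), hu])
      (by rw [card_of_nodeWeight_ne_zero (hx v), hv])
  calc _ ≤ (modelLaw n μ K P α).real (⋃ A ∈ R.powersetCard a, ⋃ B ∈ R.powersetCard a, ev A B) :=
        measureReal_mono hcover (measure_ne_top _ _)
    _ ≤ ∑ A ∈ R.powersetCard a, ∑ B ∈ R.powersetCard a, (modelLaw n μ K P α).real (ev A B) :=
        (measureReal_biUnion_finset_le _ _).trans
          (Finset.sum_le_sum fun A _ => measureReal_biUnion_finset_le _ _)
    _ = expect (nodeWeight μ K P) (fun x => (if (x u).1 = 0 ∧ (x v).1 = 0 then 1 else 0) *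
          ∑ A ∈ R.powersetCard a, ∑ B ∈ R.powersetCard a, ∏ w ∈ R, ∑ y, nodeWeight μ K P y *
          (linkFactor (α : ℝ) (w ∈ A) (x u).2 y.2 * linkFactor (α : ℝ) (w ∈ B) (x v).2 y.2)) := by
        simp only [Finset.mul_sum (s := R.powersetCard a)]
        rw [expect_sum]
        refine Finset.sum_congr rfl fun A hA => ?_
        rw [expect_sum]
        refine Finset.sum_congr rfl fun B hB => ?_
        exact modelLaw_real_pair_neighbors hμ hμ1 hK α 0 huv (Finset.mem_powersetCard.1 hA).1
          (Finset.mem_powersetCard.1 hB).1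
    _ ≤ expect (nodeWeight μ K P) (fun x => Q * Real.exp (Ψ / c₀) *
          ((if (x u).1 = 0 ∧ (x v).1 = 0 then 1 else 0) *
            Real.exp (Ψ * (κ / lam ^ 2)) ^ ((x u).2 ∩ (x v).2).card)) := by
        refine expect_mono hν fun x hx => ?_
        by_cases h : (x u).1 = 0 ∧ (x v).1 = 0
        · rw [if_pos h, one_mul, one_mul, mul_assoc]
          exact hpoint x hx h.1 h.2
        · simp [h]
    _ ≤ Q * Real.exp (Ψ / c₀) * (μ 0 ^ 2 *
          Real.exp ((Real.exp (Ψ * (κ / lam ^ 2)) - 1) * ((K 0 : ℝ) * K 0 / P))) := by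
        rw [expect_const_mul]
        refine mul_le_mul_of_nonneg_left ?_ (by positivity)
        exact expect_pair_pow_inter_le hμ1 hK 0 huv (Real.one_le_exp (by positivity))
    _ = _ := by
        rw [Real.exp_add, hQ, mul_pow (μ 0)]
        ring

end PairDegree

end RandomKeyGraph

namespace RandomKeyGraph

open MeasureTheory ProbabilityTheory

/-! ### The second moment inequality. -/

section SecondMoment

/-- Chebyshev: let `Z` count the events that occur and `M = n * q` be its mean. On `Z = 0` the
variable `(1 - Z / M) ^ 2` equals 1, and its expectation is the bound after expanding the square. -/
theorem measureReal_forall_notMem_le {Ω : Type*} [MeasurableSpace Ω] [Finite Ω]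
    [DiscreteMeasurableSpace Ω] (ρ : Measure Ω) [IsProbabilityMeasure ρ] {n : ℕ} (hn : 0 < n)
    (A : Fin n → Set Ω) {q p : ℝ} (hq : 0 < q) (hp : 0 ≤ p) (hA : ∀ u, ρ.real (A u) = q)
    (hpair : ∀ u v, u ≠ v → ρ.real (A u ∩ A v) ≤ p) :
    ρ.real {ω | ∀ u, ω ∉ A u} ≤ 1 / (n * q) + p / q ^ 2 - 1 := by
  classical
  have hnr : (0 : ℝ) < n := by exact_mod_cast hn
  set M : ℝ := n * q with hM
  have hM0 : 0 < M := by positivity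
  let I : Fin n → Ω → ℝ := fun u => (A u).indicator 1
  have hI : ∀ u, ∫ ω, I u ω ∂ρ = q := fun u => by
    rw [integral_indicator_one MeasurableSet.of_discrete, hA]
  have hII : ∀ u v, ∫ ω, I u ω * I v ω ∂ρ = ρ.real (A u ∩ A v) := fun u v => by
    rw [← integral_indicator_one MeasurableSet.of_discrete]
    congr 1
    ext ω
    simp only [I, Set.indicator_apply, Set.mem_inter_iff, Pi.one_apply]
    by_cases h1 : ω ∈ A u <;> by_cases h2 : ω ∈ A v <;> simp [h1, h2]
  let Z : Ω → ℝ := fun ω => ∑ u, I u ω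
  have hZ : ∫ ω, Z ω ∂ρ = M := by
    rw [integral_finsetSum _ fun u _ => Integrable.of_finite]
    simp [hI, hM]
  have hZZ : ∫ ω, Z ω ^ 2 ∂ρ ≤ n * q + n ^ 2 * p := by
    have h1 : ∫ ω, Z ω ^ 2 ∂ρ = ∑ u, ∑ v, ρ.real (A u ∩ A v) := by
      simp only [Z, sq, Finset.sum_mul_sum]
      rw [integral_finsetSum _ fun u _ => Integrable.of_finite]
      refine Finset.sum_congr rfl fun u _ => ?_
      rw [integral_finsetSum _ fun v _ => Integrable.of_finite]
      exact Finset.sum_congr rfl fun v _ => hII u v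
    rw [h1]
    calc ∑ u, ∑ v, ρ.real (A u ∩ A v)
        ≤ ∑ u : Fin n, ∑ v : Fin n, ((if u = v then q else 0) + p) := by
          refine Finset.sum_le_sum fun u _ => Finset.sum_le_sum fun v _ => ?_
          by_cases h : u = v
          · subst h
            simp [hA, hp]
          · simpa [h] using hpair u v h
      _ = n * q + n ^ 2 * p := by
          simp [Finset.sum_add_distrib]
          ring
  have hle : ρ.real {ω | ∀ u, ω ∉ A u} ≤ ∫ ω, (1 - Z ω / M) ^ 2 ∂ρ := by
    rw [← integral_indicator_one MeasurableSet.of_discrete]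
    refine integral_mono Integrable.of_finite Integrable.of_finite fun ω => ?_
    simp only [Set.indicator_apply, Set.mem_ofPred_eq, Pi.one_apply]
    split_ifs with h
    · have : Z ω = 0 := Finset.sum_eq_zero fun u _ => by simp [I, h u]
      simp [this]
    · positivity
  refine hle.trans ?_
  have hexp : ∫ ω, (1 - Z ω / M) ^ 2 ∂ρ =
      1 - 2 / M * ∫ ω, Z ω ∂ρ + 1 / M ^ 2 * ∫ ω, Z ω ^ 2 ∂ρ := by
    have : ∀ ω, (1 - Z ω / M) ^ 2 = 1 - 2 / M * Z ω + 1 / M ^ 2 * Z ω ^ 2 := fun ω => by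
      field_simp; ring
    simp only [this]
    rw [integral_add Integrable.of_finite Integrable.of_finite,
      integral_sub Integrable.of_finite Integrable.of_finite, integral_const_mul,
      integral_const_mul]
    simp
  rw [hexp, hZ]
  have h2 := mul_le_mul_of_nonneg_left hZZ (by positivity : 0 ≤ 1 / M ^ 2)
  have h3 : 1 - 2 / M * M + 1 / M ^ 2 * (n * q + n ^ 2 * p) = 1 / M + p / q ^ 2 - 1 := by
    rw [hM]; field_simp; ring
  linarith

end SecondMoment

/-! ### Second moment of the number of nodes of a given small degree. -/

section LowDegree

variable {n m P : ℕ}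

/-- The event that the node `u` has class `0` and exactly `d` neighbours. -/
def hasDegree (d : ℕ) (u : Fin n) :
    Set ((Fin n → Fin (m + 1) × Finset (Fin P)) × SimpleGraph (Fin n)) :=
  {ω | (ω.1 u).1 = 0 ∧ ∃ S : Finset (Fin n), S.card = d ∧
    ∀ w, w ∈ S ↔ (intersectionGraph ω).Adj u w}

theorem modelLaw_real_hasDegree {μ : Fin (m + 1) → ℝ} (hμ : ∀ i, 0 ≤ μ i)
    (hμ1 : ∑ i, μ i = 1) {K : Fin (m + 1) → ℕ} (hK : ∀ i, K i ≤ P) (α : unitInterval) (d : ℕ)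
    (u : Fin n) :
    (modelLaw n μ K P α).real (hasDegree d u) =
      μ 0 * ((n - 1).choose d * (α * hitProb μ K P (K 0)) ^ d *
        (1 - α * hitProb μ K P (K 0)) ^ (n - 1 - d)) := by
  classical
  have := isProbabilityMeasure_modelLaw (n := n) hμ hμ1 hK α
  let ev : Finset (Fin n) → Set ((Fin n → Fin (m + 1) × Finset (Fin P)) × SimpleGraph (Fin n)) :=
    fun S => {ω | (ω.1 u).1 = 0 ∧ ∀ w, w ∈ S ↔ (intersectionGraph ω).Adj u w}
  have hset : (hasDegree d u : Set ((Fin n → Fin (m + 1) × Finset (Fin P)) × SimpleGraph (Fin n))) =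
      ⋃ S ∈ ({u}ᶜ : Finset (Fin n)).powersetCard d, ev S := by
    ext ω
    simp only [hasDegree, ev, Set.mem_ofPred_eq, Set.mem_iUnion, Finset.mem_powersetCard]
    constructor
    · rintro ⟨h0, S, hS, hadj⟩
      refine ⟨S, ⟨fun w hw => ?_, hS⟩, h0, hadj⟩
      rw [Finset.mem_compl, Finset.mem_singleton]
      rintro rfl
      exact (intersectionGraph ω).irrefl ((hadj w).1 hw)
    · rintro ⟨S, ⟨-, hS⟩, h0, hadj⟩
      exact ⟨h0, S, hS, hadj⟩
  rw [hset, measureReal_biUnion_finset]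
  · rw [Finset.sum_congr rfl (g := fun _ => μ 0 * ((α * hitProb μ K P (K 0)) ^ d *
        (1 - α * hitProb μ K P (K 0)) ^ (n - 1 - d)))]
    · rw [Finset.sum_const, Finset.card_powersetCard, Finset.card_compl, Fintype.card_fin,
        Finset.card_singleton, nsmul_eq_mul]
      ring
    · intro S hS
      rw [Finset.mem_powersetCard] at hS
      have huS : u ∉ S := fun h => by simpa using hS.1 h
      rw [modelLaw_real_class_neighbors hμ hμ1 hK α 0 u huS, hS.2]
  · intro S _ S' _ hne
    rw [Function.onFun, Set.disjoint_left]
    rintro ω ⟨-, h1⟩ ⟨-, h2⟩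
    exact hne (Finset.ext fun w => (h1 w).trans (h2 w).symm)
  · exact fun S _ => MeasurableSet.of_discrete

theorem probKConnected_le_hasDegree {μ : Fin (m + 1) → ℝ} (hμ : ∀ i, 0 ≤ μ i)
    (hμ1 : ∑ i, μ i = 1) {K : Fin (m + 1) → ℕ} (hK : ∀ i, K i ≤ P) (α : unitInterval) {d k : ℕ}
    (hd : d < k) :
    probKConnected k n μ K P α ≤ (modelLaw n μ K P α).real {ω | ∀ u, ω ∉ hasDegree d u} := by
  have := isProbabilityMeasure_modelLaw (n := n) hμ hμ1 hK α
  refine measureReal_mono (fun ω hω u hu => ?_) (measure_ne_top _ _)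
  obtain ⟨-, S, hS, hadj⟩ := hu
  exact not_isKConnected_of_card_neighbors_lt hadj (hS ▸ hd) hω

/-- The event that `u` and `v` have class `0` and exactly `a` neighbours each outside `{u, v}`. -/
def pairDegree (a : ℕ) (u v : Fin n) :
    Set ((Fin n → Fin (m + 1) × Finset (Fin P)) × SimpleGraph (Fin n)) :=
  {ω | ((ω.1 u).1 = 0 ∧ (ω.1 v).1 = 0) ∧
      ∃ A ∈ ({u, v}ᶜ : Finset (Fin n)).powersetCard a,
      ∃ B ∈ ({u, v}ᶜ : Finset (Fin n)).powersetCard a,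
      ∀ w ∈ ({u, v}ᶜ : Finset (Fin n)), (w ∈ A ↔ (intersectionGraph ω).Adj u w) ∧
        (w ∈ B ↔ (intersectionGraph ω).Adj v w)}

/-- Whether or not `u` and `v` are adjacent decides if they have `d - 1` or `d` neighbours
elsewhere. -/
theorem hasDegree_inter_subset {d : ℕ} {u v : Fin n} :
    (hasDegree d u ∩ hasDegree d v :
      Set ((Fin n → Fin (m + 1) × Finset (Fin P)) × SimpleGraph (Fin n))) ⊆
      pairDegree d u v ∪ (if d = 0 then ∅ else pairDegree (d - 1) u v) := by
  classical
  rintro ω ⟨⟨hu0, S, hS, hu⟩, hv0, T, hT, hv⟩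
  set H := intersectionGraph ω with hH
  have huS : u ∉ S := fun h => H.irrefl ((hu u).1 h)
  have hvT : v ∉ T := fun h => H.irrefl ((hv v).1 h)
  by_cases hadj : H.Adj u v
  · have hvS : v ∈ S := (hu v).2 hadj
    have huT : u ∈ T := (hv u).2 hadj.symm
    have hd : d ≠ 0 := by
      rw [← hS]; exact Finset.card_ne_zero_of_mem hvS
    right
    rw [if_neg hd]
    refine ⟨⟨hu0, hv0⟩, S.erase v, ?_, T.erase u, ?_, fun w hw => ?_⟩
    · rw [Finset.mem_powersetCard, Finset.card_erase_of_mem hvS, hS]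
      refine ⟨fun w hw => ?_, rfl⟩
      rw [Finset.mem_erase] at hw
      simp only [Finset.mem_compl, Finset.mem_insert, Finset.mem_singleton, not_or]
      exact ⟨fun h => huS (h ▸ hw.2), hw.1⟩
    · rw [Finset.mem_powersetCard, Finset.card_erase_of_mem huT, hT]
      refine ⟨fun w hw => ?_, rfl⟩
      rw [Finset.mem_erase] at hw
      simp only [Finset.mem_compl, Finset.mem_insert, Finset.mem_singleton, not_or]
      exact ⟨hw.1, fun h => hvT (h ▸ hw.2)⟩
    · simp only [Finset.mem_compl, Finset.mem_insert, Finset.mem_singleton, not_or] at hw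
      rw [Finset.mem_erase, Finset.mem_erase, hu, hv]
      tauto
  · left
    have hvS : v ∉ S := fun h => hadj ((hu v).1 h)
    have huT : u ∉ T := fun h => hadj ((hv u).1 h).symm
    refine ⟨⟨hu0, hv0⟩, S, ?_, T, ?_, fun w _ => ⟨hu w, hv w⟩⟩
    · rw [Finset.mem_powersetCard]
      refine ⟨fun w hw => ?_, hS⟩
      simp only [Finset.mem_compl, Finset.mem_insert, Finset.mem_singleton, not_or]
      exact ⟨fun h => huS (h ▸ hw), fun h => hvS (h ▸ hw)⟩
    · rw [Finset.mem_powersetCard]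
      refine ⟨fun w hw => ?_, hT⟩
      simp only [Finset.mem_compl, Finset.mem_insert, Finset.mem_singleton, not_or]
      exact ⟨fun h => huT (h ▸ hw), fun h => hvT (h ▸ hw)⟩

/-- Compares the count in the pair bound with the degree probability of one node. Choosing among `n`
rather than `n - 1` nodes, and having `d + 1` factors `1 - s` fewer, costs a factor tending to 1. -/
theorem choose_mul_pow_le_of_lt {d k : ℕ} {s : ℝ} (hd : d < k) (hkn : 2 * k + 2 ≤ n) (hs0 : 0 ≤ s)
    (hs1 : s < 1) :
    (n.choose d : ℝ) * s ^ d * (1 - s) ^ (n - 2 - 2 * d) ≤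
      (n / (n - k) * ((1 - s) ^ k)⁻¹) * ((n - 1).choose d * s ^ d * (1 - s) ^ (n - 1 - d)) := by
  have h1s : 0 < 1 - s := by linarith
  have hnk : (0 : ℝ) < (n : ℝ) - k := by
    have : ((2 * k + 2 : ℕ) : ℝ) ≤ n := by exact_mod_cast hkn
    push_cast at this
    linarith [(k.cast_nonneg : (0 : ℝ) ≤ k)]
  have hc : (n.choose d : ℝ) ≤ n / (n - k) * (n - 1).choose d := by
    have h1 := Nat.choose_mul_succ_eq (n - 1) d
    rw [Nat.sub_add_cancel (by omega : 1 ≤ n)] at h1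
    have h2 : ((n - 1).choose d : ℝ) * n = n.choose d * ((n - d : ℕ) : ℝ) := by exact_mod_cast h1
    have h3 : (n : ℝ) - k ≤ ((n - d : ℕ) : ℝ) := by
      rw [Nat.cast_sub (by omega)]
      have : (d : ℝ) ≤ k := by exact_mod_cast hd.le
      linarith
    rw [div_mul_eq_mul_div, le_div_iff₀ hnk, mul_comm (n : ℝ), h2]
    gcongr
  have hp : (1 - s) ^ (n - 2 - 2 * d) ≤ ((1 - s) ^ k)⁻¹ * (1 - s) ^ (n - 1 - d) := by
    rw [inv_mul_eq_div, le_div_iff₀ (by positivity), ← pow_add]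
    exact pow_le_pow_of_le_one h1s.le (by linarith) (by omega)
  calc (n.choose d : ℝ) * s ^ d * (1 - s) ^ (n - 2 - 2 * d)
      ≤ (n / (n - k) * (n - 1).choose d) * s ^ d * (((1 - s) ^ k)⁻¹ * (1 - s) ^ (n - 1 - d)) := by
        gcongr
    _ = _ := by ring

/-- One neighbour fewer costs a factor of order `1 / (n * s)`. Its square makes the contribution of
adjacent pairs negligible. -/
theorem choose_pred_mul_pow_le {d k : ℕ} {s : ℝ} (hd0 : d ≠ 0) (hd : d < k)
    (hkn : 2 * k + 2 ≤ n) (hs0 : 0 < s) (hs1 : s < 1) :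
    (n.choose (d - 1) : ℝ) * s ^ (d - 1) * (1 - s) ^ (n - 2 - 2 * (d - 1)) ≤
      2 * k / (n * s) * (n.choose d * s ^ d * (1 - s) ^ (n - 2 - 2 * d)) := by
  obtain ⟨e, rfl⟩ := Nat.exists_eq_succ_of_ne_zero hd0
  rw [Nat.succ_eq_add_one, Nat.add_sub_cancel]
  have h1s : 0 < 1 - s := by linarith
  have hnr : (0 : ℝ) < n := by exact_mod_cast (by omega : 0 < n)
  have hc : (n.choose e : ℝ) * n ≤ 2 * k * n.choose (e + 1) := by
    have h1 := Nat.choose_succ_right_eq n e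
    have h2 : (n.choose (e + 1) : ℝ) * (e + 1) = n.choose e * ((n - e : ℕ) : ℝ) := by
      exact_mod_cast h1
    have h3 : (n : ℝ) ≤ 2 * ((n - e : ℕ) : ℝ) := by exact_mod_cast (by omega : n ≤ 2 * (n - e))
    have h4 : ((e : ℝ) + 1) ≤ k := by exact_mod_cast hd.le
    calc (n.choose e : ℝ) * n ≤ n.choose e * (2 * ((n - e : ℕ) : ℝ)) := by gcongr
      _ = 2 * (e + 1) * n.choose (e + 1) := by linarith
      _ ≤ _ := by gcongr
  have hp : (1 - s) ^ (n - 2 - 2 * e) ≤ (1 - s) ^ (n - 2 - 2 * (e + 1)) :=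
    pow_le_pow_of_le_one h1s.le (by linarith) (by omega)
  rw [div_mul_eq_mul_div, le_div_iff₀ (by positivity)]
  calc (n.choose e : ℝ) * s ^ e * (1 - s) ^ (n - 2 - 2 * e) * (n * s)
      = (n.choose e * n) * s ^ (e + 1) * (1 - s) ^ (n - 2 - 2 * e) := by ring
    _ ≤ (2 * k * n.choose (e + 1)) * s ^ (e + 1) * (1 - s) ^ (n - 2 - 2 * (e + 1)) := by gcongr
    _ = _ := by ring

/-- Arranged so that under the hypotheses of part (a) the first term tends to 0, while the product
before the final `- 1` tends to 1. -/
theorem probKConnected_le_secondMoment {μ : Fin (m + 1) → ℝ} (hμ1 : ∑ i, μ i = 1)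
    {K : Fin (m + 1) → ℕ} (hK : ∀ i, K i ≤ P) (α : unitInterval)
    {c₀ : ℝ} (hc₀ : 0 < c₀) (hc : ∀ j, c₀ ≤ μ j)
    {s : ℝ} (hs : s = (α : ℝ) * hitProb μ K P (K 0)) (hs0 : 0 < s) (hs1 : s < 1)
    {d k : ℕ} (hd : d < k) (hkn : 2 * k + 2 ≤ n) {η Ψ : ℝ}
    (hη0 : 0 ≤ η) (hη : d ≠ 0 → (2 * k / (n * s)) ^ 2 ≤ η)
    (hΨ : (d : ℝ) ^ 2 / n + n * (s ^ 2 / (1 - s) ^ 2) ≤ Ψ) :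
    probKConnected k n μ K P α ≤
      1 / (n * (μ 0 * ((n - 1).choose d * s ^ d * (1 - s) ^ (n - 1 - d)))) +
      (n / (n - k) * ((1 - s) ^ k)⁻¹) ^ 2 * (1 + η) *
        Real.exp (Ψ / c₀ + (Real.exp (Ψ * (meanRingDensity μ K P / hitProb μ K P (K 0) ^ 2)) - 1) *
        ((K 0 : ℝ) * K 0 / P)) - 1 := by
  have hμ : ∀ i, 0 ≤ μ i := fun i => hc₀.le.trans (hc i)
  have hμ0 : 0 < μ 0 := hc₀.trans_le (hc 0)
  have := isProbabilityMeasure_modelLaw (n := n) hμ hμ1 hK α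
  have h1s : 0 < 1 - s := by linarith
  have hlam : 0 < hitProb μ K P (K 0) := by
    refine lt_of_le_of_ne (hitProb_nonneg hμ _ _ _) fun h => ?_
    rw [← h, mul_zero] at hs
    exact hs0.ne' hs
  set W := Real.exp (Ψ / c₀ + (Real.exp (Ψ * (meanRingDensity μ K P /
    hitProb μ K P (K 0) ^ 2)) - 1) * ((K 0 : ℝ) * K 0 / P)) with hW
  set D : ℝ := n / (n - k) * ((1 - s) ^ k)⁻¹ with hD
  set q := μ 0 * ((n - 1).choose d * s ^ d * (1 - s) ^ (n - 1 - d)) with hq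
  have hq0 : 0 < q := by
    have : (0 : ℝ) < (n - 1).choose d := by exact_mod_cast Nat.choose_pos (by omega)
    positivity
  set N : ℕ → ℝ := fun a => n.choose a * s ^ a * (1 - s) ^ (n - 2 - 2 * a) with hN
  have hN0 : ∀ a, 0 ≤ N a := fun a => by positivity
  have hND : μ 0 * N d ≤ D * q := by
    have := mul_le_mul_of_nonneg_left (choose_mul_pow_le_of_lt hd hkn hs0.le hs1) hμ0.le
    calc _ ≤ _ := this
      _ = _ := by rw [hq, hD]; ring
  have hsmall : ∀ a ≤ d, ∀ u v : Fin n, u ≠ v →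
      (modelLaw n μ K P α).real (pairDegree a u v) ≤ (μ 0 * N a) ^ 2 * W := by
    intro a ha u v huv
    refine modelLaw_real_pair_degree_le hμ hμ1 hK α hc₀ hc hlam hs hs1 huv (by omega)
      (le_trans ?_ hΨ)
    have : (a : ℝ) ≤ d := by exact_mod_cast ha
    gcongr
  have hpair : ∀ u v : Fin n, u ≠ v →
      (modelLaw n μ K P α).real (hasDegree d u ∩ hasDegree d v) ≤ (D * q) ^ 2 * (1 + η) * W := by
    intro u v huv
    have h1 := measureReal_mono (μ := modelLaw n μ K P α) (hasDegree_inter_subset (d := d)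
      (u := u) (v := v)) (measure_ne_top _ _)
    refine h1.trans ((measureReal_union_le _ _).trans ?_)
    have h2 := hsmall d le_rfl u v huv
    have h3 : (μ 0 * N d) ^ 2 ≤ (D * q) ^ 2 :=
      pow_le_pow_left₀ (mul_nonneg hμ0.le (hN0 d)) hND 2
    have hW0 : 0 ≤ W := (Real.exp_pos _).le
    have h4 : (modelLaw n μ K P α).real
        (if d = 0 then ∅ else pairDegree (d - 1) u v) ≤ (D * q) ^ 2 * η * W := by
      split_ifs with h
      · simp only [measureReal_empty]
        positivity
      · refine (hsmall (d - 1) (by omega) u v huv).trans ?_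
        refine mul_le_mul_of_nonneg_right ?_ hW0
        have h5 : N (d - 1) ≤ 2 * k / (n * s) * N d := choose_pred_mul_pow_le h hd hkn hs0 hs1
        calc (μ 0 * N (d - 1)) ^ 2 ≤ (μ 0 * (2 * k / (n * s) * N d)) ^ 2 :=
              pow_le_pow_left₀ (mul_nonneg hμ0.le (hN0 _))
                (mul_le_mul_of_nonneg_left h5 hμ0.le) 2
          _ = (μ 0 * N d) ^ 2 * (2 * k / (n * s)) ^ 2 := by ring
          _ ≤ (D * q) ^ 2 * η := mul_le_mul h3 (hη h) (by positivity) (by positivity)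
    have h6 := mul_le_mul_of_nonneg_right h3 hW0
    calc _ ≤ (D * q) ^ 2 * W + (D * q) ^ 2 * η * W := add_le_add (h2.trans h6) h4
      _ = _ := by ring
  have hmain := measureReal_forall_notMem_le (modelLaw n μ K P α) (by omega : 0 < n)
    (fun u => hasDegree d u) hq0 (p := (D * q) ^ 2 * (1 + η) * W) (by positivity)
    (fun u => by rw [modelLaw_real_hasDegree hμ hμ1 hK α d u, hq, hs]) hpair
  refine (probKConnected_le_hasDegree hμ hμ1 hK α hd).trans (hmain.trans (le_of_eq ?_))
  congr 2
  field_simp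

end LowDegree

end RandomKeyGraph

namespace RandomKeyGraph

open MeasureTheory ProbabilityTheory

/-! ### Sharper comparisons when the class-0 hitting probability is small. -/

section Sparse

variable {m P : ℕ} {μ : Fin (m + 1) → ℝ} {K : Fin (m + 1) → ℕ} {c₀ : ℝ}

/-- A small `hitProb` forces `t ≤ 1 / 4`, where `1 - 1 / (1 + t) ≥ 4 / 5 * t`. The general factor 2
would be too weak: this constant enters an exponent that has to stay below `log n`. -/
theorem mul_div_pool_le_firstEdgeProb (hc₀ : 0 < c₀) (hc : ∀ j, c₀ ≤ μ j) (hK : ∀ i, K i ≤ P)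
    (hlam : hitProb μ K P (K 0) ≤ c₀ / 8) (j : Fin (m + 1)) :
    (K 0 : ℝ) * K j / P ≤ 5 / 4 * firstEdgeProb K P j := by
  have hμ : ∀ i, 0 ≤ μ i := fun i => hc₀.le.trans (hc i)
  have h1 : firstEdgeProb K P j ≤ 1 / 8 := by
    have h2 := mul_le_mul_of_nonneg_right (hc j) (firstEdgeProb_nonneg K P j)
    have h3 := mul_firstEdgeProb_le_hitProb (K := K) (P := P) hμ j
    have h4 : c₀ * firstEdgeProb K P j ≤ c₀ * (1 / 8) := by linarith
    exact le_of_mul_le_mul_left h4 hc₀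
  have h2 := half_min_le_firstEdgeProb hK j
  set t := (K 0 : ℝ) * K j / P with ht
  have ht0 : 0 ≤ t := by positivity
  have ht4 : t ≤ 1 / 4 := by
    by_contra hcon
    push Not at hcon
    have : 1 / 4 < min 1 t := lt_min (by norm_num) hcon
    linarith
  have h3 : Real.exp (-t) ≤ 1 / (1 + t) := by
    rw [Real.exp_neg, ← one_div]
    exact one_div_le_one_div_of_le (by linarith) (by linarith [Real.add_one_le_exp t])
  have h4 : 1 - 1 / (1 + t) ≤ firstEdgeProb K P j := by
    have := missProb_le_exp (hK j) (hK 0)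
    unfold firstEdgeProb
    linarith
  have h5 : 4 / 5 * t ≤ 1 - 1 / (1 + t) := by
    have : 1 - 1 / (1 + t) = t / (1 + t) := by field_simp; ring
    rw [this, le_div_iff₀ (by linarith)]
    nlinarith
  linarith

theorem mul_meanRingDensity_le (hc₀ : 0 < c₀) (hc : ∀ j, c₀ ≤ μ j) (hK : ∀ i, K i ≤ P)
    (hlam : hitProb μ K P (K 0) ≤ c₀ / 8) :
    (K 0 : ℝ) * meanRingDensity μ K P ≤ 5 / 4 * hitProb μ K P (K 0) := by
  rw [hitProb_zero_eq, meanRingDensity, Finset.mul_sum, Finset.mul_sum]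
  refine Finset.sum_le_sum fun j _ => ?_
  have := mul_le_mul_of_nonneg_left (mul_div_pool_le_firstEdgeProb hc₀ hc hK hlam j)
    (hc₀.le.trans (hc j))
  calc _ = μ j * ((K 0 : ℝ) * K j / P) := by ring
    _ ≤ _ := this
    _ = _ := by ring

theorem sq_div_pool_le (hc₀ : 0 < c₀) (hc : ∀ j, c₀ ≤ μ j) (hK : ∀ i, K i ≤ P)
    (hlam : hitProb μ K P (K 0) ≤ c₀ / 8) :
    (K 0 : ℝ) * K 0 / P ≤ 2 / c₀ * hitProb μ K P (K 0) := by
  have h1 := mul_div_pool_le_firstEdgeProb hc₀ hc hK hlam 0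
  have h2 := mul_le_mul_of_nonneg_right (hc 0) (firstEdgeProb_nonneg K P 0)
  have h3 := mul_firstEdgeProb_le_hitProb (K := K) (P := P) (fun i => hc₀.le.trans (hc i)) 0
  have h4 := firstEdgeProb_nonneg K P 0
  rw [div_mul_eq_mul_div, le_div_iff₀ hc₀]
  nlinarith

theorem hitProb_zero_pos (hc₀ : 0 < c₀) (hc : ∀ j, c₀ ≤ μ j) (hK : ∀ i, K i ≤ P)
    (h0 : 0 < K 0) : 0 < hitProb μ K P (K 0) := by
  have hP : (0 : ℝ) < P := by exact_mod_cast h0.trans_le (hK 0)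
  have h0r : (0 : ℝ) < K 0 := by exact_mod_cast h0
  have h1 : 0 < firstEdgeProb K P 0 :=
    lt_of_lt_of_le (by positivity) (half_min_le_firstEdgeProb hK 0)
  exact (mul_pos (hc₀.trans_le (hc 0)) h1).trans_le
    (mul_firstEdgeProb_le_hitProb (fun i => hc₀.le.trans (hc i)) 0)

/-- From `1 - s ≥ exp (-(s / (1 - s)))`, whose exponent times `n` exceeds `n * s` by `n * s ^ 2 / (1
- s) ≤ 1`; the factor `exp 1` covers this excess. Since `d < k` and `2 * k + 2 ≤ n`, the binomial
coefficient keeps the order `n ^ d`. -/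
theorem exp_neg_le_choose_mul_pow {n d k : ℕ} {s : ℝ} (hd : d < k) (hkn : 2 * k + 2 ≤ n)
    (hs0 : 0 ≤ s) (hs : s ≤ 1 / 2) (hns : n * s * s ≤ 1 / 2) :
    (2 ^ k * k.factorial * Real.exp 1)⁻¹ * ((n * s) ^ d * Real.exp (-(n * s))) ≤
      (n - 1).choose d * s ^ d * (1 - s) ^ (n - 1 - d) := by
  have hnr : (0 : ℝ) < n := by exact_mod_cast (by omega : 0 < n)
  have h1s : 0 < 1 - s := by linarith
  have hch : (2 ^ k * k.factorial : ℝ)⁻¹ * (n : ℝ) ^ d ≤ (n - 1).choose d := by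
    have h1 := Nat.pow_le_choose (α := ℝ) d (n - 1)
    have h2 : (n : ℝ) / 2 ≤ ((n - 1 + 1 - d : ℕ) : ℝ) := by
      have : (n : ℝ) ≤ 2 * ((n - 1 + 1 - d : ℕ) : ℝ) := by
        exact_mod_cast (by omega : n ≤ 2 * (n - 1 + 1 - d))
      linarith
    have h3 : (d.factorial : ℝ) ≤ k.factorial := by exact_mod_cast Nat.factorial_le hd.le
    have h4 : (2 : ℝ) ^ d ≤ 2 ^ k := pow_le_pow_right₀ (by norm_num) hd.le
    calc (2 ^ k * k.factorial : ℝ)⁻¹ * (n : ℝ) ^ d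
        ≤ (2 ^ d * d.factorial : ℝ)⁻¹ * (n : ℝ) ^ d := by gcongr
      _ = ((n : ℝ) / 2) ^ d / d.factorial := by rw [div_pow]; field_simp
      _ ≤ ((n - 1 + 1 - d : ℕ) : ℝ) ^ d / d.factorial := by gcongr
      _ ≤ _ := by exact_mod_cast h1
  have hpow : (Real.exp 1)⁻¹ * Real.exp (-(n * s)) ≤ (1 - s) ^ (n - 1 - d) := by
    have h1 : Real.exp (-(s / (1 - s))) ≤ 1 - s := by
      rw [Real.exp_neg, inv_le_comm₀ (Real.exp_pos _) h1s]
      have := Real.add_one_le_exp (s / (1 - s))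
      have h2 : s / (1 - s) + 1 = (1 - s)⁻¹ := by field_simp; ring
      linarith
    calc (Real.exp 1)⁻¹ * Real.exp (-(n * s)) = Real.exp (-1 + -(n * s)) := by
          rw [Real.exp_add, Real.exp_neg 1]
      _ ≤ Real.exp (n * (-(s / (1 - s)))) := by
          rw [Real.exp_le_exp]
          have h2 : (n : ℝ) * (s / (1 - s)) = n * s + n * s * s / (1 - s) := by field_simp; ring
          have h3 : n * s * s / (1 - s) ≤ 1 := by rw [div_le_one h1s]; linarith
          linarith
      _ ≤ (1 - s) ^ n := by
          rw [Real.exp_nat_mul]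
          exact pow_le_pow_left₀ (Real.exp_pos _).le h1 n
      _ ≤ _ := pow_le_pow_of_le_one h1s.le (by linarith) (by omega)
  calc (2 ^ k * k.factorial * Real.exp 1)⁻¹ * ((n * s) ^ d * Real.exp (-(n * s)))
      = ((2 ^ k * k.factorial : ℝ)⁻¹ * (n : ℝ) ^ d) * s ^ d *
          ((Real.exp 1)⁻¹ * Real.exp (-(n * s))) := by
        rw [mul_inv, mul_pow]; ring
    _ ≤ _ := by gcongr

/-- If `a ≤ 1 / l`, then `a * X` is bounded and the smallness of `lam` decides. Otherwise `lam ≤ X *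
l / n` is of order `l ^ 2 / n`, and the exponential is at most `n ^ (4 / 5)`, because `7 / 10 * (11
/ 10) ≤ 4 / 5`. -/
theorem exp_mul_le_of_sparse {a lam X l n : ℝ} (ha1 : a ≤ 1) (hX0 : 0 ≤ X)
    (hX : X ≤ 11 / 10 * l) (hl : 1 ≤ l) (hn : n = Real.exp l) (hXn : X = n * (a * lam))
    (hlam : 0 ≤ lam) :
    Real.exp (7 / 10 * (a * X)) * lam ≤ Real.exp 2 * lam + 2 * l ^ 2 * Real.exp (-(l / 5)) := by
  have hl0 : 0 < l := by linarith
  rcases le_total a (1 / l) with h | h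
  · have h1 : a * X ≤ 11 / 10 := by
      calc a * X ≤ 1 / l * (11 / 10 * l) := mul_le_mul h hX hX0 (by positivity)
        _ = 11 / 10 := by field_simp
    have h2 : Real.exp (7 / 10 * (a * X)) ≤ Real.exp 2 := Real.exp_le_exp.2 (by linarith)
    have h3 := mul_le_mul_of_nonneg_right h2 hlam
    have : 0 ≤ 2 * l ^ 2 * Real.exp (-(l / 5)) := by positivity
    linarith
  · have hn0 : 0 < n := by rw [hn]; exact Real.exp_pos _
    have h1 : lam ≤ 2 * l ^ 2 * Real.exp (-l) := by
      rw [div_le_iff₀ hl0] at h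
      have h2 : n * lam ≤ X * l := by
        rw [hXn]
        have := mul_le_mul_of_nonneg_left h (mul_nonneg hn0.le hlam)
        linarith
      have h3 : Real.exp (-l) * n = 1 := by rw [hn, ← Real.exp_add]; simp
      calc lam = Real.exp (-l) * (n * lam) := by rw [← mul_assoc, h3, one_mul]
        _ ≤ Real.exp (-l) * (11 / 10 * l * l) := by
            refine mul_le_mul_of_nonneg_left (h2.trans ?_) (Real.exp_pos _).le
            gcongr
        _ ≤ 2 * l ^ 2 * Real.exp (-l) := by
            nlinarith [mul_nonneg (sq_nonneg l) (Real.exp_pos (-l)).le]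
    have h2 : Real.exp (7 / 10 * (a * X)) ≤ Real.exp (4 / 5 * l) := by
      rw [Real.exp_le_exp]
      nlinarith
    calc Real.exp (7 / 10 * (a * X)) * lam
        ≤ Real.exp (4 / 5 * l) * (2 * l ^ 2 * Real.exp (-l)) :=
          mul_le_mul h2 h1 hlam (Real.exp_pos _).le
      _ = 2 * l ^ 2 * Real.exp (-(l / 5)) := by
          rw [mul_left_comm, ← Real.exp_add]; ring_nf
      _ ≤ _ := by
          have : 0 ≤ Real.exp 2 * lam := by positivity
          linarith

end Sparse

/-! ### Below the threshold. -/

section NotConnected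

open Filter Asymptotics Topology

set_option maxHeartbeats 400000 in
theorem tendsto_probKConnected_zero {m k : ℕ} (hk : 1 ≤ k) {μ : Fin (m + 1) → ℝ}
    (hμ_pos : ∀ i, 0 < μ i) (hμ1 : ∑ i, μ i = 1)
    {K : ℕ → Fin (m + 1) → ℕ} {P : ℕ → ℕ} (hKP : IsKeyScaling K P)
    {α : ℕ → unitInterval} (hα : ∀ n, 0 < (α n : ℝ)) {γ : ℕ → ℝ}
    (hγ : ∀ n : ℕ, 2 ≤ n → (α n : ℝ) * hitProb μ (K n) (P n) (K n 0) =
      (Real.log n + ((k : ℝ) - 1) * Real.log (Real.log n) + γ n) / n)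
    (hlam : Tendsto (fun n => hitProb μ (K n) (P n) (K n 0)) atTop (𝓝 0))
    (hγbot : Tendsto γ atTop atBot) :
    Tendsto (fun n : ℕ => probKConnected k n μ (K n) (P n) (α n)) atTop (𝓝 0) := by
  have hμ : ∀ i, 0 ≤ μ i := fun i => (hμ_pos i).le
  have hk1 : (1 : ℝ) ≤ k := by exact_mod_cast hk
  obtain ⟨c₀, hc₀, hc₀μ⟩ : ∃ c₀ : ℝ, 0 < c₀ ∧ ∀ j, c₀ ≤ μ j := by
    obtain ⟨i, hi⟩ := Finite.exists_min μ
    exact ⟨μ i, hμ_pos i, hi⟩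
  have hlog1 : ∀ᶠ n : ℕ in atTop, 1 ≤ Real.log n := tendsto_log_natCast.eventually_ge_atTop 1
  set lam : ℕ → ℝ := fun n => hitProb μ (K n) (P n) (K n 0) with hlamdef
  set s : ℕ → ℝ := fun n => (α n : ℝ) * lam n with hsdef
  have hlam0 : ∀ n, 0 ≤ lam n := fun n => hitProb_nonneg hμ _ _ _
  have hs0 : ∀ n, 0 ≤ s n := fun n => mul_nonneg (hα n).le (hlam0 n)
  have hst : Tendsto s atTop (𝓝 0) :=
    squeeze_zero hs0 (fun n => mul_le_of_le_one_left (hlam0 n) (α n).2.2) hlam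
  have hX : ∀ n : ℕ, 2 ≤ n →
      n * s n = Real.log n + ((k : ℝ) - 1) * Real.log (Real.log n) + γ n := by
    intro n hn
    have : (0 : ℝ) < n := by exact_mod_cast (by omega : 0 < n)
    simp only [hsdef, hlamdef]
    rw [hγ n hn]
    field_simp
  have hXle : ∀ᶠ n : ℕ in atTop, n * s n ≤ 11 / 10 * Real.log n := by
    have h1 := tendsto_log_natCast.eventually (Real.isLittleO_log_id_atTop.def
      (by positivity : (0 : ℝ) < 1 / (10 * k)))
    filter_upwards [h1, hlog1, hγbot.eventually_le_atBot 0, eventually_ge_atTop 2] with n h hl hg hn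
    rw [Real.norm_of_nonneg (Real.log_nonneg hl), id, Real.norm_of_nonneg (by linarith)] at h
    rw [hX n hn]
    have h2 : (k : ℝ) * (1 / (10 * k) * Real.log n) = 1 / 10 * Real.log n := by field_simp
    nlinarith [mul_le_mul_of_nonneg_left h (by positivity : (0 : ℝ) ≤ k), Real.log_nonneg hl]
  -- Far below the threshold nodes of degree `k - 1` may be rare, but isolated ones abound. When `X
  -- > log n / 2` the degree `k - 1` works, and `2 * k / X` is small as needed for adjacent pairs.
  set d : ℕ → ℕ := fun n => if n * s n ≤ Real.log n / 2 then 0 else k - 1 with hddef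
  have hdk : ∀ n, d n < k := fun n => by simp only [hddef]; split_ifs <;> omega
  have hdX : ∀ n, d n ≠ 0 → Real.log n / 2 < n * s n := fun n h => by
    simp only [hddef] at h
    split_ifs at h with h1
    · exact absurd rfl h
    · exact not_le.1 h1
  -- `111 / 100` is `1 / 100` from `d ≤ X / 10` plus `11 / 10`, which bounds `(1 - s) ^ (-2)` for `s
  -- ≤ 1 / 25`.
  set Ψ : ℕ → ℝ := fun n => 111 / 100 * ((n * s n) ^ 2 / n) with hΨdef
  set η : ℕ → ℝ := fun n => (4 * k / Real.log n) ^ 2 with hηdef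
  set B : ℕ → ℝ := fun n => Ψ n / c₀ + 2 / c₀ *
    (Real.exp 2 * lam n + 2 * Real.log n ^ 2 * Real.exp (-(Real.log n / 5))) with hBdef
  set Cq : ℝ := 2 ^ k * k.factorial * Real.exp 1 / μ 0 with hCq
  have hbound : ∀ᶠ n : ℕ in atTop, probKConnected k n μ (K n) (P n) (α n) ≤
      Cq * (Real.exp (-(Real.log n / 2)) + 2 ^ k * Real.exp (γ n)) +
      (n / (n - k) * ((1 - s n) ^ k)⁻¹) ^ 2 * (1 + η n) * Real.exp (B n) - 1 := by
    have hXs : ∀ᶠ n : ℕ in atTop, n * s n * s n ≤ 1 / 2 := by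
      have h1 := tendsto_log_natCast.eventually (eventually_mul_pow_le_exp (2 * (11 / 10) ^ 2)
        one_pos 2)
      filter_upwards [h1, hXle, eventually_ge_atTop 1] with n h1 h2 hn
      have hnr : (0 : ℝ) < n := by exact_mod_cast hn
      rw [one_mul, Real.exp_log hnr] at h1
      have h3 : (n * s n) ^ 2 ≤ (11 / 10 * Real.log n) ^ 2 :=
        pow_le_pow_left₀ (mul_nonneg hnr.le (hs0 n)) h2 2
      have h4 : (n : ℝ) * (n * s n * s n) ≤ n * (1 / 2) := by nlinarith
      exact le_of_mul_le_mul_left h4 hnr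
    filter_upwards [hXle, hXs, hlog1, eventually_ge_atTop (2 * k + 2),
      hst.eventually (ge_mem_nhds (by norm_num : (0 : ℝ) < 1 / 25)),
      hlam.eventually (ge_mem_nhds (by positivity : 0 < c₀ / 8)),
      tendsto_log_natCast.eventually_ge_atTop (20 * k : ℝ)] with n hXl hXs hl hkn hs hl8 hl20
    have hn2 : 2 ≤ n := by omega
    have hnr : (0 : ℝ) < n := by exact_mod_cast (by omega : 0 < n)
    obtain ⟨h2, hmono, h3⟩ := hKP n hn2
    have hKle : ∀ i, K n i ≤ P n := fun i => (hmono (Fin.le_last i)).trans (by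
      have : (K n (Fin.last m) : ℝ) ≤ P n := h3.trans (by linarith [(P n).cast_nonneg (α := ℝ)])
      exact_mod_cast this)
    have hlamp : 0 < lam n := hitProb_zero_pos hc₀ hc₀μ hKle (by omega)
    have hsp : 0 < s n := mul_pos (hα n) hlamp
    have hXp : 0 < n * s n := by positivity
    have h1s : 0 < 1 - s n := by linarith
    have hd2 : (d n : ℝ) ^ 2 ≤ (n * s n) ^ 2 / 100 := by
      by_cases h : d n = 0
      · rw [h, Nat.cast_zero, zero_pow two_ne_zero]
        positivity
      · have h4 := hdX n h
        have h5 : (d n : ℝ) ≤ k := by exact_mod_cast (hdk n).le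
        have h6 : (d n : ℝ) ≤ n * s n / 10 := by linarith
        have := pow_le_pow_left₀ (by positivity) h6 2
        rw [div_pow] at this
        norm_num at this ⊢
        exact this
    have hΨle : (d n : ℝ) ^ 2 / n + n * (s n ^ 2 / (1 - s n) ^ 2) ≤ Ψ n := by
      have h4 : s n ^ 2 / (1 - s n) ^ 2 ≤ 11 / 10 * s n ^ 2 := by
        rw [div_le_iff₀ (by positivity)]
        have : 1 ≤ 11 / 10 * (1 - s n) ^ 2 := by nlinarith
        nlinarith [sq_nonneg (s n)]
      calc (d n : ℝ) ^ 2 / n + n * (s n ^ 2 / (1 - s n) ^ 2)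
          ≤ (n * s n) ^ 2 / 100 / n + n * (11 / 10 * s n ^ 2) := by gcongr
        _ = Ψ n := by simp only [hΨdef]; field_simp; ring
    have hηle : d n ≠ 0 → (2 * k / (n * s n)) ^ 2 ≤ η n := by
      intro h
      have h4 := hdX n h
      refine pow_le_pow_left₀ (by positivity) ?_ 2
      rw [div_le_div_iff₀ hXp (by linarith)]
      nlinarith
    have hmain := probKConnected_le_secondMoment hμ1 hKle (α n) hc₀ hc₀μ (s := s n) rfl hsp
      (by linarith) (hdk n) hkn (by positivity : 0 ≤ η n) hηle hΨle
    refine hmain.trans ?_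
    have hq := exp_neg_le_choose_mul_pow (hdk n) hkn hsp.le (by linarith) hXs
    have hl0 : 0 < Real.log n := by linarith
    have hnexp : (n : ℝ) = Real.exp (Real.log n) := (Real.exp_log hnr).symm
    have hμ0 := hμ_pos 0
    have hA : 1 / (n * (μ 0 * ((n - 1).choose (d n) * s n ^ d n * (1 - s n) ^ (n - 1 - d n)))) ≤
        Cq * (Real.exp (-(Real.log n / 2)) + 2 ^ k * Real.exp (γ n)) := by
      -- For `d = 0` the expected count is of order at least `n * exp (-X) ≥ √n`. For `d = k - 1`
      -- the form of `X` turns it into `(X / log n) ^ (k - 1) * exp (-γ)`, with `X / log n > 1 / 2`.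
      have h4 : (n * ((n * s n) ^ d n * Real.exp (-(n * s n))))⁻¹ ≤
          Real.exp (-(Real.log n / 2)) + 2 ^ k * Real.exp (γ n) := by
        by_cases h : n * s n ≤ Real.log n / 2
        · have h5 : d n = 0 := by simp only [hddef, h, if_true]
          rw [h5, pow_zero, one_mul]
          have h6 : (n * Real.exp (-(n * s n)))⁻¹ ≤ Real.exp (-(Real.log n / 2)) := by
            nth_rw 1 [hnexp]
            rw [← Real.exp_add, ← Real.exp_neg, Real.exp_le_exp]
            linarith
          have : 0 ≤ (2 : ℝ) ^ k * Real.exp (γ n) := by positivity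
          linarith
        · have h5 : d n = k - 1 := by simp only [hddef, h, if_false]
          push Not at h
          rw [h5]
          have h6 : Real.exp (n * s n) = n * (Real.log n ^ (k - 1) * Real.exp (γ n)) := by
            have h7 : Real.log n ^ (k - 1) = Real.exp (((k : ℝ) - 1) * Real.log (Real.log n)) := by
              rw [show ((k : ℝ) - 1) = ((k - 1 : ℕ) : ℝ) by rw [Nat.cast_sub hk]; simp,
                Real.exp_nat_mul, Real.exp_log hl0]
            rw [hX n hn2, h7, Real.exp_add, Real.exp_add, Real.exp_log hnr]
            ring
          have h8 : (n * ((n * s n) ^ (k - 1) * Real.exp (-(n * s n))))⁻¹ =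
              (Real.log n / (n * s n)) ^ (k - 1) * Real.exp (γ n) := by
            rw [Real.exp_neg, h6, div_pow]
            field_simp
          have h9 : Real.log n / (n * s n) ≤ 2 := by rw [div_le_iff₀ hXp]; linarith
          have h10 : (Real.log n / (n * s n)) ^ (k - 1) ≤ 2 ^ k :=
            (pow_le_pow_left₀ (by positivity) h9 _).trans
              (pow_le_pow_right₀ (by norm_num) (by omega))
          rw [h8]
          have h11 := mul_le_mul_of_nonneg_right h10 (Real.exp_pos (γ n)).le
          have := Real.exp_pos (-(Real.log n / 2))
          linarith
      have h12 : 1 / (n * (μ 0 * ((n - 1).choose (d n) * s n ^ d n *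
          (1 - s n) ^ (n - 1 - d n)))) ≤ 1 / (n * (μ 0 * ((2 ^ k * k.factorial * Real.exp 1)⁻¹ *
          ((n * s n) ^ d n * Real.exp (-(n * s n)))))) := by
        refine one_div_le_one_div_of_le (by positivity) ?_
        gcongr
      refine h12.trans ?_
      calc _ = Cq * (n * ((n * s n) ^ d n * Real.exp (-(n * s n))))⁻¹ := by
            rw [hCq]; field_simp
        _ ≤ _ := mul_le_mul_of_nonneg_left h4 (by positivity)
    have hE : Ψ n / c₀ + (Real.exp (Ψ n * (meanRingDensity μ (K n) (P n) / lam n ^ 2)) - 1) *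
        ((K n 0 : ℝ) * K n 0 / P n) ≤ B n := by
      have hκ := mul_meanRingDensity_le hc₀ hc₀μ hKle hl8
      have hκ0 := meanRingDensity_nonneg hμ (K n) (P n)
      have hsq := sq_div_pool_le hc₀ hc₀μ hKle hl8
      -- Rings of at least two keys halve the density relative to `lam`; then `111 / 100 * (5 / 8) ≤
      -- 7 / 10`.
      have h4 : meanRingDensity μ (K n) (P n) ≤ 5 / 8 * lam n := by
        have : (2 : ℝ) ≤ K n 0 := by exact_mod_cast h2
        have h5 : 2 * meanRingDensity μ (K n) (P n) ≤ 5 / 4 * lam n :=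
          (mul_le_mul_of_nonneg_right this hκ0).trans hκ
        linarith
      have h5 : Ψ n * (meanRingDensity μ (K n) (P n) / lam n ^ 2) ≤
          7 / 10 * ((α n : ℝ) * (n * s n)) := by
        calc Ψ n * (meanRingDensity μ (K n) (P n) / lam n ^ 2)
            ≤ Ψ n * (5 / 8 * lam n / lam n ^ 2) := by gcongr
          _ = 111 / 100 * (5 / 8) * ((α n : ℝ) * (n * s n)) := by
              simp only [hΨdef, hsdef]; field_simp
          _ ≤ _ := by
              have : 0 ≤ (α n : ℝ) * (n * s n) := mul_nonneg (hα n).le hXp.le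
              linarith
      have h6 := exp_mul_le_of_sparse (α n).2.2 hXp.le hXl hl hnexp
        (lam := lam n) rfl hlamp.le
      simp only [hBdef]
      refine add_le_add le_rfl ?_
      calc _ ≤ Real.exp (7 / 10 * ((α n : ℝ) * (n * s n))) * (2 / c₀ * lam n) := by
            refine mul_le_mul ?_ hsq (by positivity) (Real.exp_pos _).le
            have := Real.exp_le_exp.2 h5
            linarith
        _ = 2 / c₀ * (Real.exp (7 / 10 * ((α n : ℝ) * (n * s n))) * lam n) := by ring
        _ ≤ _ := mul_le_mul_of_nonneg_left h6 (by positivity)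
    have hexpE := Real.exp_le_exp.2 hE
    have hη0 : 0 ≤ η n := by positivity
    have := mul_le_mul_of_nonneg_left hexpE
      (by positivity : 0 ≤ ((n : ℝ) / (n - k) * ((1 - s n) ^ k)⁻¹) ^ 2 * (1 + η n))
    linarith
  have hlim : Tendsto (fun n : ℕ =>
      Cq * (Real.exp (-(Real.log n / 2)) + 2 ^ k * Real.exp (γ n)) +
      (n / (n - k) * ((1 - s n) ^ k)⁻¹) ^ 2 * (1 + η n) * Real.exp (B n) - 1) atTop (𝓝 0) := by
    have t1 : Tendsto (fun n : ℕ => Real.exp (-(Real.log n / 2))) atTop (𝓝 0) :=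
      Real.tendsto_exp_neg_atTop_nhds_zero.comp
        (tendsto_log_natCast.atTop_div_const (by norm_num : (0 : ℝ) < 2))
    have t2 : Tendsto (fun n : ℕ => Real.exp (γ n)) atTop (𝓝 0) :=
      Real.tendsto_exp_atBot.comp hγbot
    have t3 : Tendsto (fun n : ℕ => (n : ℝ) / (n - k)) atTop (𝓝 1) := by
      simpa [sub_eq_add_neg] using tendsto_natCast_div_add_atTop (-(k : ℝ))
    have t4 : Tendsto (fun n : ℕ => ((1 - s n) ^ k)⁻¹) atTop (𝓝 1) := by
      have h1 : Tendsto (fun n => (1 - s n) ^ k) atTop (𝓝 1) := by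
        simpa using (hst.const_sub 1).pow k
      simpa using h1.inv₀ one_ne_zero
    have t5 : Tendsto η atTop (𝓝 0) := by
      have h1 := (tendsto_const_nhds (x := (4 * k : ℝ))).div_atTop tendsto_log_natCast
      simpa using h1.pow 2
    have t6 : Tendsto (fun n : ℕ => Real.log n ^ 2 * Real.exp (-(Real.log n / 5))) atTop (𝓝 0) := by
      have h1 := (Real.tendsto_pow_mul_exp_neg_atTop_nhds_zero 2).comp
        (tendsto_log_natCast.atTop_div_const (by norm_num : (0 : ℝ) < 5))
      have h2 := h1.const_mul 25
      rw [mul_zero] at h2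
      refine h2.congr fun n => ?_
      simp only [Function.comp]
      ring
    have t7 : Tendsto Ψ atTop (𝓝 0) := by
      have h1 := (Real.tendsto_pow_mul_exp_neg_atTop_nhds_zero 2).comp tendsto_log_natCast
      have h2 := h1.const_mul (111 / 100 * (11 / 10) ^ 2)
      rw [mul_zero] at h2
      refine squeeze_zero' (Eventually.of_forall fun n => by positivity) ?_ h2
      filter_upwards [hXle, eventually_ge_atTop 1] with n h3 hn
      have hnr : (0 : ℝ) < n := by exact_mod_cast hn
      have h4 := pow_le_pow_left₀ (mul_nonneg hnr.le (hs0 n)) h3 2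
      simp only [Function.comp, hΨdef, Real.exp_neg, Real.exp_log hnr]
      calc 111 / 100 * ((n * s n) ^ 2 / n)
          ≤ 111 / 100 * ((11 / 10 * Real.log n) ^ 2 / n) := by gcongr
        _ = _ := by ring
    have t8 : Tendsto B atTop (𝓝 0) := by
      have h1 := (t7.div_const c₀).add (((hlam.const_mul (Real.exp 2)).add
        (t6.const_mul 2)).const_mul (2 / c₀))
      simp only [zero_div, mul_zero, add_zero] at h1
      refine h1.congr fun n => ?_
      simp only [hBdef]
      ring
    have t9 : Tendsto (fun n => Real.exp (B n)) atTop (𝓝 1) := by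
      have h1 := (Real.continuous_exp.tendsto 0).comp t8
      rwa [Real.exp_zero] at h1
    have h1 := ((t1.add (t2.const_mul (2 ^ k))).const_mul Cq).add
      ((((t3.mul t4).pow 2).mul (t5.const_add 1)).mul t9)
    have h2 := h1.sub_const 1
    simpa using h2
  exact squeeze_zero' (Eventually.of_forall fun n => measureReal_nonneg) hbound hlim

end NotConnected

end RandomKeyGraph

/-- There are `m + 1` classes; class `0` has the smallest key rings and class `Fin.last m`
the largest. -/
theorem theorem1 (m k : ℕ) (hk : 1 ≤ k)
    (μ : Fin (m + 1) → ℝ) (hμ_pos : ∀ i, 0 < μ i) (hμ_sum : ∑ i, μ i = 1)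
    (K : ℕ → Fin (m + 1) → ℕ) (P : ℕ → ℕ) (hKP : IsKeyScaling K P)
    (α : ℕ → unitInterval) (hα : ∀ n, 0 < (α n : ℝ) ∧ (α n : ℝ) < 1)
    (γ : ℕ → ℝ)
    (hγ : ∀ n : ℕ, 2 ≤ n →
      (α n : ℝ) * meanEdgeProb μ (K n) (P n) 0 =
        (Real.log n + ((k : ℝ) - 1) * Real.log (Real.log n) + γ n) / n) :
    ((fun n : ℕ => meanEdgeProb μ (K n) (P n) 0) =o[atTop] (fun _ => (1 : ℝ)) →
      Tendsto γ atTop atBot →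
      Tendsto (fun n : ℕ => probKConnected k n μ (K n) (P n) (α n)) atTop (nhds 0)) ∧
    ((fun n : ℕ => (n : ℝ)) =O[atTop] (fun n : ℕ => (P n : ℝ)) →
      (fun n : ℕ => (K n (Fin.last m) : ℝ) / (P n : ℝ)) =o[atTop] (fun _ => (1 : ℝ)) →
      (fun n : ℕ => (K n (Fin.last m) : ℝ) / (K n 0 : ℝ)) =o[atTop]
        (fun n : ℕ => Real.log n) →
      Tendsto γ atTop atTop →
      Tendsto (fun n : ℕ => probKConnected k n μ (K n) (P n) (α n)) atTop (nhds 1)) := by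
  -- For `n < 2` nothing is known about the ring sizes, so the identity is used only eventually.
  have hmean : ∀ n, 2 ≤ n →
      meanEdgeProb μ (K n) (P n) 0 = hitProb μ (K n) (P n) (K n 0) := by
    intro n hn
    obtain ⟨-, hmono, h⟩ := hKP n hn
    refine meanEdgeProb_eq (fun i => (hmono (Fin.le_last i)).trans ?_) 0
    have : (K n (Fin.last m) : ℝ) ≤ P n := h.trans (by linarith [(P n).cast_nonneg (α := ℝ)])
    exact_mod_cast this
  have hγ' : ∀ n : ℕ, 2 ≤ n → (α n : ℝ) * hitProb μ (K n) (P n) (K n 0) =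
      (Real.log n + ((k : ℝ) - 1) * Real.log (Real.log n) + γ n) / n := fun n hn => by
    rw [← hmean n hn, hγ n hn]
  refine ⟨fun hlam hbot => ?_, fun hP hsmall hratio htop => ?_⟩
  · refine tendsto_probKConnected_zero hk hμ_pos hμ_sum hKP (fun n => (hα n).1) hγ' ?_ hbot
    refine ((isLittleO_one_iff ℝ).1 hlam).congr' ?_
    filter_upwards [eventually_ge_atTop 2] with n hn
    exact hmean n hn
  · exact tendsto_probKConnected_one hk hμ_pos hμ_sum hKP hγ' hP hsmall hratio htop
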